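/- **Setting.** Let $x,y\in\mathbb C(z)$ be rational functions on $\mathbb P^1$ such that all zeros of $dx$ and of $dy$ on $\mathbb P^1$ (the ramification points of $x$, resp. of $y$) are simple, $dx$ and $dy$ have no common zero, $y$ is regular at the zeros of $dx$ and $x$ is regular at the zeros of $dy$. Let $B(z_1,z_2)=\frac{dz_1\,dz_2}{(z_1-z_2)^2}$. The differentials $\omega^{(g)}_{n,0}$ are defined by topological recursion for the spectral curve $(\mathbb P^1,x,y,B)$: $\omega^{(0)}_{1,0}=y\,dx$, $\omega^{(0)}_{2,0}=B$ and, for $2g+n\ge 2$, $I=\{z_1,\dots,z_n\}$, $$\omega^{(g)}_{n+1,0}(I,z)=\sum_{\alpha:\,dx(\alpha)=0}\operatorname*{Res}_{q\to\alpha}K_\alpha(z,q)\Big(\omega^{(g-1)}_{n+2,0}(I,q,\sigma_\alpha(q))+\sum_{\substack{g_1+g_2=g,\ I_1\uplus I_2=I\\(g_1,I_1)\ne(0,\emptyset)\ne(g_2,I_2)}}\omega^{(g_1)}_{|I_1|+1,0}(I_1,q)\,\omega^{(g_2)}_{|I_2|+1,0}(I_2,\sigma_\alpha(q))\Big),$$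 $$K_\alpha(z,q)=\frac{\frac12\int_{q'=\sigma_\alpha(q)}^{q'=q}B(z,q')}{\omega^{(0)}_{1,0}(q)-\omega^{(0)}_{1,0}(\sigma_\alpha(q))},$$ where $\sigma_\alpha\neq\mathrm{id}$ is the local involution near $\alpha$ with $x\circ\sigma_\alpha=x$ and $\sigma_\alpha(\alpha)=\alpha$, and where the term with $\omega^{(g-1)}$ is absent for $g=0$. The differentials $\omega^{(g)}_{0,m}$ are defined by the same recursion with $x$ and $y$ interchanged, that is, for the spectral curve $(\mathbb P^1,y,x,B)$. Put $$W^{(g)}_{n,0}(x(z_1),\dots,x(z_n))=\frac{\omega^{(g)}_{n,0}(z_1,\dots,z_n)}{dx(z_1)\cdots dx(z_n)},\qquad W^{(g)}_{0,m}(y(z_1),\dots,y(z_m))=\frac{\omega^{(g)}_{0,m}(z_1,\dots,z_m)}{dy(z_1)\cdots dy(z_m)},$$ and let $\hat W^{(0)}_{2,0}(x_1,x_2)=W^{(0)}_{2,0}(x_1,x_2)-\frac1{(x_1-x_2)^2}$, continued to the diagonal. For $i=1,2$ let $\zeta_i$ be a holomorphic branch of the inverse of $y$ on an open set $U_i\subset\mathbb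 C$, so that $y(\zeta_i(u))=u$ for $u\in U_i$, with values in the points of $\mathbb C$ where $x$ and $y$ are finite and $x'\ne0$, and suppose $\zeta_1(y_1)\neq\zeta_2(y_2)$ for all $y_1\in U_1$, $y_2\in U_2$. Let $X(y_i)=x(\zeta_i(y_i))$; functions of $X(y_i)$ are evaluated at the point $z_i=\zeta_i(y_i)$ of the curve. **Proposition.** For all $y_1\in U_1$, $y_2\in U_2$, \begin{align*} W^{(1)}_{0,2}(y_1,y_2)=&\frac{dX(y_1)}{dy_1}\frac{dX(y_2)}{dy_2}W^{(1)}_{2,0}(X(y_1),X(y_2))\\ &-\frac{d}{dy_1}\bigg(\frac{dX(y_1)}{dy_1}\frac{dX(y_2)}{dy_2}W^{(1)}_{1,0}(X(y_1))W^{(0)}_{2,0}(X(y_1),X(y_2))\bigg)\\ &-\frac{d}{dy_2}\bigg(\frac{dX(y_1)}{dy_1}\frac{dX(y_2)}{dy_2}W^{(1)}_{1,0}(X(y_2))W^{(0)}_{2,0}(X(y_1),X(y_2))\bigg)\\ &-\frac{1}{2}\frac{d}{dy_1}\bigg(\frac{dX(y_1)}{dy_1}\frac{dX(y_2)}{dy_2}W^{(0)}_{3,0}(X(y_1),X(y_1),X(y_2))\bigg)\\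 &-\frac{1}{2}\frac{d}{dy_2}\bigg(\frac{dX(y_1)}{dy_1}\frac{dX(y_2)}{dy_2}W^{(0)}_{3,0}(X(y_2),X(y_2),X(y_1))\bigg)\\ &+\frac{1}{2}\frac{d^2}{dy_1^2}\bigg(\frac{dX(y_1)}{dy_1}\frac{dX(y_2)}{dy_2}\hat{W}^{(0)}_{2,0}(X(y_1),X(y_1))W^{(0)}_{2,0}(X(y_1),X(y_2))\bigg)\\ &+\frac{1}{2}\frac{d^2}{dy_2^2}\bigg(\frac{dX(y_1)}{dy_1}\frac{dX(y_2)}{dy_2}\hat{W}^{(0)}_{2,0}(X(y_2),X(y_2))W^{(0)}_{2,0}(X(y_1),X(y_2))\bigg)\\ &+\frac{1}{2}\frac{d^2}{dy_1dy_2}\bigg(\frac{dX(y_1)}{dy_1}\frac{dX(y_2)}{dy_2}W^{(0)}_{2,0}(X(y_1),X(y_2))^2\bigg)\\ &+\frac{1}{24}\frac{d^3}{dy_1^3}\bigg[\bigg(\frac{dy_1}{dX(y_1)}\bigg)^2\frac{d}{dy_1}\bigg(\frac{dX(y_1)}{dy_1}\frac{dX(y_2)}{dy_2}W^{(0)}_{2,0}(X(y_1),X(y_2))\bigg)\bigg]\\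 &+\frac{1}{24}\frac{d^3}{dy_2^3}\bigg[\bigg(\frac{dy_2}{dX(y_2)}\bigg)^2\frac{d}{dy_2}\bigg(\frac{dX(y_1)}{dy_1}\frac{dX(y_2)}{dy_2}W^{(0)}_{2,0}(X(y_1),X(y_2))\bigg)\bigg]. \end{align*} -/

import Mathlib

open Filter Topology

namespace XYSwap

noncomputable section

/-- The rational function `f` as a function on the affine part of the Riemann sphere. -/
def ev (f : RatFunc ℂ) (z : ℂ) : ℂ := f.eval (RingHom.id ℂ) z

/-- Local parametrisation of the Riemann sphere `OnePoint ℂ` centred at `p`: `t ↦ a + t` at a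
finite point `a` and `t ↦ 1 / t` at the point at infinity (used for small `t ≠ 0`). -/
def chart (p : OnePoint ℂ) (t : ℂ) : ℂ := p.elim t⁻¹ (fun a => a + t)

/-- Punctured neighbourhoods of `p`, as a filter on the affine part of the sphere. -/
def punctured (p : OnePoint ℂ) : Filter ℂ := map (chart p) (𝓝[≠] 0)

/-- The order of vanishing of `f` at `p` (negative at a pole). -/
def ordAt (f : RatFunc ℂ) (p : OnePoint ℂ) : WithTop ℤ :=
  meromorphicOrderAt (fun t => ev f (chart p t)) 0

/-- The order of vanishing of the differential `df` at `p`. -/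
def ordDiffAt (f : RatFunc ℂ) (p : OnePoint ℂ) : WithTop ℤ :=
  meromorphicOrderAt (deriv (fun t => ev f (chart p t))) 0

/-- The ramification points of `f`: the zeros of `df` on the Riemann sphere. -/
def ramificationPoints (f : RatFunc ℂ) : Set (OnePoint ℂ) := {p | 0 < ordDiffAt f p}

/-- The ramification points of `x` are simple, `y` is regular there, and none of them is a
ramification point of `y`. -/
structure IsRegularAtRamification (x y : RatFunc ℂ) : Prop where
  simple : ∀ p ∈ ramificationPoints x, ordDiffAt x p = 1
  regular : ∀ p ∈ ramificationPoints x, 0 ≤ ordAt y p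
  disjoint : ∀ p ∈ ramificationPoints x, p ∉ ramificationPoints y

/-- `(ℙ¹, x, y, dz₁ dz₂ / (z₁ - z₂)²)` is a genus-zero spectral curve for which topological
recursion is defined both with respect to `x` and, after interchanging `x` and `y`, with
respect to `y`. -/
structure IsSpectralCurve (x y : RatFunc ℂ) : Prop where
  left : IsRegularAtRamification x y
  right : IsRegularAtRamification y x

/-- The residue at `p` of the differential `F(q) dq`, which is meromorphic near `p`: its integral
over small circles around `p` in the local parameter. -/
def residue (p : OnePoint ℂ) (F : ℂ → ℂ) : ℂ :=
  limUnder (𝓝[>] (0 : ℝ)) fun r =>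
    (2 * Real.pi * Complex.I)⁻¹ * ∮ t in C(0, r), F (chart p t) * deriv (chart p) t

/-- `σ` is the local Galois involution of `x` at `p`: near `p` it fixes `p` and interchanges the two
points of the fibres of `x`. At a simple ramification point this determines the germ of `σ`. -/
def IsGaloisInvolution (x : RatFunc ℂ) (p : OnePoint ℂ) (σ : ℂ → ℂ) : Prop :=
  Tendsto σ (punctured p) (punctured p) ∧
    ∀ᶠ q in punctured p, ev x (σ q) = ev x q ∧ σ q ≠ q

def galoisInvolution (x : RatFunc ℂ) (p : OnePoint ℂ) : ℂ → ℂ :=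
  Classical.epsilon (IsGaloisInvolution x p)

/-- The primitive `1 / (z - ·)` of the Bergman kernel, between two points: `∫_a^b dq / (z - q)²`. -/
def bergmanIntegral (z a b : ℂ) : ℂ := 1 / (z - b) - 1 / (z - a)

theorem hasDerivAt_bergmanIntegral {z a b : ℂ} (h : z ≠ b) :
    HasDerivAt (bergmanIntegral z a) (1 / (z - b) ^ 2) b := by
  have h0 : z - b ≠ 0 := sub_ne_zero.2 h
  have h1 : HasDerivAt (fun q : ℂ => z - q) (-1) b := by
    simpa using (hasDerivAt_id b).const_sub z
  have h2 := (h1.fun_inv h0).sub_const (1 / (z - a))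
  have h3 : (- -1 / (z - b) ^ 2 : ℂ) = 1 / (z - b) ^ 2 := by norm_num
  rw [h3] at h2
  refine h2.congr_of_eventuallyEq (Eventually.of_forall fun q => ?_)
  simp [bergmanIntegral, one_div]

theorem bergmanIntegral_self (z a : ℂ) : bergmanIntegral z a a = 0 := by
  simp [bergmanIntegral]

/-- The recursion kernel
`K(z, q) = (½ ∫_{q' = σ(q)}^{q} B(z, q')) / (y(q) dx(q) - y(σ(q)) dx(σ(q)))`
(coefficient of `dz / dq`). -/
def recursionKernel (x y : RatFunc ℂ) (σ : ℂ → ℂ) (z q : ℂ) : ℂ :=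
  (1 / 2) * bergmanIntegral z (σ q) q /
    (ev y q * deriv (ev x) q - ev y (σ q) * deriv (ev x) (σ q) * deriv σ q)

/-- The correlators of topological recursion for the spectral curve `(ℙ¹, x, y, B)`:
`omega x y g n z` is the coefficient of `dz₁ ⋯ dzₙ` in the genus-`g`, `n`-point differential.
The last of the `n + 1` points is the distinguished one, the subset `S` of the other points and `Sᶜ`
are distributed over the two factors, and `deriv σ q` is the factor that comes from the pullback of
one argument by `σ`. -/
def omega (x y : RatFunc ℂ) : (g n : ℕ) → (Fin n → ℂ) → ℂ
  | _, 0, _ => 0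
  | 0, 1, z => ev y (z 0) * deriv (ev x) (z 0)
  | 0, 2, z => 1 / (z 0 - z 1) ^ 2
  | g, n + 1, z =>
    ∑ᶠ p ∈ ramificationPoints x, residue p fun q =>
      recursionKernel x y (galoisInvolution x p) (z (Fin.last n)) q *
        deriv (galoisInvolution x p) q *
        ((if _h : 0 < g then
            omega x y (g - 1) (n + 2)
              (Fin.snoc (Fin.snoc (Fin.init z) q : Fin (n + 1) → ℂ) (galoisInvolution x p q))
          else 0) +
          ∑ S : Finset (Fin n), ∑ k : Fin (g + 1),
            if _h : ¬((k : ℕ) = 0 ∧ S = ∅) ∧ ¬(g - (k : ℕ) = 0 ∧ Sᶜ = ∅) then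
              omega x y k (S.card + 1)
                  (Fin.snoc (fun i => Fin.init z (S.orderEmbOfFin rfl i)) q) *
                omega x y (g - k) (Sᶜ.card + 1)
                  (Fin.snoc (fun i => Fin.init z (Sᶜ.orderEmbOfFin rfl i))
                    (galoisInvolution x p q))
            else 0)
termination_by g n => 2 * g + n
decreasing_by
  · omega
  · have hk := k.2
    have hS : S.card ≤ n := by simpa using S.card_le_univ
    by_cases hu : Sᶜ = ∅
    · have : ¬(g - (k : ℕ) = 0) := fun h0 => _h.2 ⟨h0, hu⟩
      omega
    · have : S.card < n := by
        have := Finset.card_lt_univ_of_notMem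
          (Finset.mem_compl.1 (Finset.nonempty_iff_ne_empty.2 hu).choose_spec)
        simpa using this
      omega
  · have hk := k.2
    have hc : Sᶜ.card + S.card = n := by
      simp
    by_cases hu : S = ∅
    · have : ¬((k : ℕ) = 0) := fun h0 => _h.1 ⟨h0, hu⟩
      omega
    · have : 0 < S.card := Finset.card_pos.2 (Finset.nonempty_iff_ne_empty.2 hu)
      omega

/-- `W x y g n z` is `W⁽ᵍ⁾_{n,0}(x(z₁), …, x(zₙ)) = ω⁽ᵍ⁾_{n,0}(z₁, …, zₙ) / (dx(z₁) ⋯ dx(zₙ))`.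
With `x` and `y` interchanged, `W y x g m z` is `W⁽ᵍ⁾_{0,m}(y(z₁), …, y(zₘ))`. -/
def W (x y : RatFunc ℂ) (g n : ℕ) (z : Fin n → ℂ) : ℂ :=
  omega x y g n z / ∏ i, deriv (ev x) (z i)

/-- The regularised diagonal `Ŵ⁽⁰⁾_{2,0}(x(z), x(z))`, where
`Ŵ⁽⁰⁾_{2,0}(x₁, x₂) = W⁽⁰⁾_{2,0}(x₁, x₂) - 1 / (x₁ - x₂)²`. -/
def WhatDiag (x y : RatFunc ℂ) (z : ℂ) : ℂ :=
  limUnder (𝓝[≠] z) fun u => W x y 0 2 ![z, u] - 1 / (ev x z - ev x u) ^ 2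

/-- `ζ` is a holomorphic branch on the open set `U` of the inverse of `y`, with values in the points
where `x` and `y` are finite and `dx` does not vanish. Then `X(y) = x(ζ(y))` is a branch of `X`. -/
structure IsInverseBranch (x y : RatFunc ℂ) (U : Set ℂ) (ζ : ℂ → ℂ) : Prop where
  isOpen : IsOpen U
  holomorphic : DifferentiableOn ℂ ζ U
  right_inv : ∀ u ∈ U, ev y (ζ u) = u
  finite_x : ∀ u ∈ U, x.denom.eval (ζ u) ≠ 0
  finite_y : ∀ u ∈ U, y.denom.eval (ζ u) ≠ 0
  unramified : ∀ u ∈ U, deriv (ev x) (ζ u) ≠ 0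

end

end XYSwap

open Filter Topology

namespace XYSwap

noncomputable section

/-! Put a = 1/x', b = 1/y' and β = 1/(w - z)², in the global coordinate of the sphere. Along an
inverse branch of y the operator d/dy is b d/dz. After multiplication by dy(w) dy(z), the right-hand
side of the formula is therefore the genus-one two-point differential for x plus an explicit
correction `swapTerm`: a z-derivative plus a w-derivative of potentials built from a, b, β, the
genus-one one-point and the genus-zero three-point differentials. With w fixed, it has to be shown
that the difference of the two sides vanishes as a differential in z. The sphere has no nonzero
holomorphic differential (`eq_zero_of_regForm`), so it suffices that this difference has no pole
(`IsSpectralCurve.omega_one_two_swap`).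

Zeros of dx. The differential for y is regular there. In a coordinate s with x = c + s² the Galois
involution is s ↦ -s. The residue in the recursion is a projection onto a principal part: up to
regular terms the differential for x is -Q(s) / (2s (Y(s) - Y(-s))), where Q is the integrand and Y
is y in the coordinate s (`Uniformizer.residue_kernel`, `reg_recursionSum_sub`). In the correction,
the change of coordinate costs only a Schwarzian in the regularised diagonal (`linearPart_comp`).
Once the regular parts of the lower correlators are split off, an identity between six Laurent
coefficients remains (`reg_swap_at_ramification`). The Bergman kernel enters it only through the
Taylor coefficients of one symmetric germ.

Zeros of dy. Here the previous case applies with x and y exchanged, provided the correction changes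
sign under the exchange (`swapTerm_add_swap`). The part of the correction that is linear in β is a
third-order operator. Its sum with the exchanged operator is ab ∂³(abβ) / 12 plus a multiplication
operator (`linearPart_add_swap`). These two terms are compensated by the exchange relations for the
one-point and three-point differentials, which the same comparison of poles proves
(`IsSpectralCurve.omega_one_one_add_swap`, `IsSpectralCurve.omega_zero_three_add_swap`). What is
left is the difference of two orders of a mixed partial derivative.

The diagonal z = w. The poles, of order up to six, of the z-derivative and of the w-derivative
cancel (`reg_swap_at_diagonal`, `reg_trapezoid`).

All other points, including infinity and the poles of x and y. An exact differential has no simple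
pole, so each of a and b is nonzero or vanishes to order at least two. Then every term is regular,
also b'²/b (`reg_inv_deriv_of_notMem`). -/

/-! ### Germs at the puncture -/

/-- `f` agrees near `0`, away from `0`, with an analytic function. -/
def Reg (f : ℂ → ℂ) : Prop := ∃ g, AnalyticAt ℂ g 0 ∧ f =ᶠ[𝓝[≠] 0] g

theorem _root_.AnalyticAt.reg {f : ℂ → ℂ} (h : AnalyticAt ℂ f 0) : Reg f := ⟨f, h, .rfl⟩

namespace Reg

variable {f g : ℂ → ℂ}

theorem congr (hf : Reg f) (h : g =ᶠ[𝓝[≠] 0] f) : Reg g :=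
  let ⟨F, hF, e⟩ := hf
  ⟨F, hF, h.trans e⟩

theorem const (c : ℂ) : Reg fun _ => c := analyticAt_const.reg

theorem id : Reg fun s => s := analyticAt_id.reg

theorem add (hf : Reg f) (hg : Reg g) : Reg fun s => f s + g s :=
  let ⟨F, hF, e⟩ := hf
  let ⟨G, hG, e'⟩ := hg
  ⟨fun s => F s + G s, hF.add hG, e.add e'⟩

theorem mul (hf : Reg f) (hg : Reg g) : Reg fun s => f s * g s :=
  let ⟨F, hF, e⟩ := hf
  let ⟨G, hG, e'⟩ := hg
  ⟨fun s => F s * G s, hF.mul hG, e.mul e'⟩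

theorem neg (hf : Reg f) : Reg fun s => -f s :=
  let ⟨F, hF, e⟩ := hf
  ⟨fun s => -F s, hF.neg, e.neg⟩

theorem sub (hf : Reg f) (hg : Reg g) : Reg fun s => f s - g s :=
  let ⟨F, hF, e⟩ := hf
  let ⟨G, hG, e'⟩ := hg
  ⟨fun s => F s - G s, hF.sub hG, e.sub e'⟩

theorem const_mul (hf : Reg f) (c : ℂ) : Reg fun s => c * f s := (const c).mul hf

theorem pow (hf : Reg f) (n : ℕ) : Reg fun s => f s ^ n :=
  let ⟨F, hF, e⟩ := hf
  ⟨fun s => F s ^ n, hF.pow n, e.pow_const n⟩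

theorem sum {ι : Type*} (t : Finset ι) {F : ι → ℂ → ℂ} (h : ∀ i ∈ t, Reg (F i)) :
    Reg fun s => ∑ i ∈ t, F i s := by
  classical
  induction t using Finset.induction_on with
  | empty => simpa using const 0
  | insert i t hi ih =>
    simp only [Finset.sum_insert hi]
    exact (h i (by simp)).add (ih fun j hj => h j (by simp [hj]))

theorem deriv (hf : Reg f) : Reg (deriv f) :=
  let ⟨F, hF, e⟩ := hf
  ⟨_root_.deriv F, hF.deriv, e.nhdsNE_deriv⟩

theorem meromorphicAt (hf : Reg f) : MeromorphicAt f 0 :=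
  let ⟨_, hF, e⟩ := hf
  hF.meromorphicAt.congr e.symm

end Reg

theorem tendsto_nhdsNE_of_analyticAt {τ : ℂ → ℂ} (hτ : AnalyticAt ℂ τ 0) (h0 : τ 0 = 0)
    (h1 : deriv τ 0 ≠ 0) : Tendsto τ (𝓝[≠] 0) (𝓝[≠] 0) := by
  have := hτ.differentiableAt.hasDerivAt.tendsto_nhdsNE h1
  rwa [h0] at this

theorem Reg.comp {f τ : ℂ → ℂ} (hf : Reg f) (hτ : AnalyticAt ℂ τ 0) (h0 : τ 0 = 0)
    (h1 : _root_.deriv τ 0 ≠ 0) : Reg fun s => f (τ s) := by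
  obtain ⟨F, hF, e⟩ := hf
  refine ⟨fun s => F (τ s), ?_, (tendsto_nhdsNE_of_analyticAt hτ h0 h1).eventually e⟩
  exact AnalyticAt.fun_comp (by rwa [h0]) hτ

theorem eventually_nhdsNE_neg {p : ℂ → Prop} (h : ∀ᶠ s in 𝓝[≠] (0 : ℂ), p s) :
    ∀ᶠ s in 𝓝[≠] (0 : ℂ), p (-s) := by
  have : Tendsto (fun s : ℂ => -s) (𝓝[≠] 0) (𝓝[≠] 0) :=
    tendsto_nhdsNE_of_analyticAt analyticAt_id.neg (by simp) (by simp)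
  exact this.eventually h

theorem Reg.comp_neg {f : ℂ → ℂ} (hf : Reg f) : Reg fun s => f (-s) :=
  hf.comp (τ := fun s => -s) analyticAt_id.neg (by simp) (by simp)

/-! ### Laurent jets -/

/-- The first six coefficients of a Laurent expansion. -/
@[ext] structure Jet where
  (c0 c1 c2 c3 c4 c5 : ℂ)

namespace Jet

def eval (j : Jet) (s : ℂ) : ℂ :=
  j.c0 + j.c1 * s + j.c2 * s ^ 2 + j.c3 * s ^ 3 + j.c4 * s ^ 4 + j.c5 * s ^ 5

def add (j k : Jet) : Jet :=
  ⟨j.c0 + k.c0, j.c1 + k.c1, j.c2 + k.c2, j.c3 + k.c3, j.c4 + k.c4, j.c5 + k.c5⟩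

def smul (r : ℂ) (j : Jet) : Jet :=
  ⟨r * j.c0, r * j.c1, r * j.c2, r * j.c3, r * j.c4, r * j.c5⟩

def mul (j k : Jet) : Jet where
  c0 := j.c0 * k.c0
  c1 := j.c0 * k.c1 + j.c1 * k.c0
  c2 := j.c0 * k.c2 + j.c1 * k.c1 + j.c2 * k.c0
  c3 := j.c0 * k.c3 + j.c1 * k.c2 + j.c2 * k.c1 + j.c3 * k.c0
  c4 := j.c0 * k.c4 + j.c1 * k.c3 + j.c2 * k.c2 + j.c3 * k.c1 + j.c4 * k.c0
  c5 := j.c0 * k.c5 + j.c1 * k.c4 + j.c2 * k.c3 + j.c3 * k.c2 + j.c4 * k.c1 + j.c5 * k.c0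

def deriv (m : ℂ) (j : Jet) : Jet :=
  ⟨-m * j.c0, (1 - m) * j.c1, (2 - m) * j.c2, (3 - m) * j.c3, (4 - m) * j.c4, (5 - m) * j.c5⟩

def shift (j : Jet) : Jet := ⟨0, j.c0, j.c1, j.c2, j.c3, j.c4⟩

/-- The jet of `f (-s)` if `j` is the jet of `f`, for pole orders that are even. -/
def reflect (j : Jet) : Jet := ⟨j.c0, -j.c1, j.c2, -j.c3, j.c4, -j.c5⟩

end Jet

/-- `f` has the Laurent expansion `s⁻ᵐ (c₀ + c₁ s + ⋯ + c₅ s⁵ + O(s⁶))` at `0`. -/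
def HasJet (m : ℕ) (f : ℂ → ℂ) (j : Jet) : Prop :=
  ∃ g, AnalyticAt ℂ g 0 ∧ ∀ᶠ s in 𝓝[≠] (0 : ℂ), s ^ m * f s = j.eval s + s ^ 6 * g s

theorem eventually_ne_zero_nhdsNE : ∀ᶠ s in 𝓝[≠] (0 : ℂ), s ≠ 0 := eventually_mem_nhdsWithin

namespace HasJet

variable {m n : ℕ} {f g : ℂ → ℂ} {j k : Jet}

theorem congr (hf : HasJet m f j) (h : g =ᶠ[𝓝[≠] 0] f) : HasJet m g j := by
  obtain ⟨F, hF, e⟩ := hf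
  refine ⟨F, hF, ?_⟩
  filter_upwards [e, h] with s h1 h2
  rw [h2, h1]

theorem add (hf : HasJet m f j) (hg : HasJet m g k) :
    HasJet m (fun s => f s + g s) (j.add k) := by
  obtain ⟨F, hF, e⟩ := hf
  obtain ⟨G, hG, e'⟩ := hg
  refine ⟨fun s => F s + G s, hF.add hG, ?_⟩
  filter_upwards [e, e'] with s h1 h2
  rw [mul_add, h1, h2]
  simp only [Jet.eval, Jet.add]
  ring

theorem smul (hf : HasJet m f j) (r : ℂ) : HasJet m (fun s => r * f s) (j.smul r) := by
  obtain ⟨F, hF, e⟩ := hf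
  refine ⟨fun s => r * F s, analyticAt_const.mul hF, ?_⟩
  filter_upwards [e] with s h1
  rw [mul_left_comm, h1]
  simp only [Jet.eval, Jet.smul]
  ring

theorem neg (hf : HasJet m f j) : HasJet m (fun s => -f s) (j.smul (-1)) := by
  simpa using hf.smul (-1)

theorem sub (hf : HasJet m f j) (hg : HasJet m g k) :
    HasJet m (fun s => f s - g s) (j.add (k.smul (-1))) := by
  simpa [sub_eq_add_neg] using hf.add hg.neg

theorem mul (hf : HasJet m f j) (hg : HasJet n g k) :
    HasJet (m + n) (fun s => f s * g s) (j.mul k) := by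
  obtain ⟨F, hF, e⟩ := hf
  obtain ⟨G, hG, e'⟩ := hg
  have hpoly : ∀ j : Jet, AnalyticAt ℂ j.eval 0 := fun j => by
    unfold Jet.eval; fun_prop
  refine ⟨fun s => j.eval s * G s + F s * k.eval s + s ^ 6 * (F s * G s) +
    (j.c1 * k.c5 + j.c2 * k.c4 + j.c3 * k.c3 + j.c4 * k.c2 + j.c5 * k.c1 +
    (j.c2 * k.c5 + j.c3 * k.c4 + j.c4 * k.c3 + j.c5 * k.c2) * s +
    (j.c3 * k.c5 + j.c4 * k.c4 + j.c5 * k.c3) * s ^ 2 +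
    (j.c4 * k.c5 + j.c5 * k.c4) * s ^ 3 + j.c5 * k.c5 * s ^ 4), ?_, ?_⟩
  · have := hpoly j
    have := hpoly k
    fun_prop
  filter_upwards [e, e'] with s h1 h2
  have : s ^ (m + n) * (f s * g s) = (s ^ m * f s) * (s ^ n * g s) := by ring
  rw [this, h1, h2]
  simp only [Jet.eval, Jet.mul]
  ring

theorem shift (hf : HasJet m f j) : HasJet (m + 1) f j.shift := by
  obtain ⟨F, hF, e⟩ := hf
  refine ⟨fun s => j.c5 + s * F s, by fun_prop, ?_⟩
  filter_upwards [e] with s h1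
  rw [pow_succ', mul_assoc, h1]
  simp only [Jet.eval, Jet.shift]
  ring

theorem reflect (hf : HasJet m f j) (hm : Even m) :
    HasJet m (fun s => f (-s)) j.reflect := by
  obtain ⟨F, hF, e⟩ := hf
  refine ⟨fun s => F (-s), AnalyticAt.fun_comp (by simpa using hF) analyticAt_id.neg, ?_⟩
  filter_upwards [eventually_nhdsNE_neg e] with s h1
  rw [hm.neg_pow] at h1
  rw [h1]
  simp only [Jet.eval, Jet.reflect]
  ring

/-- The recorded pole order grows by one even if `f` is regular; the leading coefficients then
vanish through the factors i - m. The precision of six coefficients is not reduced. -/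
theorem deriv (hf : HasJet m f j) : HasJet (m + 1) (deriv f) (j.deriv m) := by
  obtain ⟨F, hF, e⟩ := hf
  refine ⟨fun s => (6 - m) * F s + s * _root_.deriv F s, ?_, ?_⟩
  · have := hF.deriv
    fun_prop
  have e2 : f =ᶠ[𝓝[≠] 0] fun s => (j.eval s + s ^ 6 * F s) * (s ^ m)⁻¹ := by
    filter_upwards [e, eventually_ne_zero_nhdsNE] with s h1 h2
    rw [← h1]
    field_simp
  have hFa : ∀ᶠ s in 𝓝[≠] (0 : ℂ), AnalyticAt ℂ F s :=
    hF.eventually_analyticAt.filter_mono nhdsWithin_le_nhds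
  filter_upwards [e2.nhdsNE_deriv, hFa, eventually_ne_zero_nhdsNE] with s h1 h2 h3
  have hd := h2.differentiableAt.hasDerivAt
  have h4 : HasDerivAt (fun s => j.eval s + s ^ 6 * F s)
      (j.c1 + 2 * j.c2 * s + 3 * j.c3 * s ^ 2 + 4 * j.c4 * s ^ 3 + 5 * j.c5 * s ^ 4
        + (6 * s ^ 5 * F s + s ^ 6 * _root_.deriv F s)) s := by
    have hp : ∀ n : ℕ, HasDerivAt (fun s : ℂ => s ^ n) (n * s ^ (n - 1)) s := fun n =>
      hasDerivAt_pow n s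
    have := ((((((hasDerivAt_const s j.c0).add ((hasDerivAt_id s).const_mul j.c1)).add
      ((hp 2).const_mul j.c2)).add ((hp 3).const_mul j.c3)).add ((hp 4).const_mul j.c4)).add
      ((hp 5).const_mul j.c5)).add ((hp 6).mul hd)
    refine this.congr_deriv ?_
    norm_num
    ring
  have h5 : HasDerivAt (fun s : ℂ => (s ^ m)⁻¹) (-(m * s ^ (m - 1)) / (s ^ m) ^ 2) s :=
    (hasDerivAt_pow m s).fun_inv (pow_ne_zero _ h3)
  rw [h1, (h4.fun_mul h5).deriv]
  have h6 : (m : ℂ) * s ^ (m - 1) = m * s ^ m / s := by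
    rcases m with _ | m
    · simp
    · rw [Nat.add_sub_cancel]
      field_simp
      ring
  rw [h6]
  simp only [Jet.eval, Jet.deriv]
  field_simp
  ring

/-- For a pole of order at most six the six coefficients contain the whole principal part, so a
cancellation of poles becomes a finite list of polynomial identities. -/
theorem reg_of_eq_zero (hf : HasJet m f j) (hm : m ≤ 6) (h : j = ⟨0, 0, 0, 0, 0, 0⟩) :
    Reg f := by
  obtain ⟨F, hF, e⟩ := hf
  refine ⟨fun s => s ^ (6 - m) * F s, by fun_prop, ?_⟩
  filter_upwards [e, eventually_ne_zero_nhdsNE] with s h1 h2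
  have h3 : s ^ 6 = s ^ m * s ^ (6 - m) := by rw [← pow_add]; congr 1; lia
  rw [h, h3] at h1
  simp only [Jet.eval] at h1
  have h4 : s ^ m * f s = s ^ m * (s ^ (6 - m) * F s) := by rw [h1]; ring
  exact mul_left_cancel₀ (pow_ne_zero _ h2) h4

theorem of_jet_eq (hf : HasJet m f j) (h : j = k) : HasJet m f k := h ▸ hf

theorem inv_pow (m : ℕ) : HasJet m (fun s => (s ^ m)⁻¹) ⟨1, 0, 0, 0, 0, 0⟩ := by
  refine ⟨fun _ => 0, analyticAt_const, ?_⟩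
  filter_upwards [eventually_ne_zero_nhdsNE] with s h
  simp [Jet.eval, h]

theorem inv (hf : HasJet 0 f j) (h : j.mul k = ⟨1, 0, 0, 0, 0, 0⟩) :
    HasJet 0 (fun s => (f s)⁻¹) k := by
  obtain ⟨G, hG, e⟩ := (hf.mul (k := k) (g := k.eval) (n := 0)
    ⟨fun _ => 0, analyticAt_const, Eventually.of_forall fun s => by simp⟩).of_jet_eq h
  obtain ⟨F, hF, e'⟩ := hf
  have h0 : j.c0 ≠ 0 := by
    intro h0
    have := congrArg Jet.c0 h
    simp [Jet.mul, h0] at this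
  have hH : AnalyticAt ℂ (fun s => j.eval s + s ^ 6 * F s) 0 := by
    unfold Jet.eval; fun_prop
  have hH0 : j.eval 0 + 0 ^ 6 * F 0 ≠ 0 := by simpa [Jet.eval] using h0
  refine ⟨fun s => -G s / (j.eval s + s ^ 6 * F s), hG.neg.div hH hH0, ?_⟩
  have hne := (hH.continuousAt.eventually_ne hH0).filter_mono
    (nhdsWithin_le_nhds (s := {(0 : ℂ)}ᶜ))
  filter_upwards [e, e', hne] with s h1 h2 h3
  simp only [pow_zero, one_mul, add_zero] at h1 h2 ⊢
  rw [← h2] at h3 ⊢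
  have h4 : f s * k.eval s = 1 + s ^ 6 * G s := by
    rw [h1]; simp [Jet.eval]
  field_simp
  linear_combination -h4

theorem exists_of_analyticAt (hf : AnalyticAt ℂ f 0) : ∃ j, HasJet 0 f j ∧ j.c0 = f 0 ∧
    j.c1 = _root_.deriv f 0 := by
  -- Splitting off the constant term and dividing by `s` with `dslope`, six times, yields the six
  -- Taylor coefficients and an analytic remainder.
  have step : ∀ f : ℂ → ℂ, AnalyticAt ℂ f 0 →
      ∃ g, AnalyticAt ℂ g 0 ∧ g 0 = _root_.deriv f 0 ∧ ∀ s, f s = f 0 + s * g s := by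
    intro f hf
    refine ⟨dslope f 0, ?_, dslope_same .., fun s => ?_⟩
    · obtain ⟨p, hp⟩ := hf
      exact hp.has_fpower_series_dslope_fslope.analyticAt
    · have := sub_smul_dslope f 0 s
      simp only [sub_zero, smul_eq_mul] at this
      rw [this]; ring
  obtain ⟨f1, h1, d1, e1⟩ := step f hf
  obtain ⟨f2, h2, -, e2⟩ := step f1 h1
  obtain ⟨f3, h3, -, e3⟩ := step f2 h2
  obtain ⟨f4, h4, -, e4⟩ := step f3 h3
  obtain ⟨f5, h5, -, e5⟩ := step f4 h4
  obtain ⟨f6, h6, -, e6⟩ := step f5 h5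
  refine ⟨⟨f 0, f1 0, f2 0, f3 0, f4 0, f5 0⟩, ⟨f6, h6, Eventually.of_forall fun s => ?_⟩, rfl,
    d1⟩
  simp only [pow_zero, one_mul]
  rw [e1 s, e2 s, e3 s, e4 s, e5 s, e6 s]
  simp only [Jet.eval]
  ring

theorem exists_of_reg (hf : Reg f) : ∃ j, HasJet 0 f j :=
  let ⟨_, hF, e⟩ := hf
  let ⟨j, hj, _⟩ := exists_of_analyticAt hF
  ⟨j, hj.congr e⟩

theorem exists_of_reg_pow_mul (hf : Reg fun s => s ^ m * f s) : ∃ j, HasJet m f j :=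
  let ⟨j, g, hg, e⟩ := exists_of_reg hf
  ⟨j, g, hg, e.mono fun s hs => by simpa using hs⟩

theorem reg_pow_mul (hf : HasJet m f j) : Reg fun s => s ^ m * f s := by
  obtain ⟨F, hF, e⟩ := hf
  exact ⟨fun s => j.eval s + s ^ 6 * F s, by unfold Jet.eval; fun_prop, e⟩

theorem tendsto_zero (hf : HasJet 0 f j) : Tendsto f (𝓝[≠] 0) (𝓝 j.c0) := by
  obtain ⟨F, hF, e⟩ := hf
  have hH : AnalyticAt ℂ (fun s => j.eval s + s ^ 6 * F s) 0 := by
    unfold Jet.eval; fun_prop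
  have h := hH.continuousAt.tendsto.mono_left (nhdsWithin_le_nhds (s := {(0 : ℂ)}ᶜ))
  refine (h.congr' ?_).trans_eq ?_
  · filter_upwards [e] with s hs
    simpa using hs.symm
  · simp [Jet.eval]

/-- Remove a vanishing leading coefficient. -/
theorem unshift (hf : HasJet (m + 1) f j) (h : j.c0 = 0) :
    ∃ c, HasJet m f ⟨j.c1, j.c2, j.c3, j.c4, j.c5, c⟩ := by
  obtain ⟨F, hF, e⟩ := hf
  have hS : AnalyticAt ℂ (dslope F 0) 0 := by
    obtain ⟨p, hp⟩ := hF
    exact hp.has_fpower_series_dslope_fslope.analyticAt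
  refine ⟨F 0, dslope F 0, hS, ?_⟩
  filter_upwards [e, eventually_ne_zero_nhdsNE] with s h1 h2
  have h3 := sub_smul_dslope F 0 s
  simp only [sub_zero, smul_eq_mul] at h3
  refine mul_left_cancel₀ h2 ?_
  rw [← mul_assoc, ← pow_succ', h1]
  simp only [Jet.eval, h]
  linear_combination (-s ^ 6) * h3

end HasJet

/-! ### Residues -/

/-- The germ `F` at `0` has residue `r`: `F - r / t` has a primitive off `0`. -/
def HasRes (F : ℂ → ℂ) (r : ℂ) : Prop :=
  ∃ H, ∀ᶠ t in 𝓝[≠] (0 : ℂ), HasDerivAt H (F t - r / t) t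

theorem exists_primitive_of_analyticAt {f : ℂ → ℂ} (hf : AnalyticAt ℂ f 0) :
    ∃ H, AnalyticAt ℂ H 0 ∧ ∀ᶠ t in 𝓝 (0 : ℂ), HasDerivAt H (f t) t := by
  obtain ⟨r, hr, hd⟩ := Metric.eventually_nhds_iff_ball.1 hf.eventually_analyticAt
  obtain ⟨H, hH⟩ := DifferentiableOn.isExactOn_ball (f := f) (c := 0) (r := r)
    fun z hz => (hd z hz).differentiableAt.differentiableWithinAt
  have hb := Metric.ball_mem_nhds (0 : ℂ) hr
  refine ⟨H, ?_, ?_⟩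
  · refine DifferentiableOn.analyticAt (s := Metric.ball 0 r)
      (fun z hz => ((hH z hz).differentiableAt).differentiableWithinAt) hb
  · filter_upwards [hb] with z hz using hH z hz

namespace HasRes

variable {F G : ℂ → ℂ} {r r' : ℂ}

theorem congr (h : HasRes F r) (e : G =ᶠ[𝓝[≠] 0] F) : HasRes G r := by
  obtain ⟨H, hH⟩ := h
  refine ⟨H, ?_⟩
  filter_upwards [hH, e] with t h1 h2
  rwa [h2]

theorem add (h : HasRes F r) (h' : HasRes G r') : HasRes (fun t => F t + G t) (r + r') := by
  obtain ⟨H, hH⟩ := h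
  obtain ⟨H', hH'⟩ := h'
  refine ⟨fun t => H t + H' t, ?_⟩
  filter_upwards [hH, hH'] with t h1 h2
  refine (h1.fun_add h2).congr_deriv ?_
  ring

theorem const_mul (h : HasRes F r) (c : ℂ) : HasRes (fun t => c * F t) (c * r) := by
  obtain ⟨H, hH⟩ := h
  refine ⟨fun t => c * H t, ?_⟩
  filter_upwards [hH] with t h1
  refine (h1.const_mul c).congr_deriv ?_
  ring

theorem of_hasJet {j : Jet} (h : HasJet 6 F j) : HasRes F j.c5 := by
  obtain ⟨g, hg, e⟩ := h
  obtain ⟨H, -, hH⟩ := exists_primitive_of_analyticAt hg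
  refine ⟨fun t => -j.c0 / 5 * (t ^ 5)⁻¹ + -j.c1 / 4 * (t ^ 4)⁻¹ + -j.c2 / 3 * (t ^ 3)⁻¹ +
    -j.c3 / 2 * (t ^ 2)⁻¹ + -j.c4 * (t ^ 1)⁻¹ + H t, ?_⟩
  filter_upwards [e, hH.filter_mono nhdsWithin_le_nhds, eventually_ne_zero_nhdsNE] with t h1 h2 h3
  have hp : ∀ n : ℕ, HasDerivAt (fun t : ℂ => (t ^ n)⁻¹) (-(n * t ^ (n - 1)) / (t ^ n) ^ 2) t :=
    fun n => (hasDerivAt_pow n t).fun_inv (pow_ne_zero _ h3)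
  refine (((((((hp 5).const_mul _).fun_add ((hp 4).const_mul _)).fun_add
    ((hp 3).const_mul _)).fun_add ((hp 2).const_mul _)).fun_add ((hp 1).const_mul _)).fun_add
    h2).congr_deriv ?_
  have h4 : F t = (j.eval t + t ^ 6 * g t) / t ^ 6 := by
    rw [← h1]; field_simp
  rw [h4]
  simp only [Jet.eval]
  norm_num
  field_simp
  ring

/-- Residues do not depend on the coordinate: dτ/τ and ds/s differ by the differential of a
logarithm of τ(s)/s, which is analytic at 0. -/
theorem comp (h : HasRes F r) {τ : ℂ → ℂ} (hτ : AnalyticAt ℂ τ 0) (h0 : τ 0 = 0)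
    (h1 : deriv τ 0 ≠ 0) : HasRes (fun s => F (τ s) * deriv τ s) r := by
  obtain ⟨H, hH⟩ := h
  have hS : AnalyticAt ℂ (dslope τ 0) 0 := by
    obtain ⟨p, hp⟩ := hτ
    exact hp.has_fpower_series_dslope_fslope.analyticAt
  have hS0 : dslope τ 0 0 ≠ 0 := by rwa [dslope_same]
  -- `L` is a primitive of the logarithmic derivative of τ(s)/s.
  obtain ⟨L, -, hL⟩ := exists_primitive_of_analyticAt (hS.deriv.div hS hS0)
  refine ⟨fun s => H (τ s) + r * L s, ?_⟩
  filter_upwards [(tendsto_nhdsNE_of_analyticAt hτ h0 h1).eventually hH,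
    hL.filter_mono nhdsWithin_le_nhds, eventually_ne_zero_nhdsNE,
    hτ.eventually_analyticAt.filter_mono nhdsWithin_le_nhds,
    hS.eventually_analyticAt.filter_mono nhdsWithin_le_nhds,
    (hS.continuousAt.eventually_ne hS0).filter_mono nhdsWithin_le_nhds] with s a1 a2 a3 a4 a5 a6
  have hd := a4.differentiableAt.hasDerivAt
  refine ((a1.comp s hd).fun_add (a2.const_mul r)).congr_deriv ?_
  have e1 : τ = fun s => s * dslope τ 0 s := by
    funext s
    have := sub_smul_dslope τ 0 s
    simpa [h0] using this.symm
  have e2 : deriv τ s = dslope τ 0 s + s * deriv (dslope τ 0) s := by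
    have := ((hasDerivAt_id s).fun_mul a5.differentiableAt.hasDerivAt).deriv
    simp only [id, one_mul] at this
    rw [← this, ← e1]
  have e3 : τ s = s * dslope τ 0 s := congrFun e1 s
  have : r / τ s * deriv τ s = r / s + r * (deriv (dslope τ 0) s / dslope τ 0 s) := by
    rw [e2, e3]
    field_simp
  rw [sub_mul, this, Pi.div_apply]
  ring

/-- Apart from r/t the integrand has a primitive near the circle. The normalised integral is thus
constant for small radii, and the limit defining `residue` is the limit of an eventually constant
function. -/
theorem circleIntegral_eq (h : HasRes F r) :
    ∀ᶠ R in 𝓝[>] (0 : ℝ), (2 * Real.pi * Complex.I)⁻¹ * (∮ t in C(0, R), F t) = r := by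
  obtain ⟨H, hH⟩ := h
  rw [eventually_nhdsWithin_iff, Metric.eventually_nhds_iff_ball] at hH
  obtain ⟨ε, hε, hH⟩ := hH
  filter_upwards [Ioo_mem_nhdsGT hε] with R hR
  have hmem : ∀ t ∈ Metric.sphere (0 : ℂ) R, t ∈ Metric.ball (0 : ℂ) ε ∧ t ≠ 0 := by
    intro t ht
    have : ‖t‖ = R := by simpa using ht
    refine ⟨by simpa [this] using hR.2, ?_⟩
    rw [← norm_pos_iff, this]; exact hR.1
  have h1 : (∮ t in C(0, R), F t - r * (t - 0)⁻¹) = 0 := by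
    refine circleIntegral.integral_eq_zero_of_hasDerivWithinAt (f := H) hR.1.le fun t ht => ?_
    have := hH t (hmem t ht).1 (hmem t ht).2
    rw [sub_zero, ← div_eq_mul_inv]
    exact this.hasDerivWithinAt
  have h2 : CircleIntegrable (fun t : ℂ => r * (t - 0)⁻¹) 0 R := by
    refine ContinuousOn.circleIntegrable hR.1.le fun t ht => ?_
    have := (hmem t ht).2
    refine ContinuousAt.continuousWithinAt ?_
    simp only [sub_zero]
    fun_prop (disch := assumption)
  -- Nothing is assumed about the continuity of `F`; it follows because F - r/t is the derivative of
  -- a holomorphic function on the punctured disc.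
  have h3 : CircleIntegrable (fun t : ℂ => F t - r * (t - 0)⁻¹) 0 R := by
    have hd : DifferentiableOn ℂ H (Metric.ball 0 ε ∩ {0}ᶜ) := fun t ht =>
      (hH t ht.1 ht.2).differentiableAt.differentiableWithinAt
    have ho : IsOpen (Metric.ball (0 : ℂ) ε ∩ {0}ᶜ) :=
      Metric.isOpen_ball.inter isOpen_compl_singleton
    have hc := (hd.deriv ho).continuousOn
    refine ContinuousOn.circleIntegrable hR.1.le ?_
    refine (hc.mono fun t ht => hmem t ht).congr fun t ht => ?_
    rw [(hH t (hmem t ht).1 (hmem t ht).2).deriv, sub_zero, div_eq_mul_inv]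
  have h4 : (∮ t in C(0, R), F t) =
      (∮ t in C(0, R), F t - r * (t - 0)⁻¹) + ∮ t in C(0, R), r * (t - 0)⁻¹ := by
    rw [← circleIntegral.integral_add h3 h2]
    simp
  rw [h4, h1, zero_add, circleIntegral.integral_const_mul,
    circleIntegral.integral_sub_center_inv _ hR.1.ne']
  have : (2 * Real.pi * Complex.I : ℂ) ≠ 0 := Complex.two_pi_I_ne_zero
  field_simp

theorem unique (h : HasRes F r) (h' : HasRes F r') : r = r' := by
  obtain ⟨R, h1, h2⟩ := (h.circleIntegral_eq.and h'.circleIntegral_eq).exists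
  exact h1.symm.trans h2

theorem residue_eq {p : OnePoint ℂ} {F : ℂ → ℂ}
    (h : HasRes (fun t => F (chart p t) * deriv (chart p) t) r) : residue p F = r := by
  refine Tendsto.limUnder_eq ?_
  exact tendsto_const_nhds.congr' (h.circleIntegral_eq.mono fun R hR => hR.symm)

theorem comp_neg (h : HasRes F r) : HasRes (fun s => F (-s)) (-r) := by
  have h1 := h.comp (τ := fun s => -s) analyticAt_id.neg (by simp) (by simp)
  have h2 := h1.const_mul (-1)
  refine (h2.congr (Eventually.of_forall fun s => ?_)).congr .rfl |> fun h => by simpa using h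
  simp

end HasRes

/-! ### Pole orders and jets of the local data at a ramification point -/

theorem HasJet.id_mul {m : ℕ} {f : ℂ → ℂ} {j : Jet} (h : HasJet (m + 1) f j) :
    HasJet m (fun s => s * f s) j := by
  obtain ⟨F, hF, e⟩ := h
  refine ⟨F, hF, e.mono fun s hs => ?_⟩
  rw [← hs]; ring

theorem HasJet.inv_id_mul {m : ℕ} {f : ℂ → ℂ} {j : Jet} (h : HasJet m f j) :
    HasJet (m + 1) (fun s => s⁻¹ * f s) j := by
  obtain ⟨F, hF, e⟩ := h
  refine ⟨F, hF, ?_⟩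
  filter_upwards [e, eventually_ne_zero_nhdsNE] with s hs h0
  rw [← hs]; field_simp; ring

theorem HasJet.reg {f : ℂ → ℂ} {j : Jet} (h : HasJet 0 f j) : Reg f :=
  h.reg_pow_mul.congr (Eventually.of_forall fun s => by simp)

theorem HasJet.reg_two {f : ℂ → ℂ} {j : Jet} (h : HasJet 2 f j) (h0 : j.c0 = 0)
    (h1 : j.c1 = 0) : Reg f :=
  let ⟨_, h'⟩ := h.unshift h0
  let ⟨_, h''⟩ := h'.unshift h1
  h''.reg

theorem HasJet.reg_four {f : ℂ → ℂ} {j : Jet} (h : HasJet 4 f j) (h0 : j.c0 = 0)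
    (h1 : j.c1 = 0) (h2 : j.c2 = 0) (h3 : j.c3 = 0) : Reg f :=
  let ⟨_, h'⟩ := h.unshift h0
  let ⟨_, h''⟩ := h'.unshift h1
  h''.reg_two h2 h3

theorem analyticAt_dslope {f : ℂ → ℂ} (hf : AnalyticAt ℂ f 0) : AnalyticAt ℂ (dslope f 0) 0 := by
  obtain ⟨p, hp⟩ := hf
  exact hp.has_fpower_series_dslope_fslope.analyticAt

theorem eq_add_mul_dslope (f : ℂ → ℂ) (s : ℂ) : f s = f 0 + s * dslope f 0 s := by
  have := sub_smul_dslope f 0 s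
  simp only [sub_zero, smul_eq_mul] at this
  rw [this]; ring

/-- The jets of the derivative, its inverse, the logarithmic derivative of that and the odd part of a
function with nonvanishing derivative. -/
theorem exists_jets_of_deriv_ne_zero {Y : ℂ → ℂ} (hY : AnalyticAt ℂ Y 0) (h : deriv Y 0 ≠ 0) :
    ∃ n2 n3 n4 n5 n6 : ℂ,
      HasJet 0 (dslope Y 0) ((⟨1, n2, n3, n4, n5, n6⟩ : Jet).smul (deriv Y 0)) ∧
      HasJet 0 (deriv Y) ((⟨1, 2 * n2, 3 * n3, 4 * n4, 5 * n5, 6 * n6⟩ : Jet).smul (deriv Y 0)) := by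
  obtain ⟨⟨c0, c1, c2, c3, c4, c5⟩, hj, h0, -⟩ := HasJet.exists_of_analyticAt (analyticAt_dslope hY)
  have h0' : c0 = deriv Y 0 := by simpa using h0
  subst h0'
  set y := deriv Y 0
  refine ⟨c1 / y, c2 / y, c3 / y, c4 / y, c5 / y, ?_, ?_⟩
  · refine hj.of_jet_eq ?_
    ext <;> simp only [Jet.smul] <;> field_simp
  · refine ((hj.add hj.deriv.id_mul).of_jet_eq ?_).congr ?_
    · ext <;> simp only [Jet.smul, Jet.add, Jet.deriv] <;> field_simp <;> push_cast <;> ring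
    · have hd : ∀ᶠ s in 𝓝[≠] (0 : ℂ), AnalyticAt ℂ (dslope Y 0) s :=
        (analyticAt_dslope hY).eventually_analyticAt.filter_mono nhdsWithin_le_nhds
      filter_upwards [hd] with s hs
      have e : Y = fun s => Y 0 + s * dslope Y 0 s := funext (eq_add_mul_dslope Y)
      have := (((hasDerivAt_id s).fun_mul hs.differentiableAt.hasDerivAt).const_add (Y 0)).deriv
      simp only [id, one_mul] at this
      rw [← this, ← e]

/-- The jet of an inverse. -/
theorem HasJet.inv_smul {f : ℂ → ℂ} {y d1 d2 d3 d4 d5 : ℂ} (hy : y ≠ 0)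
    (hf : HasJet 0 f ((⟨1, d1, d2, d3, d4, d5⟩ : Jet).smul y)) :
    HasJet 0 (fun s => (f s)⁻¹) ((⟨1, -d1, d1 ^ 2 - d2, -d1 ^ 3 + 2 * d1 * d2 - d3,
      d1 ^ 4 - 3 * d1 ^ 2 * d2 + 2 * d1 * d3 + d2 ^ 2 - d4,
      -d1 ^ 5 + 4 * d1 ^ 3 * d2 - 3 * d1 ^ 2 * d3 - 3 * d1 * d2 ^ 2 + 2 * d1 * d4 + 2 * d2 * d3
        - d5⟩ : Jet).smul y⁻¹) := by
  refine hf.inv ?_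
  ext <;> simp only [Jet.smul, Jet.mul] <;> field_simp <;> ring

/-- Y(s) - Y(-s) is 2s times the even part of (Y(s) - Y(0))/s, so only the even coefficients of that
quotient survive. -/
theorem hasJet_inv_odd {Y : ℂ → ℂ} {n2 n3 n4 n5 n6 : ℂ} (h : deriv Y 0 ≠ 0)
    (hj : HasJet 0 (dslope Y 0) ((⟨1, n2, n3, n4, n5, n6⟩ : Jet).smul (deriv Y 0))) :
    HasJet 1 (fun s => (Y s - Y (-s))⁻¹)
      ((⟨1, 0, -n3, 0, n3 ^ 2 - n5, 0⟩ : Jet).smul ((deriv Y 0)⁻¹ / 2)) := by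
  have h1 := (hj.add (hj.reflect (by decide))).of_jet_eq
    (k := (⟨1, 0, n3, 0, n5, 0⟩ : Jet).smul (2 * deriv Y 0))
    (by ext <;> simp only [Jet.smul, Jet.add, Jet.reflect] <;> ring)
  refine ((h1.inv_smul (by simp [h])).inv_id_mul.of_jet_eq ?_).congr ?_
  · ext <;> simp only [Jet.smul] <;> field_simp <;> ring
  · refine Eventually.of_forall fun s => ?_
    dsimp only
    rw [eq_add_mul_dslope Y s, eq_add_mul_dslope Y (-s), ← mul_inv]
    congr 1
    ring

theorem hasJet_inv_two_mul : HasJet 1 (fun s => (2 * s)⁻¹) ⟨1 / 2, 0, 0, 0, 0, 0⟩ := by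
  refine (((HasJet.inv_pow 1).smul (1 / 2)).of_jet_eq ?_).congr (Eventually.of_forall fun s => ?_)
  · ext <;> simp [Jet.smul]
  · simp [mul_comm]

/-- Both terms have at most a double pole. The first is even and the second is a derivative, so
neither has a residue, and the coefficients of s⁻² are f(0)g(0)/(2Y'(0)) and its negative. This
matches a recursion term bilinear in two regular forms with a term of the swap relation. -/
theorem reg_symmetric_add_deriv {Y f g : ℂ → ℂ} (hY : AnalyticAt ℂ Y 0) (h : deriv Y 0 ≠ 0)
    (hf : AnalyticAt ℂ f 0) (hg : AnalyticAt ℂ g 0) :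
    Reg fun s => (f s * g (-s) + g s * f (-s)) * ((2 * s)⁻¹ * (Y s - Y (-s))⁻¹) +
      deriv (fun s => f s * g s * ((2 * s)⁻¹ * (deriv Y s)⁻¹)) s := by
  obtain ⟨n2, n3, n4, n5, n6, h1, h2⟩ := exists_jets_of_deriv_ne_zero hY h
  obtain ⟨⟨f0, f1, f2, f3, f4, f5⟩, jf, -, -⟩ := HasJet.exists_of_analyticAt hf
  obtain ⟨⟨g0, g1, g2, g3, g4, g5⟩, jg, -, -⟩ := HasJet.exists_of_analyticAt hg
  have hb := h2.inv_smul h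
  have hK := hasJet_inv_odd h h1
  have hA := hasJet_inv_two_mul
  have jf' := jf.reflect (by decide)
  have jg' := jg.reflect (by decide)
  have hR := (((jf.mul jg').add (jg.mul jf')).mul (hA.mul hK)).add
    ((jf.mul jg).mul (hA.mul hb)).deriv
  refine HasJet.reg_two hR ?_ ?_ <;>
    simp only [Jet.mul, Jet.add, Jet.smul, Jet.deriv, Jet.reflect] <;> push_cast <;> ring

/-! ### The swap operator and its principal parts at a ramification point -/

/-- The Schwarzian derivative. -/
def schwarzian (τ : ℂ → ℂ) (s : ℂ) : ℂ :=
  deriv (fun s => deriv (deriv τ) s * (deriv τ s)⁻¹) s -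
    1 / 2 * (deriv (deriv τ) s * (deriv τ s)⁻¹) ^ 2

/-- The regularised diagonal of the Bergman kernel in terms of `a = 1 / x'`, in a coordinate with
projective connection `S`. -/
def diagTerm (a S : ℂ → ℂ) (s : ℂ) : ℂ :=
  1 / 6 * (a s * deriv (deriv a) s) - 1 / 12 * (deriv a s * deriv a s) +
    1 / 6 * (a s * a s * S s)

/-- The terms of the swap relation that are linear in the Bergman kernel `β`. -/
def linearPart (a b S β : ℂ → ℂ) (s : ℂ) : ℂ :=
  1 / 2 * (b s * deriv (fun s => diagTerm a S s * b s * β s) s) +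
    1 / 24 * (b s * deriv (fun s => b s * deriv (fun s =>
      a s * a s * (deriv β s + deriv b s * (b s)⁻¹ * β s)) s) s)

/-- The Bergman kernel between `s` and `-s` in the coordinate `τ`. -/
def bergmanAntidiag (τ : ℂ → ℂ) (s : ℂ) : ℂ :=
  deriv τ s * deriv τ (-s) * ((τ s - τ (-s))⁻¹ * (τ s - τ (-s))⁻¹)

/-- The Bergman kernel between `s` and `0` in the coordinate `τ`. -/
def bergmanOrigin (τ : ℂ → ℂ) (s : ℂ) : ℂ := deriv τ 0 * deriv τ s * ((τ s)⁻¹ * (τ s)⁻¹)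

/-- The three expansions come from one symmetric germ
`κ(s,s') = k₀ + k₁(s+s') + k₂(s²+s'²) + k₁₁ss' + k₃(s³+s'³) + k₁₂ss'(s+s') + ⋯`. -/
theorem exists_bergman_jets {τ : ℂ → ℂ} (hτ : AnalyticAt ℂ τ 0) (h0 : τ 0 = 0)
    (h1 : deriv τ 0 ≠ 0) : ∃ k0 k1 k2 k3 k11 k12 : ℂ,
      HasJet 2 (bergmanAntidiag τ) ⟨1 / 4, 0, k0, 0, 2 * k2 - k11, 0⟩ ∧
      HasJet 2 (bergmanOrigin τ) ⟨1, 0, k0, k1, k2, k3⟩ ∧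
      HasJet 2 (schwarzian τ)
        ⟨0, 0, 6 * k0, 12 * k1, 6 * (2 * k2 + k11), 12 * (k3 + k12)⟩ := by
  obtain ⟨m2, m3, m4, m5, m6, j1, j2⟩ := exists_jets_of_deriv_ne_zero hτ h1
  have hinv : HasJet 1 (fun s => (τ s)⁻¹) _ := (j1.inv_smul h1).inv_id_mul.congr
    (Eventually.of_forall fun s => by
      dsimp only
      rw [eq_add_mul_dslope τ s, h0, zero_add, mul_inv])
  have hodd := hasJet_inv_odd h1 j1
  have hB : HasJet 2 (bergmanAntidiag τ) _ :=
    (j2.mul (j2.reflect (by decide))).mul (hodd.mul hodd)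
  have hO : HasJet 2 (bergmanOrigin τ) _ := (j2.smul (deriv τ 0)).mul (hinv.mul hinv)
  have hL := j2.deriv.mul (j2.inv_smul h1)
  have hS : HasJet 2 (schwarzian τ) _ := (hL.deriv.sub ((hL.mul hL).smul (1 / 2))).congr
    (Eventually.of_forall fun s => by simp only [schwarzian]; ring)
  -- Taylor coefficients of κ(s,s') = τ'(s)τ'(s')/(τ(s) - τ(s'))² - 1/(s - s')², where τ = τ'(0)(s +
  -- m₂s² + m₃s³ + ⋯). The three functions are 1/(4s²) + κ(s,-s), 1/s² + κ(s,0) and 6κ(s,s).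
  refine ⟨m3 - m2 ^ 2, 2 * m4 - 4 * m2 * m3 + 2 * m2 ^ 3,
    3 * m5 - 6 * m2 * m4 - 3 * m3 ^ 2 + 9 * m2 ^ 2 * m3 - 3 * m2 ^ 4,
    4 * m6 - 8 * m3 * m4 + 4 * m2 ^ 5 - 16 * m2 ^ 3 * m3 + 12 * m2 ^ 2 * m4 - 8 * m2 * m5 +
      12 * m2 * m3 ^ 2,
    4 * m5 - 8 * m2 * m4 + 16 * m2 ^ 2 * m3 - 6 * m2 ^ 4 - 6 * m3 ^ 2,
    6 * m6 - 18 * m3 * m4 + 12 * m2 ^ 5 - 42 * m2 ^ 3 * m3 + 24 * m2 ^ 2 * m4 - 12 * m2 * m5 +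
      30 * m2 * m3 ^ 2, ?_, ?_, ?_⟩
  · refine hB.of_jet_eq ?_
    ext <;> simp only [Jet.mul, Jet.smul, Jet.reflect] <;> field_simp <;> ring_nf
  · refine hO.of_jet_eq ?_
    ext <;> simp only [Jet.mul, Jet.smul] <;> field_simp <;> ring_nf
  · refine hS.of_jet_eq ?_
    ext <;> simp only [Jet.mul, Jet.smul, Jet.deriv, Jet.add] <;> push_cast <;> field_simp <;>
      ring_nf


/-- At a ramification point of `x` the principal part of the genus-one two-point differential is
cancelled by the terms of the swap relation that are singular there. -/
theorem reg_swap_at_ramification {Y τ β : ℂ → ℂ} (hY : AnalyticAt ℂ Y 0) (hY1 : deriv Y 0 ≠ 0)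
    (hτ : AnalyticAt ℂ τ 0) (h0 : τ 0 = 0) (h1 : deriv τ 0 ≠ 0) (hβ : AnalyticAt ℂ β 0) :
    Reg fun s =>
      ((deriv Y 0)⁻¹ / 2 * β 0 * (bergmanOrigin τ s * bergmanOrigin τ (-s)) +
        bergmanAntidiag τ s * ((2 * s)⁻¹ * (Y s - Y (-s))⁻¹) * (β (-s) + β s)) *
        ((2 * s)⁻¹ * (Y s - Y (-s))⁻¹) +
      deriv (fun s =>
        bergmanAntidiag τ s * ((2 * s)⁻¹ * (Y s - Y (-s))⁻¹) * ((2 * s)⁻¹ * (deriv Y s)⁻¹) * β s +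
        (deriv Y 0)⁻¹ / 4 * β 0 * (bergmanOrigin τ s * bergmanOrigin τ s) *
          ((2 * s)⁻¹ * (deriv Y s)⁻¹) +
        linearPart (fun s => (2 * s)⁻¹) (fun s => (deriv Y s)⁻¹) (schwarzian τ) β s) s := by
  obtain ⟨n2, n3, n4, n5, n6, i1, i2⟩ := exists_jets_of_deriv_ne_zero hY hY1
  obtain ⟨k0, k1, k2, k3, k11, k12, jB, jO, jS⟩ := exists_bergman_jets hτ h0 h1
  obtain ⟨⟨b0, b1, b2, b3, b4, b5⟩, jβ, hb0, -⟩ := HasJet.exists_of_analyticAt hβ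
  rw [← hb0]
  have jb := i2.inv_smul hY1
  have jA := hasJet_inv_two_mul
  have jK := jA.mul (hasJet_inv_odd hY1 i1)
  -- The factor Y'(0) cancels in b'/b. From here on Y'(0) occurs only through its inverse `e`,
  -- treated as an indeterminate, and all coefficients are polynomials that `ring` can compare.
  have jlog := (jb.deriv.mul i2).of_jet_eq
    (k := ⟨0, -2 * n2, 4 * n2 ^ 2 - 6 * n3, -8 * n2 ^ 3 + 18 * n2 * n3 - 12 * n4,
      16 * n2 ^ 4 - 48 * n2 ^ 2 * n3 + 32 * n2 * n4 + 18 * n3 ^ 2 - 20 * n5,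
      -32 * n2 ^ 5 + 120 * n2 ^ 3 * n3 - 80 * n2 ^ 2 * n4 - 90 * n2 * n3 ^ 2 + 50 * n2 * n5 +
        60 * n3 * n4 - 30 * n6⟩)
    (by ext <;> simp only [Jet.mul, Jet.smul, Jet.deriv] <;> push_cast <;> field_simp <;> ring_nf)
  set e := (deriv Y 0)⁻¹
  have jh : HasJet 4 (diagTerm (fun s => (2 * s)⁻¹) (schwarzian τ))
      ⟨1 / 16, 0, k0 / 4, k1 / 2, (2 * k2 + k11) / 4, (k3 + k12) / 2⟩ :=
    ((((jA.mul jA.deriv.deriv).smul (1 / 6)).sub ((jA.deriv.mul jA.deriv).smul (1 / 12))).add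
      (((jA.mul jA).mul jS).smul (1 / 6))).of_jet_eq (by
      ext <;> simp only [Jet.mul, Jet.smul, Jet.deriv, Jet.add] <;> push_cast <;> ring_nf)
  have j5 := (jb.mul ((jh.mul jb).mul jβ).deriv).smul (1 / 2)
  have j8 := (jb.mul (jb.mul ((jA.mul jA).mul (jβ.deriv.add
    (jlog.mul jβ))).deriv).deriv).smul (1 / 24)
  have jlin : HasJet 5 (linearPart (fun s => (2 * s)⁻¹) (fun s => (deriv Y s)⁻¹)
      (schwarzian τ) β) _ := (j5.add j8).congr (Eventually.of_forall fun s => by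
        simp only [linearPart, inv_inv])
  have jm := ((((jB.mul jK).mul (jA.mul jb)).mul jβ).add
    (((jO.mul jO).smul (e / 4 * b0)).mul (jA.mul jb))).add jlin
  have jG := ((((jO.mul (jO.reflect (by decide))).smul (e / 2 * b0)).add
    ((jB.mul jK).mul ((jβ.reflect (by decide)).add jβ))).mul jK)
  -- The pole order is six, the exact number of coefficients carried, so all of them have to vanish.
  refine (jG.add jm.deriv).reg_of_eq_zero le_rfl ?_
  ext
  · simp only [Jet.mul, Jet.add, Jet.smul, Jet.deriv, Jet.reflect]; push_cast; ring
  · simp only [Jet.mul, Jet.add, Jet.smul, Jet.deriv, Jet.reflect]; push_cast; ring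
  · simp only [Jet.mul, Jet.add, Jet.smul, Jet.deriv, Jet.reflect]; push_cast; ring
  · simp only [Jet.mul, Jet.add, Jet.smul, Jet.deriv, Jet.reflect]; push_cast; ring
  · simp only [Jet.mul, Jet.add, Jet.smul, Jet.deriv, Jet.reflect]; push_cast; ring
  · simp only [Jet.mul, Jet.add, Jet.smul, Jet.deriv, Jet.reflect]; push_cast; ring

/-- The primitive of the sum of the two genus-one one-point differentials. -/
def genusOnePotential (a b S : ℂ → ℂ) (s : ℂ) : ℂ :=
  1 / 24 * (deriv (deriv a) s * b s + deriv a s * deriv b s + a s * deriv (deriv b) s -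
    b s * (deriv a s * (deriv a s * (a s)⁻¹)) - a s * (deriv b s * (deriv b s * (b s)⁻¹)) +
    2 * (a s * b s * S s))

/-- The counterpart of `reg_swap_at_ramification` for the one-point differential, whose pole has
order four: its principal part is an exact form. -/
theorem reg_genusOne_at_ramification {Y τ : ℂ → ℂ} (hY : AnalyticAt ℂ Y 0) (hY1 : deriv Y 0 ≠ 0)
    (hτ : AnalyticAt ℂ τ 0) (h0 : τ 0 = 0) (h1 : deriv τ 0 ≠ 0) :
    Reg fun s => bergmanAntidiag τ s * ((2 * s)⁻¹ * (Y s - Y (-s))⁻¹) +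
      deriv (genusOnePotential (fun s => (2 * s)⁻¹) (fun s => (deriv Y s)⁻¹) (schwarzian τ)) s := by
  obtain ⟨n2, n3, n4, n5, n6, i1, i2⟩ := exists_jets_of_deriv_ne_zero hY hY1
  obtain ⟨k0, k1, k2, k3, k11, k12, jB, jO, jS⟩ := exists_bergman_jets hτ h0 h1
  have jb := i2.inv_smul hY1
  have jA := hasJet_inv_two_mul
  have jK := jA.mul (hasJet_inv_odd hY1 i1)
  have jlog := (jb.deriv.mul i2).of_jet_eq
    (k := ⟨0, -2 * n2, 4 * n2 ^ 2 - 6 * n3, -8 * n2 ^ 3 + 18 * n2 * n3 - 12 * n4,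
      16 * n2 ^ 4 - 48 * n2 ^ 2 * n3 + 32 * n2 * n4 + 18 * n3 ^ 2 - 20 * n5,
      -32 * n2 ^ 5 + 120 * n2 ^ 3 * n3 - 80 * n2 ^ 2 * n4 - 90 * n2 * n3 ^ 2 + 50 * n2 * n5 +
        60 * n3 * n4 - 30 * n6⟩)
    (by ext <;> simp only [Jet.mul, Jet.smul, Jet.deriv] <;> push_cast <;> field_simp <;> ring_nf)
  set e := (deriv Y 0)⁻¹
  have jlogA : HasJet 1 (fun s => deriv (fun s : ℂ => (2 * s)⁻¹) s * ((2 * s)⁻¹)⁻¹)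
      ⟨-1, 0, 0, 0, 0, 0⟩ := by
    refine ((HasJet.inv_pow 1).smul (-1)).of_jet_eq (by ext <;> simp [Jet.smul]) |>.congr ?_
    filter_upwards [eventually_ne_zero_nhdsNE] with s hs
    have h2 : HasDerivAt (fun s : ℂ => (2 * s)⁻¹) (-(2 * 1) / (2 * s) ^ 2) s :=
      ((hasDerivAt_id s).const_mul 2).fun_inv (by simpa using hs)
    rw [h2.deriv, inv_inv]
    field_simp
  have jpot := (((((((jA.deriv.deriv.mul jb).add (jA.deriv.mul jb.deriv)).add
    (jA.mul jb.deriv.deriv)).sub (jb.mul (jA.deriv.mul jlogA))).sub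
    (jA.mul (jb.deriv.mul jlog))).add (((jA.mul jb).mul jS).smul 2)).smul (1 / 24))
  have jpot' : HasJet 3 (genusOnePotential (fun s => (2 * s)⁻¹) (fun s => (deriv Y s)⁻¹)
      (schwarzian τ)) _ := jpot.congr (Eventually.of_forall fun s => by
        simp only [genusOnePotential, inv_inv])
  refine ((jB.mul jK).add jpot'.deriv).reg_four ?_ ?_ ?_ ?_ <;>
    simp only [Jet.mul, Jet.add, Jet.smul, Jet.deriv] <;> push_cast <;> ring

/-! ### Coinciding points -/

theorem HasJet.eq_zero {m : ℕ} {j : Jet} (h : HasJet m (fun _ => 0) j) :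
    j = ⟨0, 0, 0, 0, 0, 0⟩ := by
  have step : ∀ {j : Jet}, HasJet 0 (fun _ => 0) j → j.c0 = 0 := fun h =>
    tendsto_nhds_unique h.tendsto_zero tendsto_const_nhds
  have any : ∀ {m : ℕ} {j : Jet}, HasJet m (fun _ => 0) j → ∀ n, HasJet n (fun _ => 0) j :=
    fun ⟨g, hg, e⟩ n => ⟨g, hg, by simpa using e⟩
  have h0 := step (any h 0)
  obtain ⟨_, a1⟩ := HasJet.unshift (any h 1) h0
  have h1 := step (any a1 0)
  obtain ⟨_, a2⟩ := HasJet.unshift (any a1 1) h1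
  have h2 := step (any a2 0)
  obtain ⟨_, a3⟩ := HasJet.unshift (any a2 1) h2
  have h3 := step (any a3 0)
  obtain ⟨_, a4⟩ := HasJet.unshift (any a3 1) h3
  have h4 := step (any a4 0)
  obtain ⟨_, a5⟩ := HasJet.unshift (any a4 1) h4
  have h5 := step (any a5 0)
  ext
  exacts [h0, h1, h2, h3, h4, h5]

theorem HasJet.unique {m : ℕ} {f : ℂ → ℂ} {j k : Jet} (h : HasJet m f j) (h' : HasJet m f k) :
    j = k := by
  have h0 := ((h.sub h').congr (g := fun _ => 0)
    (Eventually.of_forall fun s => by simp)).eq_zero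
  simp only [Jet.add, Jet.smul, Jet.mk.injEq] at h0
  obtain ⟨h0, h1, h2, h3, h4, h5⟩ := h0
  ext
  · linear_combination h0
  · linear_combination h1
  · linear_combination h2
  · linear_combination h3
  · linear_combination h4
  · linear_combination h5

/-- The pole order is only nominal, as for a derivative of a regular function, so the value is found
at the index equal to that order. The next two statements serve third-order derivatives and one
derivative more. -/
theorem HasJet.value_one {f : ℂ → ℂ} {j : Jet} (h : HasJet 1 f j) (hf : AnalyticAt ℂ f 0) :
    f 0 = j.c1 := by
  obtain ⟨k, hk, h0, -⟩ := HasJet.exists_of_analyticAt hf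
  rw [h.unique hk.shift, ← h0]; rfl

theorem HasJet.value_three {f : ℂ → ℂ} {j : Jet} (h : HasJet 3 f j) (hf : AnalyticAt ℂ f 0) :
    f 0 = j.c3 := by
  obtain ⟨k, hk, h0, -⟩ := HasJet.exists_of_analyticAt hf
  rw [h.unique hk.shift.shift.shift, ← h0]; rfl

theorem HasJet.value_four {f : ℂ → ℂ} {j : Jet} (h : HasJet 4 f j) (hf : AnalyticAt ℂ f 0) :
    f 0 = j.c4 := by
  obtain ⟨k, hk, h0, -⟩ := HasJet.exists_of_analyticAt hf
  rw [h.unique hk.shift.shift.shift.shift, ← h0]; rfl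

/-- The jet in `δ` of the Bergman kernel `1 / (t - δ)²`. -/
def bergmanJet (t : ℂ) : Jet where
  c0 := (t ^ 2)⁻¹
  c1 := 2 * (t ^ 3)⁻¹
  c2 := 3 * (t ^ 4)⁻¹
  c3 := 4 * (t ^ 5)⁻¹
  c4 := 5 * (t ^ 6)⁻¹
  c5 := 6 * (t ^ 7)⁻¹

theorem analyticAt_bergman {t : ℂ} (ht : t ≠ 0) :
    AnalyticAt ℂ (fun δ : ℂ => ((t - δ) ^ 2)⁻¹) 0 :=
  ((analyticAt_const.sub analyticAt_id).pow 2).inv (by simpa using ht)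

theorem hasJet_bergman {t : ℂ} (ht : t ≠ 0) :
    HasJet 0 (fun δ => ((t - δ) ^ 2)⁻¹) (bergmanJet t) := by
  have h1 : HasJet 0 (fun δ : ℂ => (t - δ) ^ 2)
      ((⟨1, -2 / t, 1 / t ^ 2, 0, 0, 0⟩ : Jet).smul (t ^ 2)) := by
    refine ⟨fun _ => 0, analyticAt_const, Eventually.of_forall fun s => ?_⟩
    simp only [Jet.eval, Jet.smul]
    field_simp
    ring
  refine (h1.inv_smul (pow_ne_zero 2 ht)).of_jet_eq ?_
  ext <;> simp only [bergmanJet, Jet.smul] <;> field_simp <;> ring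

/-- In f(δ) Σ (k+1) δᵏ t⁻ᵏ⁻² the coefficient of δ is 2f₀t⁻³ + f₁t⁻², which is minus the derivative
of the polar part f₀t⁻² + f₁t⁻¹ of f(t)/t². On the diagonal this cancels the terms with the
one-point function. -/
theorem reg_trapezoid {f : ℂ → ℂ} (hf : AnalyticAt ℂ f 0) :
    Reg fun t => deriv (fun t => f t * (t ^ 2)⁻¹) t +
      deriv (fun δ => f δ * ((t - δ) ^ 2)⁻¹) 0 := by
  obtain ⟨⟨f0, f1, f2, f3, f4, f5⟩, jf, -, -⟩ := HasJet.exists_of_analyticAt hf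
  have hF : HasJet 3 (fun t => deriv (fun δ => f δ * ((t - δ) ^ 2)⁻¹) 0)
      ⟨2 * f0, f1, 0, 0, 0, 0⟩ := by
    refine ⟨fun _ => 0, analyticAt_const, ?_⟩
    filter_upwards [eventually_ne_zero_nhdsNE] with t ht
    rw [(jf.mul (hasJet_bergman ht)).deriv.value_one (hf.mul (analyticAt_bergman ht)).deriv]
    simp only [Jet.eval, Jet.mul, Jet.deriv, bergmanJet]
    push_cast
    field_simp
    ring
  obtain ⟨c, hc⟩ := ((jf.mul (HasJet.inv_pow 2)).deriv.add hF).unshift (m := 2) (by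
    simp only [Jet.mul, Jet.add, Jet.deriv]; push_cast; ring)
  refine hc.reg_two ?_ ?_ <;> simp only [Jet.mul, Jet.add, Jet.deriv] <;> push_cast <;> ring

/-- The same mechanism with f(t)/t⁴ and the coefficient of δ³; the factor 1/6 turns the third
derivative into that coefficient. -/
theorem reg_threePoint_at_diagonal {f : ℂ → ℂ} (hf : AnalyticAt ℂ f 0) :
    Reg fun t => deriv (fun t => f t * (t ^ 4)⁻¹) t +
      1 / 6 * deriv (deriv (deriv fun δ => f δ * ((t - δ) ^ 2)⁻¹)) 0 := by
  obtain ⟨⟨f0, f1, f2, f3, f4, f5⟩, jf, -, -⟩ := HasJet.exists_of_analyticAt hf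
  have hF : HasJet 5 (fun t => 1 / 6 * deriv (deriv (deriv fun δ => f δ * ((t - δ) ^ 2)⁻¹)) 0)
      ⟨4 * f0, 3 * f1, 2 * f2, f3, 0, 0⟩ := by
    refine ⟨fun _ => 0, analyticAt_const, ?_⟩
    filter_upwards [eventually_ne_zero_nhdsNE] with t ht
    rw [(jf.mul (hasJet_bergman ht)).deriv.deriv.deriv.value_three
      (hf.mul (analyticAt_bergman ht)).deriv.deriv.deriv]
    simp only [Jet.eval, Jet.mul, Jet.deriv, bergmanJet]
    push_cast
    field_simp
    ring
  obtain ⟨c, hc⟩ := ((jf.mul (HasJet.inv_pow 4)).deriv.add hF).unshift (m := 4) (by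
    simp only [Jet.mul, Jet.add, Jet.deriv]; push_cast; ring)
  refine hc.reg_four ?_ ?_ ?_ ?_ <;> simp only [Jet.mul, Jet.add, Jet.deriv] <;> push_cast <;> ring

theorem hasJet_logDeriv {b : ℂ → ℂ} {b0 r1 r2 r3 r4 r5 : ℂ} (h : b0 ≠ 0)
    (jb : HasJet 0 b ((⟨1, r1, r2, r3, r4, r5⟩ : Jet).smul b0)) :
    HasJet 1 (fun s => deriv b s * (b s)⁻¹) ⟨0, r1, 2 * r2 - r1 ^ 2, 3 * r3 - 3 * r1 * r2 + r1 ^ 3,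
      4 * r4 - 4 * r1 * r3 - 2 * r2 ^ 2 + 4 * r1 ^ 2 * r2 - r1 ^ 4,
      5 * r5 - 5 * r1 * r4 - 5 * r2 * r3 + 5 * r1 ^ 2 * r3 + 5 * r1 * r2 ^ 2 - 5 * r1 ^ 3 * r2 +
        r1 ^ 5⟩ := by
  refine (jb.deriv.mul (jb.inv_smul h)).of_jet_eq ?_
  ext <;> simp only [Jet.mul, Jet.smul, Jet.deriv] <;> push_cast <;> field_simp <;> ring_nf

/-- The jet of `linearPart`, for a kernel with jet `β`. -/
def linearJet (a b h l β : Jet) (m : ℕ) : Jet :=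
  ((b.mul (((h.mul b).mul β).deriv (m + 2 : ℕ))).smul (1 / 2)).add
    ((b.mul ((b.mul (((a.mul a).mul ((β.deriv m).add (l.mul β))).deriv (m + 1 : ℕ))).deriv
      (m + 2 : ℕ))).smul (1 / 24))

/-- A third-order operator differentiated once more sees only the first five Taylor coefficients of
β, and sees them linearly. Evaluating on basis jets separates the dependence on the position `t` of
the pole from the coefficients of the operator. -/
theorem linearJet_deriv_c4 (A B H l β : Jet) : ((linearJet A B H l β 0).deriv (3 : ℕ)).c4 =
    β.c0 * ((linearJet A B H l ⟨1, 0, 0, 0, 0, 0⟩ 0).deriv (3 : ℕ)).c4 +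
    β.c1 * ((linearJet A B H l ⟨0, 1, 0, 0, 0, 0⟩ 0).deriv (3 : ℕ)).c4 +
    β.c2 * ((linearJet A B H l ⟨0, 0, 1, 0, 0, 0⟩ 0).deriv (3 : ℕ)).c4 +
    β.c3 * ((linearJet A B H l ⟨0, 0, 0, 1, 0, 0⟩ 0).deriv (3 : ℕ)).c4 +
    β.c4 * ((linearJet A B H l ⟨0, 0, 0, 0, 1, 0⟩ 0).deriv (3 : ℕ)).c4 := by
  simp only [linearJet, Jet.mul, Jet.smul, Jet.add, Jet.deriv]
  push_cast
  ring

-- The diagonal counterpart of `reg_swap_at_ramification`, with t = z - w and δ the displacement of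
-- the fixed point. The bracket with t⁻⁴ and t⁻⁵ is the cross term, as computed in `crossTerm_eq`.
set_option maxHeartbeats 1000000 in
theorem reg_swap_at_diagonal {a b : ℂ → ℂ} (ha : AnalyticAt ℂ a 0) (hb : AnalyticAt ℂ b 0)
    (hb0 : b 0 ≠ 0) :
    Reg fun t => deriv (fun t => linearPart a b 0 (fun t => (t ^ 2)⁻¹) t +
        1 / 2 * (a t * b t * (deriv (fun δ => a δ * b δ) 0 * (t ^ 4)⁻¹ +
          4 * (a 0 * b 0) * (t ^ 5)⁻¹))) t +
      deriv (linearPart a b 0 fun δ => ((t - δ) ^ 2)⁻¹) 0 := by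
  obtain ⟨⟨a0, a1, a2, a3, a4, a5⟩, ja, ha0, -⟩ := HasJet.exists_of_analyticAt ha
  obtain ⟨⟨b0, b1, b2, b3, b4, b5⟩, jb, hb1, -⟩ := HasJet.exists_of_analyticAt hb
  obtain ⟨r1, r2, r3, r4, r5, jb⟩ : ∃ r1 r2 r3 r4 r5 : ℂ,
      HasJet 0 b ((⟨1, r1, r2, r3, r4, r5⟩ : Jet).smul b0) := by
    rw [← hb1] at hb0
    refine ⟨b1 / b0, b2 / b0, b3 / b0, b4 / b0, b5 / b0, jb.of_jet_eq ?_⟩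
    dsimp only at hb0
    ext <;> simp only [Jet.smul] <;> field_simp
  have hb1' : b 0 = b0 := hb1.symm
  have ha0' : a 0 = a0 := ha0.symm
  have jl := hasJet_logDeriv (hb1' ▸ hb0) jb
  have jab : deriv (fun δ => a δ * b δ) 0 = a0 * (b0 * r1) + a1 * b0 := by
    rw [(ja.mul jb).deriv.value_one (ha.mul hb).deriv]
    simp only [Jet.mul, Jet.smul, Jet.deriv]; push_cast; ring
  rw [jab, ha0', hb1']
  have jh : HasJet 2 (diagTerm a 0) _ := (((ja.mul ja.deriv.deriv).smul (1 / 6)).sub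
    ((ja.deriv.mul ja.deriv).smul (1 / 12))).congr
      (Eventually.of_forall fun s => by simp [diagTerm])
  set A : Jet := ⟨a0, a1, a2, a3, a4, a5⟩
  set B : Jet := (⟨1, r1, r2, r3, r4, r5⟩ : Jet).smul b0
  set l : Jet := ⟨0, r1, _, _, _, _⟩
  set H : Jet := Jet.add _ _
  have j0 : ∀ β j, HasJet 0 β j → HasJet 3 (linearPart a b 0 β) (linearJet A B H l j 0) :=
    fun β j jβ => ((jb.mul ((jh.mul jb).mul jβ).deriv).smul (1 / 2)).add
      ((jb.mul (jb.mul ((ja.mul ja).mul (jβ.deriv.add (jl.mul jβ))).deriv).deriv).smul (1 / 24))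
  have j2 : HasJet 5 (linearPart a b 0 fun t => (t ^ 2)⁻¹)
      (linearJet A B H l ⟨1, 0, 0, 0, 0, 0⟩ 2) :=
    have jβ := HasJet.inv_pow 2
    ((jb.mul ((jh.mul jb).mul jβ).deriv).smul (1 / 2)).add
      ((jb.mul (jb.mul ((ja.mul ja).mul (jβ.deriv.add (jl.mul jβ))).deriv).deriv).smul (1 / 24))
  let P : Jet → ℂ := fun β => ((linearJet A B H l β 0).deriv (3 : ℕ)).c4
  -- The coefficient of δᵏ in 1/(t - δ)² is (k+1)t⁻ᵏ⁻². Multiplied by t⁶ these become 5, 4t, 3t²,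
  -- 2t³, t⁴ for k = 4, …, 0.
  have hF : HasJet 6 (fun t => deriv (linearPart a b 0 fun δ => ((t - δ) ^ 2)⁻¹) 0)
      ⟨5 * P ⟨0, 0, 0, 0, 1, 0⟩, 4 * P ⟨0, 0, 0, 1, 0, 0⟩, 3 * P ⟨0, 0, 1, 0, 0, 0⟩,
        2 * P ⟨0, 1, 0, 0, 0, 0⟩, P ⟨1, 0, 0, 0, 0, 0⟩, 0⟩ := by
    refine ⟨fun _ => 0, analyticAt_const, ?_⟩
    filter_upwards [eventually_ne_zero_nhdsNE] with t ht
    have hβ := analyticAt_bergman ht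
    have han : AnalyticAt ℂ (linearPart a b 0 fun δ => ((t - δ) ^ 2)⁻¹) 0 := by
      have := ha.deriv
      have := ha.deriv.deriv
      have := hb.deriv
      have hbi := hb.inv hb0
      have hd : AnalyticAt ℂ (diagTerm a 0) 0 := by
        unfold diagTerm
        simp only [Pi.zero_apply]
        fun_prop
      have h5 := ((hd.mul hb).mul hβ).deriv
      have h8 := (hb.mul ((ha.mul ha).mul (hβ.deriv.add ((hb.deriv.mul hbi).mul hβ))).deriv).deriv
      exact (analyticAt_const.mul (hb.mul h5)).add (analyticAt_const.mul (hb.mul h8))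
    rw [(j0 _ _ (hasJet_bergman ht)).deriv.value_four han.deriv]
    rw [linearJet_deriv_c4]
    simp only [bergmanJet, Jet.eval, P]
    generalize (Jet.deriv _ (linearJet A B H l ⟨1, 0, 0, 0, 0, 0⟩ 0)).c4 = p0
    generalize (Jet.deriv _ (linearJet A B H l ⟨0, 1, 0, 0, 0, 0⟩ 0)).c4 = p1
    generalize (Jet.deriv _ (linearJet A B H l ⟨0, 0, 1, 0, 0, 0⟩ 0)).c4 = p2
    generalize (Jet.deriv _ (linearJet A B H l ⟨0, 0, 0, 1, 0, 0⟩ 0)).c4 = p3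
    generalize (Jet.deriv _ (linearJet A B H l ⟨0, 0, 0, 0, 1, 0⟩ 0)).c4 = p4
    field_simp
    ring
  have jT : HasJet 5 (fun t => 1 / 2 * (a t * b t * ((a0 * (b0 * r1) + a1 * b0) * (t ^ 4)⁻¹ +
      4 * (a0 * b0) * (t ^ 5)⁻¹))) _ := ((ja.mul jb).mul
    (((HasJet.inv_pow 4).smul (a0 * (b0 * r1) + a1 * b0)).shift.add
      ((HasJet.inv_pow 5).smul (4 * (a0 * b0))))).smul (1 / 2)
  refine (((j2.add jT).deriv).add hF).reg_of_eq_zero le_rfl ?_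
  ext <;> simp only [P, linearJet, Jet.mul, Jet.smul, Jet.add, Jet.deriv, Jet.shift, A, B, H, l] <;>
    push_cast <;> ring

/-! ### Regularity away from the ramification points -/

theorem Reg.eventually_analyticAt {f : ℂ → ℂ} (hf : Reg f) :
    ∀ᶠ s in 𝓝[≠] (0 : ℂ), AnalyticAt ℂ f s := hf.meromorphicAt.eventually_analyticAt

theorem reg_diagTerm {a S : ℂ → ℂ} (ha : Reg a) (hS : Reg S) : Reg (diagTerm a S) :=
  (((ha.mul ha.deriv.deriv).const_mul _).sub ((ha.deriv.mul ha.deriv).const_mul _)).add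
    (((ha.mul ha).mul hS).const_mul _)

/-- At a zero of b the quotient b'/b has a pole. Expanding b (b'/b · a²β)' shows that, apart from
regular functions, only b'²/b occurs; this is the reason for the hypothesis on that quotient. -/
theorem reg_linearPart {a b S β : ℂ → ℂ} (ha : Reg a) (hb : Reg b) (hS : Reg S) (hβ : Reg β)
    (hq : Reg fun s => deriv b s * (deriv b s * (b s)⁻¹))
    (hb0 : ∀ᶠ s in 𝓝[≠] (0 : ℂ), b s ≠ 0) : Reg (linearPart a b S β) := by
  have hM := (ha.mul ha).mul hβ
  have hN := (ha.mul ha).mul hβ.deriv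
  have hT : Reg fun s => b s * deriv (fun s =>
      a s * a s * (deriv β s + deriv b s * (b s)⁻¹ * β s)) s := by
    refine (((hb.mul hN.deriv).add ((hb.deriv.deriv.sub hq).mul hM)).add
      (hb.deriv.mul hM.deriv)).congr ?_
    filter_upwards [hb0, hM.eventually_analyticAt, hN.eventually_analyticAt,
      hb.eventually_analyticAt, hb.deriv.eventually_analyticAt] with s h0 h1 h2 h3 h4
    have e : (fun s => a s * a s * (deriv β s + deriv b s * (b s)⁻¹ * β s)) =
        fun s => a s * a s * deriv β s + deriv b s * (b s)⁻¹ * (a s * a s * β s) := by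
      funext s; ring
    rw [e, (h2.differentiableAt.hasDerivAt.fun_add ((h4.differentiableAt.hasDerivAt.fun_mul
      (h3.differentiableAt.hasDerivAt.fun_inv h0)).fun_mul
      h1.differentiableAt.hasDerivAt)).deriv]
    field_simp
    ring
  exact ((hb.mul (((reg_diagTerm ha hS).mul hb).mul hβ).deriv).const_mul _).add
    ((hb.mul hT.deriv).const_mul _)

theorem reg_genusOnePotential {a b S : ℂ → ℂ} (ha : Reg a) (hb : Reg b) (hS : Reg S)
    (hqa : Reg fun s => deriv a s * (deriv a s * (a s)⁻¹))
    (hqb : Reg fun s => deriv b s * (deriv b s * (b s)⁻¹)) :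
    Reg (genusOnePotential a b S) :=
  ((((((ha.deriv.deriv.mul hb).add (ha.deriv.mul hb.deriv)).add
    (ha.mul hb.deriv.deriv)).sub (hb.mul hqa)).sub (ha.mul hqb)).add
    (((ha.mul hb).mul hS).const_mul 2)).const_mul _

/-! ### The swap operator is symmetric up to multiplication operators -/

/-- The algebraic source of the antisymmetry of `swapTerm`. The two terms on the right reappear with
the opposite sign from the exchange relations of the three-point and one-point differentials. The
identity compares Taylor coefficients at 0 up to third order in β. -/
theorem linearPart_add_swap_zero {a b β : ℂ → ℂ} (ha : AnalyticAt ℂ a 0) (hb : AnalyticAt ℂ b 0)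
    (hβ : AnalyticAt ℂ β 0) (ha0 : a 0 ≠ 0) (hb0 : b 0 ≠ 0) :
    linearPart a b 0 β 0 + linearPart b a 0 β 0 =
      1 / 12 * (a 0 * b 0 * deriv (deriv (deriv fun s => a s * b s * β s)) 0) +
      deriv (genusOnePotential a b 0) 0 * (a 0 * b 0 * β 0) := by
  have norm : ∀ f : ℂ → ℂ, AnalyticAt ℂ f 0 → f 0 ≠ 0 → ∃ r1 r2 r3 r4 r5 : ℂ,
      HasJet 0 f ((⟨1, r1, r2, r3, r4, r5⟩ : Jet).smul (f 0)) := by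
    intro f hf h0
    obtain ⟨⟨b0, b1, b2, b3, b4, b5⟩, jb, hb1, -⟩ := HasJet.exists_of_analyticAt hf
    rw [← hb1] at h0 ⊢
    refine ⟨b1 / b0, b2 / b0, b3 / b0, b4 / b0, b5 / b0, jb.of_jet_eq ?_⟩
    dsimp only at h0
    ext <;> simp only [Jet.smul] <;> field_simp
  obtain ⟨p1, p2, p3, p4, p5, ja⟩ := norm a ha ha0
  obtain ⟨r1, r2, r3, r4, r5, jb⟩ := norm b hb hb0
  obtain ⟨⟨b0, b1, b2, b3, b4, b5⟩, jβ, hβ0, -⟩ := HasJet.exists_of_analyticAt hβ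
  have han : ∀ a b : ℂ → ℂ, AnalyticAt ℂ a 0 → AnalyticAt ℂ b 0 → b 0 ≠ 0 →
      AnalyticAt ℂ (linearPart a b 0 β) 0 := by
    intro a b ha hb hb0
    have := ha.deriv
    have := ha.deriv.deriv
    have hd : AnalyticAt ℂ (diagTerm a 0) 0 := by
      unfold diagTerm
      simp only [Pi.zero_apply]
      fun_prop
    have h5 := ((hd.mul hb).mul hβ).deriv
    have h8 := (hb.mul ((ha.mul ha).mul (hβ.deriv.add
      ((hb.deriv.mul (hb.inv hb0)).mul hβ))).deriv).deriv
    exact (analyticAt_const.mul (hb.mul h5)).add (analyticAt_const.mul (hb.mul h8))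
  have hpot : AnalyticAt ℂ (genusOnePotential a b 0) 0 :=
    analyticAt_const.mul ((((((ha.deriv.deriv.mul hb).add (ha.deriv.mul hb.deriv)).add
      (ha.mul hb.deriv.deriv)).sub (hb.mul (ha.deriv.mul (ha.deriv.mul (ha.inv ha0))))).sub
      (ha.mul (hb.deriv.mul (hb.deriv.mul (hb.inv hb0))))).add
      (analyticAt_const.mul ((ha.mul hb).mul analyticAt_const)))
  have jla := hasJet_logDeriv ha0 ja
  have jlb := hasJet_logDeriv hb0 jb
  have jha : HasJet 2 (diagTerm a 0) _ := (((ja.mul ja.deriv.deriv).smul (1 / 6)).sub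
    ((ja.deriv.mul ja.deriv).smul (1 / 12))).congr
      (Eventually.of_forall fun s => by simp [diagTerm])
  have jhb : HasJet 2 (diagTerm b 0) _ := (((jb.mul jb.deriv.deriv).smul (1 / 6)).sub
    ((jb.deriv.mul jb.deriv).smul (1 / 12))).congr
      (Eventually.of_forall fun s => by simp [diagTerm])
  have j1 : HasJet 3 (linearPart a b 0 β) _ :=
    ((jb.mul ((jha.mul jb).mul jβ).deriv).smul (1 / 2)).add
      ((jb.mul (jb.mul ((ja.mul ja).mul (jβ.deriv.add (jlb.mul jβ))).deriv).deriv).smul (1 / 24))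
  have j2 : HasJet 3 (linearPart b a 0 β) _ :=
    ((ja.mul ((jhb.mul ja).mul jβ).deriv).smul (1 / 2)).add
      ((ja.mul (ja.mul ((jb.mul jb).mul (jβ.deriv.add (jla.mul jβ))).deriv).deriv).smul (1 / 24))
  have jp : HasJet 2 (genusOnePotential a b 0) _ :=
    ((((((ja.deriv.deriv.mul jb).add (ja.deriv.mul jb.deriv)).add
    (ja.mul jb.deriv.deriv)).sub (jb.mul (ja.deriv.mul jla))).sub
    (ja.mul (jb.deriv.mul jlb))).smul (1 / 24)).congr
      (Eventually.of_forall fun s => by simp [genusOnePotential])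
  have hc := ((ja.mul jb).mul jβ).deriv.deriv.deriv.value_three
    ((ha.mul hb).mul hβ).deriv.deriv.deriv
  rw [j1.value_three (han a b ha hb hb0), j2.value_three (han b a hb ha ha0),
    jp.deriv.value_three hpot.deriv, hc, ← hβ0]
  simp only [Jet.mul, Jet.smul, Jet.add, Jet.deriv]
  push_cast
  ring

/-! ### Change of coordinate -/

theorem deriv_eventuallyEq {f g : ℂ → ℂ} (h : f =ᶠ[𝓝[≠] 0] g) : deriv f =ᶠ[𝓝[≠] 0] deriv g :=
  h.nhdsNE_deriv

theorem diagTerm_congr {a a' S : ℂ → ℂ} (ha : a =ᶠ[𝓝[≠] 0] a') :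
    diagTerm a S =ᶠ[𝓝[≠] 0] diagTerm a' S := by
  filter_upwards [ha, deriv_eventuallyEq ha, deriv_eventuallyEq (deriv_eventuallyEq ha)] with s
    h0 h1 h2
  simp only [diagTerm, h0, h1, h2]

theorem linearPart_congr {a b a' b' S β β' : ℂ → ℂ} (ha : a =ᶠ[𝓝[≠] 0] a')
    (hb : b =ᶠ[𝓝[≠] 0] b') (hβ : β =ᶠ[𝓝[≠] 0] β') :
    linearPart a b S β =ᶠ[𝓝[≠] 0] linearPart a' b' S β' := by
  have h5 : (fun s => diagTerm a S s * b s * β s) =ᶠ[𝓝[≠] 0]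
      fun s => diagTerm a' S s * b' s * β' s := ((diagTerm_congr ha).mul hb).mul hβ
  have h8 : (fun s => a s * a s * (deriv β s + deriv b s * (b s)⁻¹ * β s)) =ᶠ[𝓝[≠] 0]
      fun s => a' s * a' s * (deriv β' s + deriv b' s * (b' s)⁻¹ * β' s) :=
    (ha.mul ha).mul ((deriv_eventuallyEq hβ).add (((deriv_eventuallyEq hb).mul hb.inv).mul hβ))
  have h9 := deriv_eventuallyEq (hb.mul (deriv_eventuallyEq h8))
  filter_upwards [hb, deriv_eventuallyEq h5, h9] with s e1 e2 e3
  simp only [linearPart, e1, e2]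
  congr 3

theorem genusOnePotential_congr {a b a' b' S : ℂ → ℂ} (ha : a =ᶠ[𝓝[≠] 0] a')
    (hb : b =ᶠ[𝓝[≠] 0] b') :
    genusOnePotential a b S =ᶠ[𝓝[≠] 0] genusOnePotential a' b' S := by
  filter_upwards [ha, deriv_eventuallyEq ha, deriv_eventuallyEq (deriv_eventuallyEq ha),
    hb, deriv_eventuallyEq hb, deriv_eventuallyEq (deriv_eventuallyEq hb)] with s h0 h1 h2 h3 h4 h5
  simp only [genusOnePotential, h0, h1, h2, h3, h4, h5]

theorem hasDerivAt_comp_of_analyticAt {f φ : ℂ → ℂ} {s : ℂ} (hf : AnalyticAt ℂ f (φ s))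
    (hφ : AnalyticAt ℂ φ s) : HasDerivAt (fun s => f (φ s)) (deriv f (φ s) * deriv φ s) s :=
  hf.differentiableAt.hasDerivAt.comp s hφ.differentiableAt.hasDerivAt

/-- `φ` is a coordinate on a punctured neighbourhood of `0`. -/
def IsCoord (φ : ℂ → ℂ) : Prop := ∀ᶠ s in 𝓝[≠] (0 : ℂ), AnalyticAt ℂ φ s ∧ deriv φ s ≠ 0

/-- `f` is analytic along the coordinate `φ`. -/
def AnalyticAlong (φ f : ℂ → ℂ) : Prop := ∀ᶠ s in 𝓝[≠] (0 : ℂ), AnalyticAt ℂ f (φ s)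

namespace AnalyticAlong

variable {φ f g : ℂ → ℂ}

theorem deriv (hf : AnalyticAlong φ f) : AnalyticAlong φ (deriv f) := hf.mono fun _ h => h.deriv

theorem mul (hf : AnalyticAlong φ f) (hg : AnalyticAlong φ g) :
    AnalyticAlong φ fun z => f z * g z := by
  filter_upwards [hf, hg] with s h1 h2 using h1.mul h2

theorem add (hf : AnalyticAlong φ f) (hg : AnalyticAlong φ g) :
    AnalyticAlong φ fun z => f z + g z := by
  filter_upwards [hf, hg] with s h1 h2 using h1.add h2

theorem sub (hf : AnalyticAlong φ f) (hg : AnalyticAlong φ g) :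
    AnalyticAlong φ fun z => f z - g z := by
  filter_upwards [hf, hg] with s h1 h2 using h1.sub h2

theorem inv (hf : AnalyticAlong φ f) (h0 : ∀ᶠ s in 𝓝[≠] (0 : ℂ), f (φ s) ≠ 0) :
    AnalyticAlong φ fun z => (f z)⁻¹ := by
  filter_upwards [hf, h0] with s h1 h2 using h1.inv h2

theorem const_mul (hf : AnalyticAlong φ f) (c : ℂ) : AnalyticAlong φ fun z => c * f z :=
  hf.mono fun _ h => analyticAt_const.mul h

theorem diagTerm (hf : AnalyticAlong φ f) : AnalyticAlong φ (diagTerm f 0) := by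
  have h := ((hf.mul hf.deriv.deriv).const_mul (1 / 6)).sub
    ((hf.deriv.mul hf.deriv).const_mul (1 / 12))
  have e : XYSwap.diagTerm f 0 = fun z => 1 / 6 * (f z * _root_.deriv (_root_.deriv f) z) -
      1 / 12 * (_root_.deriv f z * _root_.deriv f z) := by
    funext z; simp [XYSwap.diagTerm]
  rwa [e]

/-- The chain rule. -/
theorem deriv_comp (hf : AnalyticAlong φ f) (hφ : IsCoord φ) :
    ∀ᶠ s in 𝓝[≠] (0 : ℂ), _root_.deriv (fun s => f (φ s)) s = _root_.deriv f (φ s) * _root_.deriv φ s := by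
  filter_upwards [hf, hφ] with s h1 h2
  exact (hasDerivAt_comp_of_analyticAt h1 h2.1).deriv

end AnalyticAlong

/-- Derivatives of the vector field `a` in the coordinate `φ`. -/
theorem deriv_div_deriv {φ a : ℂ → ℂ} (hφ : IsCoord φ) (ha : AnalyticAlong φ a) :
    ∀ᶠ s in 𝓝[≠] (0 : ℂ),
      deriv (fun s => a (φ s) * (deriv φ s)⁻¹) s =
        deriv a (φ s) - a (φ s) * deriv (deriv φ) s * (deriv φ s)⁻¹ ^ 2 ∧
      deriv (deriv fun s => a (φ s) * (deriv φ s)⁻¹) s =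
        deriv (deriv a) (φ s) * deriv φ s - deriv a (φ s) * deriv (deriv φ) s * (deriv φ s)⁻¹ -
        a (φ s) * deriv (deriv (deriv φ)) s * (deriv φ s)⁻¹ ^ 2 +
        2 * a (φ s) * deriv (deriv φ) s ^ 2 * (deriv φ s)⁻¹ ^ 3 := by
  have h1 : (deriv fun s => a (φ s) * (deriv φ s)⁻¹) =ᶠ[𝓝[≠] 0]
      fun s => deriv a (φ s) - a (φ s) * deriv (deriv φ) s * (deriv φ s)⁻¹ ^ 2 := by
    filter_upwards [hφ, ha] with s h1 h2
    rw [((hasDerivAt_comp_of_analyticAt h2 h1.1).fun_mul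
      (h1.1.deriv.differentiableAt.hasDerivAt.fun_inv h1.2)).deriv]
    have := h1.2
    field_simp
    ring
  filter_upwards [h1, deriv_eventuallyEq h1, hφ, ha] with s e1 e2 h3 h4
  refine ⟨e1, ?_⟩
  rw [e2]
  have h5 := h3.1.deriv.differentiableAt.hasDerivAt.fun_inv h3.2
  rw [((hasDerivAt_comp_of_analyticAt h4.deriv h3.1).fun_sub
    (((hasDerivAt_comp_of_analyticAt h4 h3.1).fun_mul
      h3.1.deriv.deriv.differentiableAt.hasDerivAt).fun_mul (h5.fun_pow 2))).deriv]
  have := h3.2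
  norm_num
  field_simp
  ring

theorem schwarzian_eventuallyEq {φ : ℂ → ℂ} (hφ : IsCoord φ) :
    ∀ᶠ s in 𝓝[≠] (0 : ℂ), schwarzian φ s = deriv (deriv (deriv φ)) s * (deriv φ s)⁻¹ -
      3 / 2 * (deriv (deriv φ) s * (deriv φ s)⁻¹) ^ 2 := by
  filter_upwards [hφ] with s h
  have := h.2
  rw [schwarzian, (h.1.deriv.deriv.differentiableAt.hasDerivAt.fun_mul
    (h.1.deriv.differentiableAt.hasDerivAt.fun_inv h.2)).deriv]
  field_simp
  ring

/-- For a = 1/x' the left side is -{x, z}/(6x'²), and the identity is the chain rule for the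
Schwarzian derivative. -/
theorem diagTerm_comp {φ a : ℂ → ℂ} (hφ : IsCoord φ) (ha : AnalyticAlong φ a) :
    ∀ᶠ s in 𝓝[≠] (0 : ℂ), diagTerm a 0 (φ s) =
      diagTerm (fun s => a (φ s) * (deriv φ s)⁻¹) (schwarzian φ) s := by
  filter_upwards [deriv_div_deriv hφ ha, schwarzian_eventuallyEq hφ, hφ] with s h1 h2 h3
  have := h3.2
  simp only [diagTerm, h1.1, h1.2, h2, Pi.zero_apply]
  field_simp
  ring

theorem genusOnePotential_comp {φ a b : ℂ → ℂ} (hφ : IsCoord φ) (ha : AnalyticAlong φ a)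
    (hb : AnalyticAlong φ b) (ha0 : ∀ᶠ s in 𝓝[≠] (0 : ℂ), a (φ s) ≠ 0)
    (hb0 : ∀ᶠ s in 𝓝[≠] (0 : ℂ), b (φ s) ≠ 0) :
    ∀ᶠ s in 𝓝[≠] (0 : ℂ), genusOnePotential a b 0 (φ s) =
      genusOnePotential (fun s => a (φ s) * (deriv φ s)⁻¹) (fun s => b (φ s) * (deriv φ s)⁻¹)
        (schwarzian φ) s := by
  filter_upwards [deriv_div_deriv hφ ha, deriv_div_deriv hφ hb, schwarzian_eventuallyEq hφ, hφ,
    ha0, hb0] with s h1 h2 h3 h4 h5 h6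
  have := h4.2
  simp only [genusOnePotential, h1.1, h1.2, h2.1, h2.2, h3, Pi.zero_apply]
  field_simp
  ring

/-- Here a and b are vector fields and β is a form, so bβ and a/b are functions and b d/dz is
intrinsic. Since a²(β' + b'β/b) = (a/b)² b (bβ)', only `diagTerm` needs a correction. -/
theorem linearPart_comp {φ a b β : ℂ → ℂ} (hφ : IsCoord φ) (ha : AnalyticAlong φ a)
    (hb : AnalyticAlong φ b) (hβ : AnalyticAlong φ β)
    (hb0 : ∀ᶠ s in 𝓝[≠] (0 : ℂ), b (φ s) ≠ 0) :
    ∀ᶠ s in 𝓝[≠] (0 : ℂ), linearPart a b 0 β (φ s) =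
      linearPart (fun s => a (φ s) * (deriv φ s)⁻¹) (fun s => b (φ s) * (deriv φ s)⁻¹)
        (schwarzian φ) (fun s => β (φ s) * deriv φ s) s := by
  have g1 : AnalyticAlong φ fun z => diagTerm a 0 z * b z * β z := (ha.diagTerm.mul hb).mul hβ
  have g2 : AnalyticAlong φ fun z => a z * a z * (deriv β z + deriv b z * (b z)⁻¹ * β z) :=
    (ha.mul ha).mul (hβ.deriv.add ((hb.deriv.mul (hb.inv hb0)).mul hβ))
  have g3 := hb.mul g2.deriv
  have e1 : (fun s => diagTerm (fun s => a (φ s) * (deriv φ s)⁻¹) (schwarzian φ) s *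
      (b (φ s) * (deriv φ s)⁻¹) * (β (φ s) * deriv φ s)) =ᶠ[𝓝[≠] 0]
      fun s => diagTerm a 0 (φ s) * b (φ s) * β (φ s) := by
    filter_upwards [diagTerm_comp hφ ha, hφ] with s h1 h2
    have := h2.2
    rw [h1]
    field_simp
  have e2 : (fun s => a (φ s) * (deriv φ s)⁻¹ * (a (φ s) * (deriv φ s)⁻¹) *
      (deriv (fun s => β (φ s) * deriv φ s) s + deriv (fun s => b (φ s) * (deriv φ s)⁻¹) s *
        (b (φ s) * (deriv φ s)⁻¹)⁻¹ * (β (φ s) * deriv φ s))) =ᶠ[𝓝[≠] 0]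
      fun s => a (φ s) * a (φ s) *
        (deriv β (φ s) + deriv b (φ s) * (b (φ s))⁻¹ * β (φ s)) := by
    filter_upwards [hφ, hβ, deriv_div_deriv hφ hb, hb0] with s h1 h2 h3 h4
    have := h1.2
    rw [h3.1, ((hasDerivAt_comp_of_analyticAt h2 h1.1).fun_mul
      h1.1.deriv.differentiableAt.hasDerivAt).deriv]
    field_simp
    ring
  have e3 : (fun s => b (φ s) * (deriv φ s)⁻¹ * deriv (fun s =>
      a (φ s) * (deriv φ s)⁻¹ * (a (φ s) * (deriv φ s)⁻¹) *
      (deriv (fun s => β (φ s) * deriv φ s) s + deriv (fun s => b (φ s) * (deriv φ s)⁻¹) s *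
        (b (φ s) * (deriv φ s)⁻¹)⁻¹ * (β (φ s) * deriv φ s))) s) =ᶠ[𝓝[≠] 0]
      fun s => b (φ s) * deriv (fun z => a z * a z * (deriv β z + deriv b z * (b z)⁻¹ * β z))
        (φ s) := by
    filter_upwards [deriv_eventuallyEq e2, g2.deriv_comp hφ, hφ] with s h1 h2 h3
    have := h3.2
    rw [h1, h2]
    field_simp
  filter_upwards [deriv_eventuallyEq e1, g1.deriv_comp hφ, deriv_eventuallyEq e3,
    g3.deriv_comp hφ, hφ] with s h1 h2 h3 h4 h5
  have := h5.2
  simp only [linearPart]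
  rw [h1, h2, h3, h4]
  field_simp

/-! ### Rational functions on the sphere -/

theorem chart_infty : chart OnePoint.infty = fun t => t⁻¹ := rfl

theorem chart_coe (a : ℂ) : chart (a : OnePoint ℂ) = fun t => a + t := rfl

theorem isCoord_chart (p : OnePoint ℂ) : IsCoord (chart p) := by
  induction p using OnePoint.rec with
  | infty =>
    filter_upwards [eventually_ne_zero_nhdsNE] with s hs
    rw [chart_infty]
    exact ⟨analyticAt_id.inv hs, by simp [hs]⟩
  | coe a =>
    refine Eventually.of_forall fun s => ?_
    rw [chart_coe]
    exact ⟨by fun_prop, by simp⟩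

theorem chart_injective (p : OnePoint ℂ) : Function.Injective (chart p) := by
  induction p using OnePoint.rec with
  | infty => rw [chart_infty]; exact inv_injective
  | coe a => rw [chart_coe]; exact add_right_injective a

theorem deriv_chart_infty (t : ℂ) : deriv (chart OnePoint.infty) t = -(t ^ 2)⁻¹ := by
  rw [chart_infty, deriv_inv]

theorem deriv_chart_coe (a t : ℂ) : deriv (chart (a : OnePoint ℂ)) t = 1 := by
  rw [chart_coe]; simp

theorem eventually_chart_notMem (p : OnePoint ℂ) {T : Set ℂ} (hT : T.Finite) :
    ∀ᶠ t in 𝓝[≠] (0 : ℂ), chart p t ∉ T := by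
  have h1 : (chart p ⁻¹' T \ {0}).Finite :=
    (hT.preimage (chart_injective p).injOn).subset Set.sdiff_subset
  have h2 : ∀ᶠ t in 𝓝 (0 : ℂ), t ∉ chart p ⁻¹' T \ {0} :=
    h1.isClosed.isOpen_compl.mem_nhds (by simp)
  filter_upwards [h2.filter_mono nhdsWithin_le_nhds, eventually_ne_zero_nhdsNE] with t h3 h4 h5
  exact h3 ⟨h5, h4⟩

theorem meromorphicAt_polynomial_comp (P : Polynomial ℂ) {φ : ℂ → ℂ} {s : ℂ}
    (hφ : MeromorphicAt φ s) : MeromorphicAt (fun t => P.eval (φ t)) s := by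
  induction P using Polynomial.induction_on' with
  | add p q hp hq => simpa using hp.fun_add hq
  | monomial n a => simpa using (MeromorphicAt.const a s).fun_mul (hφ.fun_pow n)

theorem meromorphicAt_chart (p : OnePoint ℂ) : MeromorphicAt (chart p) 0 := by
  induction p using OnePoint.rec with
  | infty => rw [chart_infty]; exact (MeromorphicAt.id 0).inv
  | coe a => rw [chart_coe]; exact AnalyticAt.meromorphicAt (by fun_prop)

theorem meromorphicAt_ev_chart (f : RatFunc ℂ) (p : OnePoint ℂ) :
    MeromorphicAt (fun t => ev f (chart p t)) 0 :=
  (meromorphicAt_polynomial_comp f.num (meromorphicAt_chart p)).div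
    (meromorphicAt_polynomial_comp f.denom (meromorphicAt_chart p))

/-- The points at which `f` has a pole or a critical point. -/
def badSet (f : RatFunc ℂ) : Set ℂ := {z | f.denom.eval z = 0 ∨ deriv (ev f) z = 0}

theorem analyticAt_ev {f : RatFunc ℂ} {z : ℂ} (h : f.denom.eval z ≠ 0) :
    AnalyticAt ℂ (ev f) z := by
  have hp : ∀ P : Polynomial ℂ, AnalyticAt ℂ (fun z => P.eval z) z := fun P =>
    P.differentiable.analyticAt z
  exact (hp f.num).div (hp f.denom) h

theorem deriv_ev {f : RatFunc ℂ} {z : ℂ} (h : f.denom.eval z ≠ 0) :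
    deriv (ev f) z = (f.num.derivative * f.denom - f.num * f.denom.derivative).eval z /
      f.denom.eval z ^ 2 := by
  have := (f.num.hasDerivAt z).fun_div (f.denom.hasDerivAt z) h
  rw [show ev f = fun z => f.num.eval z / f.denom.eval z from rfl, this.deriv]
  simp

theorem finite_denom_zero (f : RatFunc ℂ) : {z | f.denom.eval z = 0}.Finite := by
  refine (f.denom.rootSet_finite ℂ).subset fun z hz => ?_
  rw [Polynomial.mem_rootSet]
  exact ⟨f.denom_ne_zero, by simpa [Polynomial.aeval_def] using hz⟩

theorem deriv_ev_chart (f : RatFunc ℂ) (p : OnePoint ℂ) :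
    ∀ᶠ t in 𝓝[≠] (0 : ℂ), deriv (fun t => ev f (chart p t)) t =
      deriv (ev f) (chart p t) * deriv (chart p) t := by
  filter_upwards [eventually_chart_notMem p (finite_denom_zero f), isCoord_chart p] with t h1 h2
  exact (hasDerivAt_comp_of_analyticAt (analyticAt_ev h1) h2.1).deriv

theorem finite_badSet {f : RatFunc ℂ} (h : ordDiffAt f (0 : ℂ) ≠ ⊤) : (badSet f).Finite := by
  set P := f.num.derivative * f.denom - f.num * f.denom.derivative with hP
  have hP0 : P ≠ 0 := by
    intro h0
    refine h (meromorphicOrderAt_eq_top_iff.2 ?_)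
    filter_upwards [deriv_ev_chart f (0 : ℂ),
      eventually_chart_notMem (0 : ℂ) (finite_denom_zero f)] with t h1 h2
    rw [h1, deriv_ev h2, ← hP, h0]
    simp
  refine ((finite_denom_zero f).union (P.rootSet_finite ℂ)).subset fun z hz => ?_
  by_cases hd : f.denom.eval z = 0
  · exact Or.inl hd
  · right
    rw [Polynomial.mem_rootSet]
    refine ⟨hP0, ?_⟩
    have := hz.resolve_left hd
    rw [deriv_ev hd, div_eq_zero_iff] at this
    rw [Polynomial.coe_aeval_eq_eval]
    exact this.resolve_right (pow_ne_zero 2 hd)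

theorem notMem_ramificationPoints {f : RatFunc ℂ} {z : ℂ} (h : z ∉ badSet f) :
    (z : OnePoint ℂ) ∉ ramificationPoints f := by
  simp only [badSet, Set.mem_ofPred_eq, not_or] at h
  intro hz
  have han := (analyticAt_ev h.1).deriv
  have h1 : Tendsto (fun t : ℂ => z + t) (𝓝[≠] 0) (𝓝 z) := by
    have : ContinuousAt (fun t : ℂ => z + t) 0 := by fun_prop
    simpa using this.tendsto.mono_left (nhdsWithin_le_nhds (s := {(0 : ℂ)}ᶜ))
  have h2 : Tendsto (deriv fun t => ev f (chart z t)) (𝓝[≠] 0) (𝓝 (deriv (ev f) z)) := by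
    refine (han.continuousAt.tendsto.comp h1).congr' ?_
    filter_upwards [deriv_ev_chart f z] with t ht
    rw [ht, deriv_chart_coe, mul_one]; rfl
  have h3 := tendsto_zero_of_meromorphicOrderAt_pos hz
  exact h.2 (tendsto_nhds_unique h2 h3)

theorem finite_ramificationPoints {f : RatFunc ℂ} (h : ordDiffAt f (0 : ℂ) ≠ ⊤) :
    (ramificationPoints f).Finite := by
  refine (((finite_badSet h).image ((↑) : ℂ → OnePoint ℂ)).union
    (Set.finite_singleton OnePoint.infty)).subset fun p hp => ?_
  induction p using OnePoint.rec with
  | infty => exact Or.inr rfl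
  | coe a =>
    refine Or.inl ⟨a, ?_, rfl⟩
    by_contra hc
    exact notMem_ramificationPoints hc hp

/-- An identically vanishing dx has order ⊤, which counts as positive, so `p` would be a
ramification point that is not simple. This excludes constants. -/
theorem IsRegularAtRamification.ordDiffAt_ne_top {x y : RatFunc ℂ}
    (h : IsRegularAtRamification x y) (p : OnePoint ℂ) : ordDiffAt x p ≠ ⊤ := by
  intro hp
  have := h.simple p (by simp [ramificationPoints, hp])
  simp [hp] at this

theorem reg_iff {f : ℂ → ℂ} (hf : MeromorphicAt f 0) : Reg f ↔ 0 ≤ meromorphicOrderAt f 0 :=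
  hf.meromorphicOrderAt_nonneg_iff.symm

/-- A derivative has no residue, hence no simple pole. -/
theorem meromorphicOrderAt_deriv_ne_neg_one {f : ℂ → ℂ} (hf : MeromorphicAt f 0) :
    meromorphicOrderAt (deriv f) 0 ≠ (-1 : ℤ) := by
  intro h
  cases hn : meromorphicOrderAt f 0 with
  | top =>
    have : deriv f =ᶠ[𝓝[≠] 0] deriv fun _ => 0 :=
      deriv_eventuallyEq (meromorphicOrderAt_eq_top_iff.1 hn)
    have h2 : meromorphicOrderAt (deriv f) 0 = ⊤ := by
      rw [meromorphicOrderAt_eq_top_iff]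
      exact this.mono fun s hs => by simpa using hs
    rw [h2] at h
    exact absurd h WithTop.top_ne_coe
  | coe n =>
    by_cases h0 : 0 ≤ n
    · have := (reg_iff hf).2 (by rw [hn]; exact_mod_cast h0)
      have h3 := (reg_iff hf.deriv).1 this.deriv
      rw [h] at h3
      exact absurd h3 (by decide)
    · have := meromorphicOrderAt_deriv_eq_sub_one (n := n) (by
        exact_mod_cast (by lia : n ≠ 0)) hn
      rw [h] at this
      have h4 : (-1 : ℤ) = n - 1 := by exact_mod_cast this
      lia

/-- The vector field `1 / dx` in the chart at a point where `x` is unramified. -/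
theorem reg_inv_deriv_of_notMem {f : ℂ → ℂ} (hf : MeromorphicAt f 0)
    (h : ¬ 0 < meromorphicOrderAt (deriv f) 0) :
    Reg (fun s => (deriv f s)⁻¹) ∧ (∀ᶠ s in 𝓝[≠] (0 : ℂ), (deriv f s)⁻¹ ≠ 0) ∧
      Reg fun s => deriv (fun s => (deriv f s)⁻¹) s *
        (deriv (fun s => (deriv f s)⁻¹) s * ((deriv f s)⁻¹)⁻¹) := by
  cases hn : meromorphicOrderAt (deriv f) 0 with
  | top => simp [hn] at h
  | coe n =>
    have hn0 : n ≤ 0 := by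
      rw [hn] at h; exact_mod_cast not_lt.1 h
    have hn1 : n ≠ -1 := fun h1 => meromorphicOrderAt_deriv_ne_neg_one hf (by rw [hn, h1])
    obtain ⟨g, hg, hg0, e⟩ := (meromorphicOrderAt_eq_int_iff hf.deriv).1 hn
    obtain ⟨m, rfl⟩ : ∃ m : ℕ, n = -m := ⟨n.natAbs, by lia⟩
    have hk : AnalyticAt ℂ (fun s => (g s)⁻¹) 0 := hg.inv hg0
    have e1 : (fun s => (deriv f s)⁻¹) =ᶠ[𝓝[≠] 0] fun s => s ^ m * (g s)⁻¹ := by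
      filter_upwards [e] with s hs
      rw [hs]
      simp [mul_comm]
    have hg1 : ∀ᶠ s in 𝓝[≠] (0 : ℂ), g s ≠ 0 :=
      (hg.continuousAt.eventually_ne hg0).filter_mono nhdsWithin_le_nhds
    refine ⟨⟨_, (by fun_prop), e1⟩, ?_, ?_⟩
    · filter_upwards [e1, hg1, eventually_ne_zero_nhdsNE] with s h1 h2 h3
      rw [h1]
      exact mul_ne_zero (pow_ne_zero _ h3) (inv_ne_zero h2)
    -- If a = 1/f' is sᵐ times a unit with m ≥ 1, then a'²/a has order m - 2. The only harmful value
    -- is m = 1, a simple pole of df.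
    · have hm : m = 0 ∨ 2 ≤ m := by
        rcases m with _ | _ | m
        · simp
        · simp at hn1
        · right; lia
      have hka : ∀ᶠ s in 𝓝[≠] (0 : ℂ), AnalyticAt ℂ (fun s => (g s)⁻¹) s :=
        hk.eventually_analyticAt.filter_mono nhdsWithin_le_nhds
      rcases hm with rfl | hm
      · refine (((hk.deriv.mul hk.deriv).mul hg).reg).congr ?_
        filter_upwards [e1, deriv_eventuallyEq e1] with s h1 h2
        rw [h1, h2]
        simp only [pow_zero, one_mul, inv_inv, Pi.mul_apply]
        ring
      · obtain ⟨m, rfl⟩ := Nat.exists_eq_add_of_le hm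
        have := hk.deriv
        refine AnalyticAt.reg (f := fun s => s ^ m * (((2 + m : ℕ) : ℂ) * (g s)⁻¹ +
          s * deriv (fun s => (g s)⁻¹) s) ^ 2 * g s) (by fun_prop) |>.congr ?_
        filter_upwards [e1, deriv_eventuallyEq e1, hka, eventually_ne_zero_nhdsNE, hg1] with s h1 h2
          h3 h4 h5
        have h6 := (hasDerivAt_pow (2 + m) s).fun_mul h3.differentiableAt.hasDerivAt
        rw [h1, h2, h6.deriv]
        rw [show 2 + m - 1 = m + 1 by lia]
        field_simp
        ring

/-! ### Regular forms and Liouville's theorem -/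

/-- The differential `f(z) dz` is regular at `p`. -/
def RegForm (p : OnePoint ℂ) (f : ℂ → ℂ) : Prop := Reg fun t => f (chart p t) * deriv (chart p) t

theorem eventually_chart_coe {a : ℂ} {P : ℂ → Prop} :
    (∀ᶠ t in 𝓝[≠] (0 : ℂ), P (a + t)) ↔ ∀ᶠ z in 𝓝[≠] a, P z := by
  have : map (fun t : ℂ => a + t) (𝓝[≠] 0) = 𝓝[≠] a := by
    simp
  rw [← this, eventually_map]

/-- The local analytic extensions of `f` glue to an entire function G. Regularity at infinity says
G(1/t) = -t² g(t), so G tends to 0 and vanishes by Liouville. Since `f` may differ from G at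
isolated points, continuity at `z` is needed. -/
theorem eq_zero_of_regForm {f : ℂ → ℂ} (h : ∀ p, RegForm p f) {z : ℂ} (hz : ContinuousAt f z) :
    f z = 0 := by
  choose g hg e using h
  have hloc : ∀ a : ℂ, ∀ᶠ z in 𝓝[≠] a, f z = g a (z - a) := by
    intro a
    rw [← eventually_chart_coe]
    filter_upwards [e a] with t ht
    rw [deriv_chart_coe, mul_one, chart_coe] at ht
    rw [ht]; simp
  have hlim : ∀ a : ℂ, Tendsto f (𝓝[≠] a) (𝓝 (g a 0)) := by
    intro a
    have h1 : Tendsto (fun z => z - a) (𝓝[≠] a) (𝓝 0) := by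
      have : ContinuousAt (fun z : ℂ => z - a) a := by fun_prop
      simpa using this.tendsto.mono_left (nhdsWithin_le_nhds (s := {a}ᶜ))
    exact ((hg a).continuousAt.tendsto.comp h1).congr' ((hloc a).mono fun z hz => hz.symm)
  set G : ℂ → ℂ := fun a => g a 0
  have hG : ∀ a, G =ᶠ[𝓝 a] fun z => g a (z - a) := by
    intro a
    have h1 : ∀ᶠ z in 𝓝 a, z ≠ a → ∀ᶠ w in 𝓝 z, w ≠ a → f w = g a (w - a) :=
      ((eventually_nhdsWithin_iff.1 (hloc a)).eventually_nhds).mono fun z hz _ => hz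
    have h2 : ∀ᶠ z in 𝓝 a, AnalyticAt ℂ (g a) (z - a) := by
      have : ContinuousAt (fun z : ℂ => z - a) a := by fun_prop
      have h3 := this.tendsto
      rw [sub_self] at h3
      exact h3.eventually (hg a).eventually_analyticAt
    filter_upwards [h1, h2] with z h3 h4
    by_cases hza : z = a
    · subst hza; simp [G]
    · have h5 : ∀ᶠ w in 𝓝[≠] z, f w = g a (w - a) := by
        filter_upwards [(h3 hza).filter_mono nhdsWithin_le_nhds,
          (isOpen_ne.mem_nhds hza : {w | w ≠ a} ∈ 𝓝 z) |> mem_nhdsWithin_of_mem_nhds] with w h6 h7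
        exact h6 h7
      have h8 : Tendsto (fun w => g a (w - a)) (𝓝[≠] z) (𝓝 (g a (z - a))) := by
        have : ContinuousAt (fun w => g a (w - a)) z :=
          ContinuousAt.comp (f := fun w => w - a) h4.continuousAt (by fun_prop)
        exact this.tendsto.mono_left nhdsWithin_le_nhds
      exact tendsto_nhds_unique (hlim z) (h8.congr' (h5.mono fun w hw => hw.symm))
  have hGd : Differentiable ℂ G := fun a =>
    (DifferentiableAt.comp (g := g a) (f := fun z => z - a) a
      (by rw [sub_self]; exact (hg a).differentiableAt) (by fun_prop)).congr_of_eventuallyEq (hG a)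
  have hfG : ∀ a, f =ᶠ[𝓝[≠] a] G := fun a => by
    filter_upwards [hloc a, (hG a).filter_mono nhdsWithin_le_nhds] with z h1 h2
    rw [h1, h2]
  have hinf : Tendsto G (cocompact ℂ) (𝓝 0) := by
    have h1 : ∀ᶠ t in 𝓝[≠] (0 : ℂ), f t⁻¹ = -t ^ 2 * g OnePoint.infty t := by
      filter_upwards [e OnePoint.infty, eventually_ne_zero_nhdsNE] with t ht h0
      rw [← ht, deriv_chart_infty, chart_infty]
      field_simp
    have h2 : ∀ᶠ t in 𝓝[≠] (0 : ℂ), G t⁻¹ = -t ^ 2 * g OnePoint.infty t := by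
      have h3 : ∀ᶠ t in 𝓝[≠] (0 : ℂ), ∀ᶠ u in 𝓝 t, f u⁻¹ = -u ^ 2 * g OnePoint.infty u := by
        have h4 := (eventually_nhdsWithin_iff.1 h1).eventually_nhds
        filter_upwards [h4.filter_mono nhdsWithin_le_nhds, eventually_ne_zero_nhdsNE] with t h5 h6
        filter_upwards [h5, isOpen_ne.mem_nhds h6] with u h7 h8
        exact h7 h8
      have h9 : ∀ᶠ t in 𝓝[≠] (0 : ℂ), AnalyticAt ℂ (g OnePoint.infty) t :=
        (hg OnePoint.infty).eventually_analyticAt.filter_mono nhdsWithin_le_nhds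
      filter_upwards [h3, h9, eventually_ne_zero_nhdsNE] with t h4 h5 h6
      have h7 : Tendsto (fun w : ℂ => w⁻¹) (𝓝[≠] t⁻¹) (𝓝 t) := by
        have : ContinuousAt (fun w : ℂ => w⁻¹) t⁻¹ := continuousAt_inv₀ (inv_ne_zero h6)
        simpa using this.tendsto.mono_left (nhdsWithin_le_nhds (s := {t⁻¹}ᶜ))
      have h8 : Tendsto f (𝓝[≠] t⁻¹) (𝓝 (-t ^ 2 * g OnePoint.infty t)) := by
        have hc : ContinuousAt (fun u => -u ^ 2 * g OnePoint.infty u) t := by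
          have := h5.continuousAt
          fun_prop
        refine (hc.tendsto.comp h7).congr' ?_
        filter_upwards [h7.eventually h4] with w hw
        rw [inv_inv] at hw
        exact hw.symm
      exact tendsto_nhds_unique (hlim _) h8
    have h3 : Tendsto (fun t => G t⁻¹) (𝓝[≠] 0) (𝓝 0) := by
      have hc : ContinuousAt (fun u => -u ^ 2 * g OnePoint.infty u) 0 := by
        have := (hg OnePoint.infty).continuousAt
        fun_prop
      have := hc.tendsto.mono_left (nhdsWithin_le_nhds (s := {(0 : ℂ)}ᶜ))
      simp only [ne_eq, OfNat.ofNat_ne_zero, not_false_eq_true, zero_pow, neg_zero, zero_mul] at this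
      exact this.congr' (h2.mono fun t ht => ht.symm)
    have h4 := h3.comp (tendsto_inv₀_cobounded' : Tendsto Inv.inv (Bornology.cobounded ℂ) _)
    rw [← Metric.cobounded_eq_cocompact]
    refine h4.congr fun t => by simp
  have hG0 : G z = 0 := hGd.apply_eq_of_tendsto_cocompact z hinf
  have h1 := tendsto_nhds_unique (hlim z) (hz.tendsto.mono_left nhdsWithin_le_nhds)
  rw [← h1]; exact hG0

/-! ### Uniformisation at a simple ramification point -/

/-- A coordinate `s` at `p` in which `x = c + s²`, together with `y` in this coordinate. -/
structure Uniformizer (x y : RatFunc ℂ) (p : OnePoint ℂ) where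
  (τ ς Y : ℂ → ℂ)
  c : ℂ
  analyticAt_τ : AnalyticAt ℂ τ 0
  τ_zero : τ 0 = 0
  deriv_τ : deriv τ 0 ≠ 0
  analyticAt_ς : AnalyticAt ℂ ς 0
  ς_zero : ς 0 = 0
  deriv_ς : deriv ς 0 ≠ 0
  left_inv : ∀ᶠ s in 𝓝 0, ς (τ s) = s
  right_inv : ∀ᶠ t in 𝓝 0, τ (ς t) = t
  x_eq : ∀ᶠ s in 𝓝[≠] 0, ev x (chart p (τ s)) = c + s ^ 2
  analyticAt_Y : AnalyticAt ℂ Y 0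
  deriv_Y : deriv Y 0 ≠ 0
  y_eq : ∀ᶠ s in 𝓝[≠] 0, ev y (chart p (τ s)) = Y s

theorem exists_sqrt_of_analyticAt {v : ℂ → ℂ} (hv : AnalyticAt ℂ v 0) (h0 : v 0 ≠ 0) :
    ∃ r : ℂ → ℂ, AnalyticAt ℂ r 0 ∧ r 0 ≠ 0 ∧ ∀ᶠ t in 𝓝 0, r t ^ 2 = v t := by
  obtain ⟨k, hk⟩ := IsAlgClosed.exists_pow_nat_eq (v 0) (n := 2) (by norm_num)
  have hk0 : k ≠ 0 := by rintro rfl; simp at hk; exact h0 hk.symm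
  have h1 : AnalyticAt ℂ (fun t => v t / v 0) 0 := hv.div_const
  have h2 : v 0 / v 0 = 1 := div_self h0
  refine ⟨fun t => k * (v t / v 0) ^ (1 / 2 : ℂ), ?_, ?_, ?_⟩
  -- Division by `v 0` moves the base to 1, inside the domain of the principal branch.
  · exact analyticAt_const.mul (h1.cpow analyticAt_const (by
      simp only [h2]; exact Complex.one_mem_slitPlane))
  · simp [h2, hk0]
  · refine Eventually.of_forall fun t => ?_
    rw [mul_pow, hk, ← Complex.cpow_nat_mul]
    norm_num
    field_simp

/-- A simple zero of dx means x - c = t² v(t) with v(0) ≠ 0, and s = t √v is the coordinate. That y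
is regular at `p` and dy does not vanish there gives Y'(0) ≠ 0. -/
theorem exists_uniformizer {x y : RatFunc ℂ} (h : IsRegularAtRamification x y) {p : OnePoint ℂ}
    (hp : p ∈ ramificationPoints x) : Nonempty (Uniformizer x y p) := by
  set f := fun t => ev x (chart p t)
  have hf : MeromorphicAt f 0 := meromorphicAt_ev_chart x p
  have hord : meromorphicOrderAt (deriv f) 0 = (1 : ℤ) := h.simple p hp
  -- A pole of x would make the order of dx negative.
  have hreg : Reg f := by
    rw [reg_iff hf]
    by_contra hneg
    cases hn : meromorphicOrderAt f 0 with
    | top => simp [hn] at hneg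
    | coe n =>
      have hn0 : n < 0 := by rw [hn] at hneg; exact_mod_cast not_le.1 hneg
      have := meromorphicOrderAt_deriv_eq_sub_one (n := n) (by exact_mod_cast hn0.ne) hn
      rw [hord] at this
      have h1 : (1 : ℤ) = n - 1 := by exact_mod_cast this
      lia
  obtain ⟨F, hF, e⟩ := hreg
  have hF1 : AnalyticAt ℂ (fun t => F t - F 0) 0 := hF.sub analyticAt_const
  have hd : meromorphicOrderAt (deriv fun t => F t - F 0) 0 = (1 : ℤ) := by
    rw [← hord]
    refine meromorphicOrderAt_congr ?_
    refine EventuallyEq.trans ?_ (deriv_eventuallyEq e).symm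
    exact Eventually.of_forall fun t => by simp
  have hord2 : meromorphicOrderAt (fun t => F t - F 0) 0 = (2 : ℤ) := by
    have hpos : 0 < meromorphicOrderAt (fun t => F t - F 0) 0 := by
      rw [← tendsto_zero_iff_meromorphicOrderAt_pos hF1.meromorphicAt]
      simpa using hF1.continuousAt.tendsto.mono_left (nhdsWithin_le_nhds (s := {(0 : ℂ)}ᶜ))
    cases hn : meromorphicOrderAt (fun t => F t - F 0) 0 with
    | top =>
      have h1 : deriv (fun t => F t - F 0) =ᶠ[𝓝[≠] 0] deriv fun _ => 0 :=
        deriv_eventuallyEq (meromorphicOrderAt_eq_top_iff.1 hn)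
      have h2 : meromorphicOrderAt (deriv fun t => F t - F 0) 0 = ⊤ := by
        rw [meromorphicOrderAt_eq_top_iff]
        exact h1.mono fun s hs => by rw [hs]; simp
      rw [hd] at h2
      exact absurd h2 WithTop.coe_ne_top
    | coe n =>
      have hn0 : 0 < n := by rw [hn] at hpos; exact_mod_cast hpos
      have := meromorphicOrderAt_deriv_eq_sub_one (n := n) (by exact_mod_cast hn0.ne') hn
      rw [hd] at this
      have h1 : (1 : ℤ) = n - 1 := by exact_mod_cast this
      have : n = 2 := by lia
      rw [this]
  obtain ⟨v, hv, hv0, ev⟩ := (meromorphicOrderAt_eq_int_iff hF1.meromorphicAt).1 hord2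
  obtain ⟨r, hr, hr0, er⟩ := exists_sqrt_of_analyticAt hv hv0
  set ς : ℂ → ℂ := fun t => t * r t
  have hς : AnalyticAt ℂ ς 0 := analyticAt_id.mul hr
  have hς0 : ς 0 = 0 := by simp [ς]
  have hς1 : deriv ς 0 = r 0 := by
    have := ((hasDerivAt_id (0 : ℂ)).fun_mul hr.differentiableAt.hasDerivAt).deriv
    simpa using this
  have hς1' : deriv ς 0 ≠ 0 := by rwa [hς1]
  set τ := hς.hasStrictDerivAt.localInverse _ _ _ hς1'
  have hτ : AnalyticAt ℂ τ 0 := by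
    have := hς.analyticAt_localInverse hς1'
    rwa [hς0] at this
  have hleft : ∀ᶠ s in 𝓝 0, τ (ς s) = s :=
    HasStrictDerivAt.eventually_left_inverse hς.hasStrictDerivAt hς1'
  have hright : ∀ᶠ s in 𝓝 0, ς (τ s) = s := by
    have := HasStrictDerivAt.eventually_right_inverse hς.hasStrictDerivAt hς1'
    rwa [hς0] at this
  have hτ0 : τ 0 = 0 := by
    have := hleft.self_of_nhds
    rwa [hς0] at this
  have hτ1 : deriv τ 0 ≠ 0 := by
    have := (HasStrictDerivAt.to_localInverse hς.hasStrictDerivAt hς1').hasDerivAt.deriv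
    rw [hς0] at this
    rw [this]
    exact inv_ne_zero hς1'
  have hτt := tendsto_nhdsNE_of_analyticAt hτ hτ0 hτ1
  have hy : Reg fun t => XYSwap.ev y (chart p t) :=
    (reg_iff (meromorphicAt_ev_chart y p)).2 (h.regular p hp)
  obtain ⟨Y, hY, eY⟩ := hy
  have hY1 : deriv Y 0 ≠ 0 := by
    intro hc
    refine h.disjoint p hp ?_
    have h1 : ordDiffAt y p = meromorphicOrderAt (deriv Y) 0 :=
      meromorphicOrderAt_congr (deriv_eventuallyEq eY)
    have h2 : 0 < meromorphicOrderAt (deriv Y) 0 := by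
      have h3 : Tendsto (deriv Y) (𝓝[≠] 0) (𝓝 (deriv Y 0)) :=
        hY.deriv.continuousAt.tendsto.mono_left nhdsWithin_le_nhds
      rw [hc] at h3
      exact (tendsto_zero_iff_meromorphicOrderAt_pos hY.deriv.meromorphicAt).1 h3
    rw [← h1] at h2
    exact h2
  have hYτ : HasDerivAt (fun s => Y (τ s)) (deriv Y 0 * deriv τ 0) 0 := by
    have := hasDerivAt_comp_of_analyticAt (f := Y) (φ := τ) (s := 0) (by rwa [hτ0]) hτ
    rwa [hτ0] at this
  refine ⟨⟨τ, ς, fun s => Y (τ s), F 0, hτ, hτ0, hτ1, hς, hς0, hς1', hright, hleft, ?_,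
    AnalyticAt.fun_comp (by rwa [hτ0]) hτ, ?_, hτt.eventually eY⟩⟩
  · have er' : ∀ᶠ t in 𝓝[≠] 0, r t ^ 2 = v t := er.filter_mono nhdsWithin_le_nhds
    filter_upwards [hτt.eventually e, hτt.eventually ev, hτt.eventually er',
      hright.filter_mono nhdsWithin_le_nhds] with s h1 h2 h3 h4
    have h5 : f (τ s) = XYSwap.ev x (chart p (τ s)) := rfl
    have h6 : s ^ 2 = τ s ^ 2 * v (τ s) := by
      rw [← h3, ← mul_pow]
      exact congrArg (· ^ 2) h4.symm
    simp only [sub_zero, smul_eq_mul] at h2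
    rw [← h5, h1, h6]
    have : (τ s) ^ (2 : ℤ) = τ s ^ 2 := by norm_cast
    rw [this] at h2
    linear_combination h2
  · rw [hYτ.deriv]
    exact mul_ne_zero hY1 hτ1

/-- The Bergman kernel is invariant under Möbius maps, in particular under z ↦ 1/z. -/
theorem bergman_chart (p : OnePoint ℂ) {t u : ℂ} (ht : t ≠ 0) (hu : u ≠ 0) :
    deriv (chart p) t * deriv (chart p) u * ((chart p t - chart p u) ^ 2)⁻¹ =
      ((t - u) ^ 2)⁻¹ := by
  induction p using OnePoint.rec with
  | infty =>
    rw [deriv_chart_infty, deriv_chart_infty, chart_infty, neg_mul_neg, ← mul_inv, ← mul_inv]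
    congr 1
    simp only
    field_simp
    ring
  | coe a => rw [deriv_chart_coe, deriv_chart_coe, chart_coe]; simp

namespace Uniformizer

variable {x y : RatFunc ℂ} {p : OnePoint ℂ} (U : Uniformizer x y p)

/-- The coordinate `s`, as a map to the affine part of the sphere. -/
def φ (s : ℂ) : ℂ := chart p (U.τ s)

theorem tendsto_τ : Tendsto U.τ (𝓝[≠] 0) (𝓝[≠] 0) :=
  tendsto_nhdsNE_of_analyticAt U.analyticAt_τ U.τ_zero U.deriv_τ

theorem tendsto_ς : Tendsto U.ς (𝓝[≠] 0) (𝓝[≠] 0) :=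
  tendsto_nhdsNE_of_analyticAt U.analyticAt_ς U.ς_zero U.deriv_ς

theorem eventually_deriv_φ :
    ∀ᶠ s in 𝓝[≠] (0 : ℂ), deriv U.φ s = deriv (chart p) (U.τ s) * deriv U.τ s := by
  filter_upwards [U.tendsto_τ.eventually (isCoord_chart p),
    U.analyticAt_τ.eventually_analyticAt.filter_mono nhdsWithin_le_nhds] with s h1 h2
  exact (hasDerivAt_comp_of_analyticAt h1.1 h2).deriv

theorem eventually_deriv_τ_ne : ∀ᶠ s in 𝓝[≠] (0 : ℂ), deriv U.τ s ≠ 0 :=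
  (U.analyticAt_τ.deriv.continuousAt.eventually_ne U.deriv_τ).filter_mono nhdsWithin_le_nhds

theorem isCoord : IsCoord U.φ := by
  filter_upwards [U.tendsto_τ.eventually (isCoord_chart p), U.eventually_deriv_φ,
    U.analyticAt_τ.eventually_analyticAt.filter_mono nhdsWithin_le_nhds,
    U.eventually_deriv_τ_ne] with s h1 h2 h3 h4
  have h5 : AnalyticAt ℂ (fun s => chart p (U.τ s)) s := AnalyticAt.fun_comp h1.1 h3
  exact ⟨h5, h2 ▸ mul_ne_zero h1.2 h4⟩

theorem eventually_φ {P : ℂ → Prop} (h : ∀ᶠ t in 𝓝[≠] (0 : ℂ), P (chart p t)) :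
    ∀ᶠ s in 𝓝[≠] (0 : ℂ), P (U.φ s) := U.tendsto_τ.eventually h

theorem bergman_eq : ∀ᶠ s in 𝓝[≠] (0 : ℂ),
    deriv U.φ s * deriv U.φ (-s) * ((U.φ s - U.φ (-s)) ^ 2)⁻¹ = bergmanAntidiag U.τ s := by
  filter_upwards [U.eventually_deriv_φ, eventually_nhdsNE_neg U.eventually_deriv_φ,
    U.tendsto_τ.eventually eventually_ne_zero_nhdsNE,
    eventually_nhdsNE_neg (U.tendsto_τ.eventually eventually_ne_zero_nhdsNE)] with s h1 h2 h3 h4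
  have h5 := bergman_chart p h3 h4
  rw [h1, h2, bergmanAntidiag, ← mul_inv, ← sq, ← h5]
  simp only [φ]
  ring

/-- Both kinds of chart are Möbius maps, and composing with one from the left leaves the Schwarzian
derivative unchanged. -/
theorem schwarzian_eq : ∀ᶠ s in 𝓝[≠] (0 : ℂ), schwarzian U.φ s = schwarzian U.τ s := by
  have hτ : IsCoord U.τ := by
    filter_upwards [U.analyticAt_τ.eventually_analyticAt.filter_mono nhdsWithin_le_nhds,
      U.eventually_deriv_τ_ne] with s h1 h2 using ⟨h1, h2⟩
  have hd : deriv U.φ =ᶠ[𝓝[≠] 0] fun s => deriv (chart p) (U.τ s) * deriv U.τ s :=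
    U.eventually_deriv_φ
  have key : ∀ᶠ s in 𝓝[≠] (0 : ℂ), schwarzian U.φ s = schwarzian U.τ s := by
    induction p using OnePoint.rec with
    | coe a =>
      have h1 : deriv U.φ =ᶠ[𝓝[≠] 0] deriv U.τ := hd.trans
        (Eventually.of_forall fun s => by simp only [deriv_chart_coe, one_mul])
      have h2 := deriv_eventuallyEq h1
      have h3 : (fun s => deriv (deriv U.φ) s * (deriv U.φ s)⁻¹) =ᶠ[𝓝[≠] 0]
          fun s => deriv (deriv U.τ) s * (deriv U.τ s)⁻¹ := h2.mul h1.inv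
      filter_upwards [h3, deriv_eventuallyEq h3] with s h4 h5
      simp only [schwarzian, h5]
      rw [h4]
    | infty =>
      have h1 : deriv U.φ =ᶠ[𝓝[≠] 0] fun s => -((U.τ s) ^ 2)⁻¹ * deriv U.τ s := hd.trans
        (Eventually.of_forall fun s => by simp only [deriv_chart_infty])
      have hne := U.tendsto_τ.eventually eventually_ne_zero_nhdsNE
      have h2 : deriv (deriv U.φ) =ᶠ[𝓝[≠] 0] fun s =>
          2 * ((U.τ s) ^ 3)⁻¹ * deriv U.τ s ^ 2 - ((U.τ s) ^ 2)⁻¹ * deriv (deriv U.τ) s := by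
        filter_upwards [deriv_eventuallyEq h1, hτ, hne] with s e1 e2 e3
        rw [e1, ((((e2.1.differentiableAt.hasDerivAt.fun_pow 2).fun_inv (pow_ne_zero 2 e3)).fun_neg
          ).fun_mul e2.1.deriv.differentiableAt.hasDerivAt).deriv]
        norm_num
        field_simp
        ring
      have h3 : deriv (deriv (deriv U.φ)) =ᶠ[𝓝[≠] 0] fun s =>
          -6 * ((U.τ s) ^ 4)⁻¹ * deriv U.τ s ^ 3 +
          6 * ((U.τ s) ^ 3)⁻¹ * deriv U.τ s * deriv (deriv U.τ) s -
          ((U.τ s) ^ 2)⁻¹ * deriv (deriv (deriv U.τ)) s := by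
        filter_upwards [deriv_eventuallyEq h2, hτ, hne] with s e1 e2 e3
        have d0 := e2.1.differentiableAt.hasDerivAt
        have d1 := e2.1.deriv.differentiableAt.hasDerivAt
        have d2 := e2.1.deriv.deriv.differentiableAt.hasDerivAt
        rw [e1, (((((d0.fun_pow 3).fun_inv (pow_ne_zero 3 e3)).const_mul 2).fun_mul
          (d1.fun_pow 2)).fun_sub (((d0.fun_pow 2).fun_inv (pow_ne_zero 2 e3)).fun_mul d2)).deriv]
        norm_num
        field_simp
        ring
      filter_upwards [h1, h2, h3, schwarzian_eventuallyEq U.isCoord, schwarzian_eventuallyEq hτ,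
        hτ, hne] with s e1 e2 e3 e4 e5 e6 e7
      have := e6.2
      rw [e4, e5, e1, e2, e3]
      field_simp
      ring
  exact key

/-- Regularity of a form can be checked in the coordinate `s`. -/
theorem regForm {f : ℂ → ℂ} (h : Reg fun s => f (U.φ s) * deriv U.φ s) : RegForm p f := by
  refine (((h.comp U.analyticAt_ς U.ς_zero U.deriv_ς).mul U.analyticAt_ς.deriv.reg)).congr ?_
  have h1 : ∀ᶠ t in 𝓝[≠] (0 : ℂ), ∀ᶠ u in 𝓝 t, U.τ (U.ς u) = u :=
    U.right_inv.eventually_nhds.filter_mono nhdsWithin_le_nhds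
  filter_upwards [U.tendsto_ς.eventually U.eventually_deriv_φ, h1,
    U.tendsto_ς.eventually (U.analyticAt_τ.eventually_analyticAt.filter_mono nhdsWithin_le_nhds),
    U.analyticAt_ς.eventually_analyticAt.filter_mono nhdsWithin_le_nhds] with t e1 e2 e3 e4
  have h2 : deriv U.τ (U.ς t) * deriv U.ς t = 1 := by
    have h3 := hasDerivAt_comp_of_analyticAt e3 e4
    have h4 : (fun u => U.τ (U.ς u)) =ᶠ[𝓝 t] fun u => u := e2
    have h5 := h4.deriv_eq
    rw [h3.deriv] at h5
    simpa using h5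
  rw [e1, φ, e2.self_of_nhds]
  linear_combination (-(f (chart p t) * deriv (chart p) t)) * h2

theorem reg_comp {f : ℂ → ℂ} (h : RegForm p f) : Reg fun s => f (U.φ s) * deriv U.φ s := by
  refine ((h.comp U.analyticAt_τ U.τ_zero U.deriv_τ).mul U.analyticAt_τ.deriv.reg).congr ?_
  filter_upwards [U.eventually_deriv_φ] with s hs
  rw [hs, φ]; ring

end Uniformizer

/-! ### The Galois involution -/

def chartInv (p : OnePoint ℂ) (z : ℂ) : ℂ := p.elim z⁻¹ (fun a => z - a)

theorem chartInv_chart (p : OnePoint ℂ) (t : ℂ) : chartInv p (chart p t) = t := by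
  induction p using OnePoint.rec with
  | infty => exact inv_inv t
  | coe a => exact add_sub_cancel_left a t

theorem chart_chartInv (p : OnePoint ℂ) (z : ℂ) : chart p (chartInv p z) = z := by
  induction p using OnePoint.rec with
  | infty => exact inv_inv z
  | coe a => exact add_sub_cancel a z

theorem tendsto_chartInv (p : OnePoint ℂ) : Tendsto (chartInv p) (punctured p) (𝓝[≠] 0) := by
  rw [punctured, tendsto_map'_iff]
  exact tendsto_id.congr fun t => (chartInv_chart p t).symm

namespace Uniformizer

variable {x y : RatFunc ℂ} {p : OnePoint ℂ} (U : Uniformizer x y p)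

theorem x_chart : ∀ᶠ t in 𝓝[≠] (0 : ℂ), ev x (chart p t) = U.c + U.ς t ^ 2 := by
  filter_upwards [U.tendsto_ς.eventually U.x_eq, U.right_inv.filter_mono nhdsWithin_le_nhds] with
    t h1 h2
  rwa [h2] at h1

theorem tendsto_neg : Tendsto (fun s : ℂ => -s) (𝓝[≠] 0) (𝓝[≠] 0) :=
  tendsto_nhdsNE_of_analyticAt analyticAt_id.neg (by simp) (by simp)

/-- The reflection s ↦ -s is a witness, so the choice made by `Classical.epsilon` has the required
property. -/
theorem isGaloisInvolution (U : Uniformizer x y p) :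
    IsGaloisInvolution x p (galoisInvolution x p) := by
  refine Classical.epsilon_spec (p := IsGaloisInvolution x p)
    ⟨fun q => chart p (U.τ (-U.ς (chartInv p q))), ?_, ?_⟩
  · have h1 : Tendsto (fun q => U.τ (-U.ς (chartInv p q))) (punctured p) (𝓝[≠] 0) :=
      U.tendsto_τ.comp (tendsto_neg.comp (U.tendsto_ς.comp (tendsto_chartInv p)))
    exact tendsto_map.comp h1
  · rw [punctured, eventually_map]
    have h1 := (U.tendsto_τ.comp (tendsto_neg.comp U.tendsto_ς)).eventually U.x_chart
    have h2 := (tendsto_neg.comp U.tendsto_ς).eventually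
      (U.left_inv.filter_mono nhdsWithin_le_nhds)
    filter_upwards [U.x_chart, h1, h2, U.tendsto_ς.eventually eventually_ne_zero_nhdsNE] with t
      h3 h4 h5 h6
    simp only [Function.comp_apply] at h4 h5
    rw [chartInv_chart]
    refine ⟨by rw [h4, h5, h3]; ring, fun h7 => h6 ?_⟩
    have h8 := chart_injective p h7
    rw [h8] at h5
    have h9 : (2 : ℂ) * U.ς t = 0 := by linear_combination h5
    simpa using h9

/-- Equality of the values c + ς² leaves ς ∘ σ = ±ς, and the plus sign would give σ(q) = q. The
chosen germ is therefore s ↦ -s. -/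
theorem galoisInvolution_chart : ∀ᶠ t in 𝓝[≠] (0 : ℂ),
    galoisInvolution x p (chart p t) = chart p (U.τ (-U.ς t)) := by
  obtain ⟨h1, h2⟩ := U.isGaloisInvolution
  set σ := galoisInvolution x p
  have hu : Tendsto (fun t => chartInv p (σ (chart p t))) (𝓝[≠] 0) (𝓝[≠] 0) :=
    (tendsto_chartInv p).comp (h1.comp tendsto_map)
  rw [punctured, eventually_map] at h2
  filter_upwards [h2, U.x_chart, hu.eventually U.x_chart,
    hu.eventually (U.right_inv.filter_mono nhdsWithin_le_nhds),
    U.right_inv.filter_mono nhdsWithin_le_nhds] with t h3 h4 h5 h6 h7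
  rw [chart_chartInv, h3.1, h4] at h5
  have h8 : (U.ς (chartInv p (σ (chart p t))) - U.ς t) *
      (U.ς (chartInv p (σ (chart p t))) + U.ς t) = 0 := by linear_combination -h5
  rcases mul_eq_zero.1 h8 with h9 | h9
  · rw [sub_eq_zero.1 h9, h7] at h6
    refine absurd ?_ h3.2
    have h10 := congrArg (chart p) h6
    rw [chart_chartInv] at h10
    exact h10.symm
  · rw [eq_neg_of_add_eq_zero_left h9] at h6
    rw [h6, chart_chartInv]

theorem galoisInvolution_φ : ∀ᶠ s in 𝓝[≠] (0 : ℂ), galoisInvolution x p (U.φ s) = U.φ (-s) := by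
  filter_upwards [U.tendsto_τ.eventually U.galoisInvolution_chart,
    U.left_inv.filter_mono nhdsWithin_le_nhds] with s h1 h2
  rw [φ, h1, h2, φ]

theorem deriv_galoisInvolution_φ : ∀ᶠ s in 𝓝[≠] (0 : ℂ),
    deriv (galoisInvolution x p) (U.φ s) = -(deriv U.φ (-s) * (deriv U.φ s)⁻¹) := by
  have h1 : ∀ᶠ s in 𝓝[≠] (0 : ℂ), ∀ᶠ u in 𝓝 s, galoisInvolution x p (U.φ u) = U.φ (-u) := by
    have := (eventually_nhdsWithin_iff.1 U.galoisInvolution_φ).eventually_nhds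
    filter_upwards [this.filter_mono nhdsWithin_le_nhds, eventually_ne_zero_nhdsNE] with s h5 h6
    filter_upwards [h5, isOpen_ne.mem_nhds h6] with u h7 h8
    exact h7 h8
  filter_upwards [h1, U.isCoord, eventually_nhdsNE_neg U.isCoord] with s h2 h3 h4
  -- Near φ(s) the involution is the conjugate of u ↦ -u by φ, and `r` is the local inverse of φ.
  set r := h3.1.hasStrictDerivAt.localInverse _ _ _ h3.2
  have hr : HasDerivAt r (deriv U.φ s)⁻¹ (U.φ s) :=
    (HasStrictDerivAt.to_localInverse h3.1.hasStrictDerivAt h3.2).hasDerivAt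
  have hrs : r (U.φ s) = s :=
    (HasStrictDerivAt.eventually_left_inverse h3.1.hasStrictDerivAt h3.2).self_of_nhds
  have hright := HasStrictDerivAt.eventually_right_inverse h3.1.hasStrictDerivAt h3.2
  have hrt : Tendsto r (𝓝 (U.φ s)) (𝓝 s) := by
    have := hr.continuousAt.tendsto
    rwa [hrs] at this
  have e : galoisInvolution x p =ᶠ[𝓝 (U.φ s)] fun q => U.φ (-r q) := by
    filter_upwards [hrt.eventually h2, hright] with q h5 h6
    have h7 : U.φ (r q) = q := h6
    rw [← h5, h7]
  have hd : HasDerivAt (fun q => U.φ (-r q)) (deriv U.φ (-s) * -(deriv U.φ s)⁻¹) (U.φ s) := by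
    have h6 : HasDerivAt U.φ (deriv U.φ (-s)) (-r (U.φ s)) := by
      rw [hrs]; exact h4.1.differentiableAt.hasDerivAt
    exact HasDerivAt.comp (h₂ := U.φ) (h := fun q => -r q) (U.φ s) h6 hr.fun_neg
  rw [e.deriv_eq, hd.deriv, mul_neg]

end Uniformizer

/-! ### The residues in the recursion -/

/-- The differential on the affine line with expansion `t⁻ʲ⁻¹ dt` at `p`, for `1 ≤ j`. -/
def poleForm (p : OnePoint ℂ) (j : ℕ) (z : ℂ) : ℂ :=
  p.elim (-z ^ (j - 1)) fun a => ((z - a) ^ (j + 1))⁻¹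

theorem poleForm_chart (p : OnePoint ℂ) {j : ℕ} (hj : 1 ≤ j) {t : ℂ} (ht : t ≠ 0) :
    poleForm p j (chart p t) * deriv (chart p) t = (t ^ (j + 1))⁻¹ := by
  induction p using OnePoint.rec with
  | infty =>
    rw [deriv_chart_infty, chart_infty]
    obtain ⟨i, rfl⟩ := Nat.exists_eq_add_of_le' hj
    simp only [poleForm, OnePoint.elim_infty, Nat.add_sub_cancel, inv_pow]
    field_simp
    ring
  | coe a =>
    rw [deriv_chart_coe, chart_coe]
    simp [poleForm]

theorem analyticAt_poleForm {p : OnePoint ℂ} {z : ℂ} (h : (z : OnePoint ℂ) ≠ p) (j : ℕ) :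
    AnalyticAt ℂ (poleForm p j) z := by
  induction p using OnePoint.rec with
  | infty => exact AnalyticAt.neg (by fun_prop)
  | coe a =>
    have h1 : z - a ≠ 0 := sub_ne_zero.2 fun e => h (by rw [e])
    exact AnalyticAt.inv (by fun_prop) (pow_ne_zero _ h1)

theorem regForm_of_analyticAt {f : ℂ → ℂ} {a : ℂ} (h : AnalyticAt ℂ f a) : RegForm a f := by
  have h1 : AnalyticAt ℂ (fun t => f (a + t)) 0 :=
    AnalyticAt.fun_comp (g := f) (f := fun t => a + t) (by simpa using h) (by fun_prop)
  refine h1.reg.congr (Eventually.of_forall fun t => ?_)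
  dsimp only
  rw [deriv_chart_coe, mul_one, chart_coe]

theorem regForm_poleForm {p q : OnePoint ℂ} (h : q ≠ p) {j : ℕ} (hj : 1 ≤ j) :
    RegForm q (poleForm p j) := by
  induction q using OnePoint.rec with
  | coe b => exact regForm_of_analyticAt (analyticAt_poleForm h j)
  | infty =>
    induction p using OnePoint.rec with
    | infty => exact absurd rfl h
    | coe a =>
      obtain ⟨i, rfl⟩ := Nat.exists_eq_add_of_le' hj
      have h1 : AnalyticAt ℂ (fun t : ℂ => -(t ^ i * ((1 - a * t) ^ (i + 2))⁻¹)) 0 :=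
        ((analyticAt_id.pow i).mul (AnalyticAt.inv (by fun_prop) (by simp))).neg
      refine h1.reg.congr ?_
      have h2 : ∀ᶠ t in 𝓝[≠] (0 : ℂ), 1 - a * t ≠ 0 := by
        have h3 : ContinuousAt (fun t : ℂ => 1 - a * t) 0 := by fun_prop
        exact (h3.eventually_ne (by simp)).filter_mono nhdsWithin_le_nhds
      filter_upwards [h2, eventually_ne_zero_nhdsNE] with t h3 h4
      rw [deriv_chart_infty, chart_infty]
      simp only [poleForm, OnePoint.elim_some]
      have h5 : t⁻¹ - a = (1 - a * t) * t⁻¹ := by field_simp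
      rw [h5, mul_pow, inv_pow]
      field_simp
      ring

/-- The differential with prescribed principal part at `p` and no other pole. -/
def principal (p : OnePoint ℂ) (j : Jet) (z : ℂ) : ℂ :=
  j.c4 * poleForm p 1 z + j.c3 * poleForm p 2 z + j.c2 * poleForm p 3 z + j.c1 * poleForm p 4 z +
    j.c0 * poleForm p 5 z

theorem analyticAt_principal {p : OnePoint ℂ} {z : ℂ} (h : (z : OnePoint ℂ) ≠ p) (j : Jet) :
    AnalyticAt ℂ (principal p j) z := by
  have h1 := fun i => analyticAt_poleForm h i
  have e : principal p j = fun z => j.c4 * poleForm p 1 z + j.c3 * poleForm p 2 z +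
    j.c2 * poleForm p 3 z + j.c1 * poleForm p 4 z + j.c0 * poleForm p 5 z := rfl
  rw [e]
  have := h1 1; have := h1 2; have := h1 3; have := h1 4; have := h1 5
  fun_prop

theorem regForm_principal {p q : OnePoint ℂ} (h : q ≠ p) (j : Jet) :
    RegForm q (principal p j) := by
  have h1 := fun i (hi : 1 ≤ i) => regForm_poleForm h hi
  refine ((((((h1 1 le_rfl).const_mul j.c4).add ((h1 2 (by simp)).const_mul j.c3)).add
    ((h1 3 (by simp)).const_mul j.c2)).add ((h1 4 (by simp)).const_mul j.c1)).add
    ((h1 5 (by simp)).const_mul j.c0)).congr (Eventually.of_forall fun t => ?_)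
  simp only [principal]
  ring

theorem reg_principal_sub (p : OnePoint ℂ) {j : Jet} {G : ℂ → ℂ} (hG : HasJet 6 G j)
    (h5 : j.c5 = 0) : Reg fun t => principal p j (chart p t) * deriv (chart p) t - G t := by
  obtain ⟨g, hg, e⟩ := hG
  refine hg.neg.reg.congr ?_
  filter_upwards [e, eventually_ne_zero_nhdsNE] with t h1 h2
  have h3 := fun i (hi : 1 ≤ i) => poleForm_chart p hi h2
  have h4 : principal p j (chart p t) * deriv (chart p) t = j.c4 * (t ^ 2)⁻¹ + j.c3 * (t ^ 3)⁻¹ +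
      j.c2 * (t ^ 4)⁻¹ + j.c1 * (t ^ 5)⁻¹ + j.c0 * (t ^ 6)⁻¹ := by
    rw [← h3 1 le_rfl, ← h3 2 (by simp), ← h3 3 (by simp), ← h3 4 (by simp), ← h3 5 (by simp),
      principal]
    ring
  rw [h4]
  simp only [Jet.eval, h5] at h1
  have h6 : t ^ 6 ≠ 0 := pow_ne_zero 6 h2
  rw [← mul_right_inj' h6, mul_sub, h1]
  simp only [Pi.neg_apply]
  field_simp
  ring

/-- The jet of `t ↦ 1 / (z - chart p t)`. -/
def cauchyJet (p : OnePoint ℂ) (z : ℂ) : Jet where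
  c0 := p.elim 0 fun a => (z - a)⁻¹
  c1 := poleForm p 1 z
  c2 := poleForm p 2 z
  c3 := poleForm p 3 z
  c4 := poleForm p 4 z
  c5 := poleForm p 5 z

/-- The geometric series of 1/(z - a - t), or of -t/(1 - zt) at infinity. Its higher coefficients
are the forms `poleForm`, so that a residue against 1/(z - q) reproduces principal parts. -/
theorem hasJet_cauchy {p : OnePoint ℂ} {z : ℂ} (h : (z : OnePoint ℂ) ≠ p) :
    HasJet 0 (fun t => 1 / (z - chart p t)) (cauchyJet p z) := by
  induction p using OnePoint.rec with
  | infty =>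
    have h1 : ∀ᶠ t in 𝓝[≠] (0 : ℂ), 1 - z * t ≠ 0 := by
      have h3 : ContinuousAt (fun t : ℂ => 1 - z * t) 0 := by fun_prop
      exact (h3.eventually_ne (by simp)).filter_mono nhdsWithin_le_nhds
    refine ⟨fun t => -z ^ 5 * (1 - z * t)⁻¹,
      analyticAt_const.mul (AnalyticAt.inv (by fun_prop) (by simp)), ?_⟩
    filter_upwards [h1, eventually_ne_zero_nhdsNE] with t h2 h3
    have h4 : z - t⁻¹ = -(1 - z * t) * t⁻¹ := by field_simp; ring
    rw [chart_infty]
    simp only [h4, Jet.eval, cauchyJet, poleForm, OnePoint.elim_infty]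
    field_simp
    ring
  | coe a =>
    have h0 : z - a ≠ 0 := sub_ne_zero.2 fun e => h (by rw [e])
    have h1 : ∀ᶠ t in 𝓝[≠] (0 : ℂ), z - a - t ≠ 0 := by
      have h3 : ContinuousAt (fun t : ℂ => z - a - t) 0 := by fun_prop
      exact (h3.eventually_ne (by simpa using h0)).filter_mono nhdsWithin_le_nhds
    refine ⟨fun t => ((z - a) ^ 6)⁻¹ * (z - a - t)⁻¹,
      analyticAt_const.mul (AnalyticAt.inv (by fun_prop) (by simpa using h0)), ?_⟩
    filter_upwards [h1] with t h2
    rw [chart_coe]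
    simp only [Jet.eval, cauchyJet, poleForm, OnePoint.elim_some, ← sub_sub]
    generalize z - a = v at *
    field_simp
    ring

/-- The local expression `-Q(s) / (2 s (Y(s) - Y(-s)))` of the recursion at a ramification point. -/
def localForm (Y Q : ℂ → ℂ) (s : ℂ) : ℂ := -Q s * ((2 * s)⁻¹ * (Y s - Y (-s))⁻¹)

theorem localForm_neg {Y Q : ℂ → ℂ} {s : ℂ} (h : Q (-s) = Q s) :
    localForm Y Q (-s) = localForm Y Q s := by
  have h1 : Y (-s) - Y s = -(Y s - Y (-s)) := by ring
  rw [localForm, localForm, h, neg_neg, h1, mul_neg, inv_neg, inv_neg]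
  ring

/-- `Q` is the integrand `F` in the coordinate of `U`. -/
structure IsLocalData {x y : RatFunc ℂ} {p : OnePoint ℂ} (U : Uniformizer x y p) (F Q : ℂ → ℂ) :
    Prop where
  even : ∀ᶠ s in 𝓝[≠] (0 : ℂ), Q (-s) = Q s
  jet : ∃ j, HasJet 4 Q j
  eq : ∀ᶠ s in 𝓝[≠] (0 : ℂ), F (U.φ s) * (deriv U.φ s * deriv U.φ (-s)) = Q s

namespace Uniformizer

variable {x y : RatFunc ℂ} {p : OnePoint ℂ} (U : Uniformizer x y p)

theorem eventually_ς_τ : ∀ᶠ s in 𝓝[≠] (0 : ℂ), deriv U.ς (U.τ s) * deriv U.τ s = 1 := by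
  have h1 : ∀ᶠ t in 𝓝[≠] (0 : ℂ), ∀ᶠ u in 𝓝 t, U.ς (U.τ u) = u :=
    U.left_inv.eventually_nhds.filter_mono nhdsWithin_le_nhds
  filter_upwards [h1, U.analyticAt_τ.eventually_analyticAt.filter_mono nhdsWithin_le_nhds,
    U.tendsto_τ.eventually (U.analyticAt_ς.eventually_analyticAt.filter_mono nhdsWithin_le_nhds)]
    with s e2 e3 e4
  have h3 := hasDerivAt_comp_of_analyticAt e4 e3
  have h4 : (fun u => U.ς (U.τ u)) =ᶠ[𝓝 s] fun u => u := e2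
  have h5 := h4.deriv_eq
  rw [h3.deriv] at h5
  simpa using h5

/-- The form `G(s) ds` in the parameter of the chart. -/
def toChart (G : ℂ → ℂ) (t : ℂ) : ℂ := G (U.ς t) * deriv U.ς t

theorem toChart_τ (G : ℂ → ℂ) :
    ∀ᶠ s in 𝓝[≠] (0 : ℂ), U.toChart G (U.τ s) * deriv U.τ s = G s := by
  filter_upwards [U.eventually_ς_τ, U.left_inv.filter_mono nhdsWithin_le_nhds] with s h1 h2
  rw [toChart, h2, mul_assoc, h1, mul_one]

theorem exists_hasJet_toChart {G : ℂ → ℂ} {m : ℕ} {j : Jet} (h : HasJet m G j) :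
    ∃ k, HasJet m (U.toChart G) k := by
  refine HasJet.exists_of_reg_pow_mul ?_
  have h1 : deriv U.ς 0 ≠ 0 := U.deriv_ς
  have h2 : AnalyticAt ℂ (fun t => (dslope U.ς 0 t)⁻¹) 0 :=
    (analyticAt_dslope U.analyticAt_ς).inv (by simpa using h1)
  refine ((h.reg_pow_mul.comp U.analyticAt_ς U.ς_zero U.deriv_ς).mul
    ((h2.pow m).mul U.analyticAt_ς.deriv).reg).congr ?_
  have h3 : ∀ᶠ t in 𝓝[≠] (0 : ℂ), dslope U.ς 0 t ≠ 0 :=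
    ((analyticAt_dslope U.analyticAt_ς).continuousAt.eventually_ne (by simpa using h1)).filter_mono
      nhdsWithin_le_nhds
  filter_upwards [h3] with t h4
  have h5 := eq_add_mul_dslope U.ς t
  rw [U.ς_zero, zero_add] at h5
  have h6 : U.ς t ^ m * (dslope U.ς 0 t)⁻¹ ^ m = t ^ m := by
    rw [h5, mul_pow, mul_assoc, ← mul_pow, mul_inv_cancel₀ h4, one_pow, mul_one]
  simp only [toChart, Pi.mul_apply, Pi.pow_apply]
  linear_combination (-(G (U.ς t) * deriv U.ς t)) * h6

/-- Substituting -s changes the sign of the residue of an even function. -/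
theorem hasRes_of_even {G : ℂ → ℂ} (h : ∀ᶠ s in 𝓝[≠] (0 : ℂ), G (-s) = G s) {r : ℂ}
    (hr : HasRes G r) : r = 0 := by
  have h1 := hr.comp_neg.congr (G := G) (h.mono fun s hs => hs.symm)
  have h2 := h1.unique hr
  have h3 : 2 * r = 0 := by linear_combination -h2
  simpa using h3

theorem hasRes_comp {G : ℂ → ℂ} {r : ℂ} (h : HasRes (U.toChart G) r) : HasRes G r :=
  (h.comp U.analyticAt_τ U.τ_zero U.deriv_τ).congr ((U.toChart_τ G).mono fun _ hs => hs.symm)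

theorem deriv_x : ∀ᶠ s in 𝓝[≠] (0 : ℂ), deriv (ev x) (U.φ s) * deriv U.φ s = 2 * s := by
  have h1 : ∀ᶠ s in 𝓝[≠] (0 : ℂ), AnalyticAt ℂ (ev x) (U.φ s) :=
    (U.eventually_φ (P := fun z => z ∉ {z | x.denom.eval z = 0})
      (eventually_chart_notMem p (finite_denom_zero x))).mono fun s hs => analyticAt_ev hs
  have h2 : (fun s => ev x (U.φ s)) =ᶠ[𝓝[≠] 0] fun s => U.c + s ^ 2 := U.x_eq
  filter_upwards [h1, U.isCoord, deriv_eventuallyEq h2] with s h3 h4 h5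
  rw [← (hasDerivAt_comp_of_analyticAt h3 h4.1).deriv, h5]
  simp

/-- Here dx = 2s ds, so the denominator of the kernel becomes 2s (Y(s) - Y(-s)) up to the Jacobian.
The overall sign comes from the derivative of the involution. -/
theorem kernel_φ (z : ℂ) : ∀ᶠ s in 𝓝[≠] (0 : ℂ),
    recursionKernel x y (galoisInvolution x p) z (U.φ s) * deriv (galoisInvolution x p) (U.φ s) *
      deriv U.φ s = -(1 / 2) * (1 / (z - U.φ s) - 1 / (z - U.φ (-s))) *
        ((2 * s)⁻¹ * (U.Y s - U.Y (-s))⁻¹) * (deriv U.φ s * deriv U.φ (-s)) := by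
  filter_upwards [U.galoisInvolution_φ, U.deriv_galoisInvolution_φ, U.deriv_x,
    eventually_nhdsNE_neg U.deriv_x, U.isCoord, U.y_eq, eventually_nhdsNE_neg U.y_eq] with
    s h1 h2 h3 h4 h5 h6 h7
  rw [recursionKernel, bergmanIntegral, h1, h2]
  have h8 : ev y (U.φ s) = U.Y s := h6
  have h9 : ev y (U.φ (-s)) = U.Y (-s) := h7
  have h10 : (ev y (U.φ s) * deriv (ev x) (U.φ s) - ev y (U.φ (-s)) * deriv (ev x) (U.φ (-s)) *
      -(deriv U.φ (-s) * (deriv U.φ s)⁻¹)) = (2 * s) * (U.Y s - U.Y (-s)) * (deriv U.φ s)⁻¹ := by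
    rw [eq_mul_inv_iff_mul_eq₀ h5.2, sub_mul, h8, h9]
    have := inv_mul_cancel₀ h5.2
    linear_combination U.Y s * h3 + U.Y (-s) * deriv (ev x) (U.φ (-s)) * deriv U.φ (-s) * this +
      U.Y (-s) * h4
  rw [h10, div_eq_mul_inv, mul_inv, mul_inv, inv_inv]
  have := inv_mul_cancel₀ h5.2
  linear_combination (-(1 / 2) * (1 / (z - U.φ s) - 1 / (z - U.φ (-s))) *
        ((2 * s)⁻¹ * (U.Y s - U.Y (-s))⁻¹) * (deriv U.φ s * deriv U.φ (-s))) * this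

variable {F Q : ℂ → ℂ}

theorem jet_c5_eq_zero (hQ : IsLocalData U F Q) {j : Jet}
    (hj : HasJet 6 (U.toChart (localForm U.Y Q)) j) : j.c5 = 0 :=
  hasRes_of_even (hQ.even.mono fun _ hs => localForm_neg hs) (U.hasRes_comp (HasRes.of_hasJet hj))

/-- The coefficient of the local form is even, so the two halves of the kernel, at φ(s) and at
φ(-s), contribute equally. What remains is the residue of the local form against 1/(z - q), which
extracts its principal part. Evenness also removes the simple pole, which makes the constant term of
the Cauchy jet irrelevant. -/
theorem residue_kernel (hQ : IsLocalData U F Q) {j : Jet}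
    (hj : HasJet 6 (U.toChart (localForm U.Y Q)) j) {z : ℂ} (hz : (z : OnePoint ℂ) ≠ p) :
    residue p (fun q => recursionKernel x y (galoisInvolution x p) z q *
      deriv (galoisInvolution x p) q * F q) = principal p j z := by
  set G := localForm U.Y Q
  have hN := HasRes.of_hasJet (((hasJet_cauchy hz).mul hj).of_jet_eq rfl)
  have h5 := U.jet_c5_eq_zero hQ hj
  have hval : ((cauchyJet p z).mul j).c5 = principal p j z := by
    simp only [Jet.mul, cauchyJet, principal, h5]
    ring
  rw [hval] at hN
  have hs : HasRes (fun s => 1 / (z - U.φ s) * G s) (principal p j z) := by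
    refine (hN.comp U.analyticAt_τ U.τ_zero U.deriv_τ).congr ?_
    filter_upwards [U.toChart_τ G] with s h1
    rw [← h1, φ]
    ring
  have hs' : HasRes (fun s => 1 / (z - U.φ (-s)) * G s) (-principal p j z) := by
    refine hs.comp_neg.congr ?_
    filter_upwards [hQ.even] with s h1
    rw [show G (-s) = G s from localForm_neg h1]
  have hI : HasRes (fun s => recursionKernel x y (galoisInvolution x p) z (U.φ s) *
      deriv (galoisInvolution x p) (U.φ s) * F (U.φ s) * deriv U.φ s) (principal p j z) := by
    have h1 := (hs.const_mul (1 / 2)).add (hs'.const_mul (-(1 / 2)))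
    have h2 : 1 / 2 * principal p j z + -(1 / 2) * -principal p j z = principal p j z := by ring
    rw [h2] at h1
    refine h1.congr ?_
    filter_upwards [U.kernel_φ z, hQ.eq] with s h3 h4
    simp only [G, localForm, ← h4]
    linear_combination F (U.φ s) * h3
  refine HasRes.residue_eq ?_
  refine (hI.comp U.analyticAt_ς U.ς_zero U.deriv_ς).congr ?_
  filter_upwards [U.tendsto_ς.eventually U.eventually_deriv_φ,
    U.tendsto_ς.eventually U.eventually_ς_τ, U.right_inv.filter_mono nhdsWithin_le_nhds]
    with t h1 h2 h3
  rw [h3] at h2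
  rw [h1, φ, h3]
  linear_combination (-(recursionKernel x y (galoisInvolution x p) z (chart p t) *
      deriv (galoisInvolution x p) (chart p t) * F (chart p t) * deriv (chart p) t)) * h2

theorem exists_hasJet_localForm {j : Jet} (hQ : HasJet 4 Q j) :
    ∃ k, HasJet 6 (localForm U.Y Q) k := by
  obtain ⟨n2, n3, n4, n5, n6, j1, j2⟩ := exists_jets_of_deriv_ne_zero U.analyticAt_Y U.deriv_Y
  have h := (hQ.smul (-1)).mul (hasJet_inv_two_mul.mul (hasJet_inv_odd U.deriv_Y j1))
  exact ⟨_, h.congr (Eventually.of_forall fun s => by simp [localForm])⟩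

end Uniformizer

/-! ### Differentials defined by a recursion -/

/-- The right-hand side of the recursion, for integrands `F p` at the ramification points. -/
def recursionSum (x y : RatFunc ℂ) (F : OnePoint ℂ → ℂ → ℂ) (z : ℂ) : ℂ :=
  ∑ᶠ p ∈ ramificationPoints x, residue p fun q =>
    recursionKernel x y (galoisInvolution x p) z q * deriv (galoisInvolution x p) q * F p q

section Recursion

variable {x y : RatFunc ℂ} (U : ∀ p : ramificationPoints x, Uniformizer x y p)
  {F : OnePoint ℂ → ℂ → ℂ} {Q : ramificationPoints x → ℂ → ℂ}

theorem recursionSum_eq [Fintype (ramificationPoints x)]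
    (hQ : ∀ p, IsLocalData (U p) (F p) (Q p)) {J : ramificationPoints x → Jet}
    (hJ : ∀ p, HasJet 6 ((U p).toChart (localForm (U p).Y (Q p))) (J p)) {z : ℂ}
    (hz : (z : OnePoint ℂ) ∉ ramificationPoints x) :
    recursionSum x y F z = ∑ p : ramificationPoints x, principal p (J p) z := by
  rw [recursionSum, ← finsum_set_coe_eq_finsum_mem, finsum_eq_sum_of_fintype]
  refine Finset.sum_congr rfl fun p _ => ?_
  exact (U p).residue_kernel (hQ p) (hJ p) fun h => hz (h ▸ p.2)

theorem exists_recursion_jets (hQ : ∀ p, IsLocalData (U p) (F p) (Q p)) :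
    ∃ J : ramificationPoints x → Jet,
      ∀ p, HasJet 6 ((U p).toChart (localForm (U p).Y (Q p))) (J p) := by
  refine ⟨_, fun p => Classical.choose_spec (p := fun j => HasJet 6 _ j) ?_⟩
  obtain ⟨j, hj⟩ := (hQ p).jet
  obtain ⟨k, hk⟩ := (U p).exists_hasJet_localForm hj
  exact (U p).exists_hasJet_toChart hk

theorem finite_coe_preimage_ramificationPoints (h : (ramificationPoints x).Finite) :
    ((↑) ⁻¹' ramificationPoints x : Set ℂ).Finite :=
  h.preimage OnePoint.coe_injective.injOn

theorem analyticAt_recursionSum (hfin : (ramificationPoints x).Finite)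
    (hQ : ∀ p, IsLocalData (U p) (F p) (Q p)) {z : ℂ}
    (hz : (z : OnePoint ℂ) ∉ ramificationPoints x) : AnalyticAt ℂ (recursionSum x y F) z := by
  have := hfin.fintype
  obtain ⟨J, hJ⟩ := exists_recursion_jets U hQ
  have h1 : AnalyticAt ℂ (fun z => ∑ p : ramificationPoints x, principal p (J p) z) z :=
    Finset.analyticAt_fun_sum _ fun p _ => analyticAt_principal (fun h => hz (h ▸ p.2)) _
  refine h1.congr ?_
  have h2 : IsClosed ((↑) ⁻¹' ramificationPoints x : Set ℂ) :=
    (finite_coe_preimage_ramificationPoints hfin).isClosed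
  filter_upwards [h2.isOpen_compl.mem_nhds hz] with u hu
  exact (recursionSum_eq U hQ hJ hu).symm

theorem regForm_sum {ι : Type*} (t : Finset ι) {f : ι → ℂ → ℂ} {q : OnePoint ℂ}
    (h : ∀ i ∈ t, RegForm q (f i)) : RegForm q fun z => ∑ i ∈ t, f i z :=
  (Reg.sum t h).congr (Eventually.of_forall fun s => by simp only [Finset.sum_mul])

theorem RegForm.congr {f g : ℂ → ℂ} {q : OnePoint ℂ} (hf : RegForm q f)
    (h : ∀ᶠ t in 𝓝[≠] (0 : ℂ), g (chart q t) = f (chart q t)) : RegForm q g :=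
  Reg.congr hf (h.mono fun t ht => by simp only [ht])

theorem regForm_recursionSum (hfin : (ramificationPoints x).Finite)
    (hQ : ∀ p, IsLocalData (U p) (F p) (Q p)) {q : OnePoint ℂ}
    (hq : q ∉ ramificationPoints x) : RegForm q (recursionSum x y F) := by
  have := hfin.fintype
  obtain ⟨J, hJ⟩ := exists_recursion_jets U hQ
  refine (regForm_sum Finset.univ (f := fun p : ramificationPoints x => principal p (J p))
    fun p _ => regForm_principal (fun h => hq (by rw [h]; exact p.2)) _).congr ?_
  filter_upwards [eventually_chart_notMem q (finite_coe_preimage_ramificationPoints hfin)] with t ht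
  exact recursionSum_eq U hQ hJ ht

theorem Uniformizer.eventually_φ_notMem {p : OnePoint ℂ} (V : Uniformizer x y p)
    (hfin : (ramificationPoints x).Finite) :
    ∀ᶠ s in 𝓝[≠] (0 : ℂ), (V.φ s : OnePoint ℂ) ∉ ramificationPoints x :=
  V.eventually_φ (P := fun z => (z : OnePoint ℂ) ∉ ramificationPoints x)
    (eventually_chart_notMem p (finite_coe_preimage_ramificationPoints hfin))

/-- The other ramification points contribute forms that are regular at `p`, so the local form
carries the whole principal part there. -/
theorem reg_recursionSum_sub (hfin : (ramificationPoints x).Finite)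
    (hQ : ∀ p, IsLocalData (U p) (F p) (Q p)) (p : ramificationPoints x) :
    Reg fun s => recursionSum x y F ((U p).φ s) * deriv (U p).φ s -
      localForm (U p).Y (Q p) s := by
  classical
  have := hfin.fintype
  obtain ⟨J, hJ⟩ := exists_recursion_jets U hQ
  have h0 : ∀ r ∈ Finset.univ.erase p, RegForm p (principal r (J r)) := fun r hr =>
    regForm_principal (fun h => (Finset.ne_of_mem_erase hr) (Subtype.ext h.symm)) _
  have h1 : Reg fun t => (∑ r ∈ Finset.univ.erase p, principal r (J r) (chart p t)) *
      deriv (chart p) t := regForm_sum _ h0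
  have h2 := reg_principal_sub p (hJ p) ((U p).jet_c5_eq_zero (hQ p) (hJ p))
  have h3 := ((h1.add h2).comp (U p).analyticAt_τ (U p).τ_zero (U p).deriv_τ).mul
    (U p).analyticAt_τ.deriv.reg
  refine h3.congr ?_
  have e4 : ∀ z, ∑ r : ramificationPoints x, principal r (J r) z =
      principal p (J p) z + ∑ r ∈ Finset.univ.erase p, principal r (J r) z := fun z =>
    (Finset.add_sum_erase _ _ (Finset.mem_univ p)).symm
  filter_upwards [(U p).eventually_deriv_φ, (U p).toChart_τ (localForm (U p).Y (Q p)),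
    (U p).eventually_φ_notMem hfin] with s e1 e2 e3
  rw [recursionSum_eq U hQ hJ e3, e4, ← e2, e1, Uniformizer.φ]
  ring

end Recursion

/-! ### The first correlators -/

theorem omega_zero_two (x y : RatFunc ℂ) (z : Fin 2 → ℂ) :
    omega x y 0 2 z = ((z 0 - z 1) ^ 2)⁻¹ := by rw [omega, one_div]

/-- `S.card` occurs in the type of the list of points, so the value of `S` is supplied by an
equation that can be substituted. -/
theorem omega_snoc_of_eq_empty (x y : RatFunc ℂ) (g : ℕ) {n : ℕ} {S : Finset (Fin n)} (h : S = ∅)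
    (f : Fin n → ℂ) (q : ℂ) :
    omega x y g (S.card + 1) (Fin.snoc (fun i => f (S.orderEmbOfFin rfl i)) q) =
      omega x y g 1 ![q] := by
  subst h
  congr 1
  funext i
  fin_cases i
  rfl

theorem omega_snoc_of_eq_singleton (x y : RatFunc ℂ) (g : ℕ) {n : ℕ} {S : Finset (Fin n)}
    {a : Fin n} (h : S = {a}) (f : Fin n → ℂ) (q : ℂ) :
    omega x y g (S.card + 1) (Fin.snoc (fun i => f (S.orderEmbOfFin rfl i)) q) =
      omega x y g 2 ![f a, q] := by
  subst h
  congr 1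
  funext i
  fin_cases i
  · exact congrArg f (Finset.orderEmbOfFin_singleton a _)
  · rfl

/-- With no other points every splitting has a factor (0, ∅), and only the Bergman kernel at q and
σ(q) is left. -/
theorem omega_one_one (x y : RatFunc ℂ) (z : ℂ) :
    omega x y 1 1 ![z] = recursionSum x y
      (fun p q => ((q - galoisInvolution x p q) ^ 2)⁻¹) z := by
  rw [omega, recursionSum]
  · refine finsum_mem_congr rfl fun p _ => congrArg (residue p) (funext fun q => ?_)
    have hu : (Finset.univ : Finset (Finset (Fin 0))) = {∅} := rfl
    rw [hu, Finset.sum_singleton, Fin.sum_univ_two, dif_pos one_pos, dif_neg (by decide),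
      dif_neg (by decide), omega_zero_two, add_zero, add_zero]
    rfl
  all_goals simp

theorem omega_zero_three (x y : RatFunc ℂ) (z₁ z₂ z : ℂ) :
    omega x y 0 3 ![z₁, z₂, z] = recursionSum x y
      (fun p q => ((z₁ - q) ^ 2)⁻¹ * ((z₂ - galoisInvolution x p q) ^ 2)⁻¹ +
        ((z₂ - q) ^ 2)⁻¹ * ((z₁ - galoisInvolution x p q) ^ 2)⁻¹) z := by
  rw [omega, recursionSum]
  · refine finsum_mem_congr rfl fun p _ => congrArg (residue p) (funext fun q => ?_)
    have hu : (Finset.univ : Finset (Finset (Fin 2))) = {∅, {0}, {1}, {0, 1}} := by decide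
    rw [hu, Finset.sum_insert (by decide), Finset.sum_insert (by decide),
      Finset.sum_insert (by decide), Finset.sum_singleton, Fin.sum_univ_one, Fin.sum_univ_one,
      Fin.sum_univ_one, Fin.sum_univ_one, dif_neg (by decide), dif_neg (by decide),
      dif_pos (by decide), dif_pos (by decide), dif_neg (by decide),
      omega_snoc_of_eq_singleton x y _ (S := {0}) rfl,
      omega_snoc_of_eq_singleton x y _ (S := {0}ᶜ) (a := 1) (by decide),
      omega_snoc_of_eq_singleton x y _ (S := {1}) rfl,
      omega_snoc_of_eq_singleton x y _ (S := {1}ᶜ) (a := 0) (by decide)]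
    simp only [Fin.val_zero, Nat.sub_zero, omega_zero_two, zero_add, add_zero]
    rfl
  all_goals simp

/-- The admissible splittings are S = ∅ with k = 1 and S = {0} with k = 0; the other two contain a
factor (0, ∅). -/
theorem omega_one_two (x y : RatFunc ℂ) (w z : ℂ) :
    omega x y 1 2 ![w, z] = recursionSum x y
      (fun p q => omega x y 0 3 ![w, q, galoisInvolution x p q] +
        (omega x y 1 1 ![q] * ((w - galoisInvolution x p q) ^ 2)⁻¹ +
        ((w - q) ^ 2)⁻¹ * omega x y 1 1 ![galoisInvolution x p q])) z := by
  rw [omega, recursionSum]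
  · refine finsum_mem_congr rfl fun p _ => congrArg (residue p) (funext fun q => ?_)
    have hu : (Finset.univ : Finset (Finset (Fin 1))) = {∅, {0}} := by decide
    rw [hu, Finset.sum_insert (by decide), Finset.sum_singleton, Fin.sum_univ_two,
      Fin.sum_univ_two, dif_pos one_pos, dif_neg (by decide),
      dif_pos (by decide), dif_pos (by decide), dif_neg (by decide),
      omega_snoc_of_eq_empty x y _ (S := ∅) rfl,
      omega_snoc_of_eq_singleton x y _ (S := ∅ᶜ) (a := 0) (by decide),
      omega_snoc_of_eq_singleton x y _ (S := {0}) rfl,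
      omega_snoc_of_eq_empty x y _ (S := {0}ᶜ) (by decide)]
    simp only [Fin.val_zero, Fin.val_one, Nat.sub_zero, Nat.sub_self, zero_add, add_zero]
    rw [omega_zero_two, omega_zero_two]
    congr 2
    refine congrArg (omega x y 0 3) (funext fun i => ?_)
    fin_cases i <;> rfl
  all_goals simp

/-! ### Local expressions of the first correlators -/

/-- The form `dt` times the Bergman kernel between `z` and `chart p t`. -/
def fiber (p : OnePoint ℂ) (z t : ℂ) : ℂ :=
  p.elim (-((z * t - 1) ^ 2)⁻¹) fun a => ((z - a - t) ^ 2)⁻¹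

theorem fiber_eq (p : OnePoint ℂ) (z : ℂ) {t : ℂ} (ht : t ≠ 0) :
    ((z - chart p t) ^ 2)⁻¹ * deriv (chart p) t = fiber p z t := by
  induction p using OnePoint.rec with
  | infty =>
    rw [deriv_chart_infty, chart_infty]
    simp only [fiber, OnePoint.elim_infty]
    have h : z * t - 1 = (z - t⁻¹) * t := by field_simp
    rw [h, mul_pow, mul_inv]
    ring
  | coe a =>
    rw [deriv_chart_coe, chart_coe]
    simp only [fiber, OnePoint.elim_some, sub_sub, mul_one]

theorem fiber_zero (p : OnePoint ℂ) (z : ℂ) : fiber p z 0 = poleForm p 1 z := by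
  induction p using OnePoint.rec with
  | infty => simp [fiber, poleForm]
  | coe a => simp [fiber, poleForm]

theorem analyticAt_fiber {p : OnePoint ℂ} {z : ℂ} (h : (z : OnePoint ℂ) ≠ p) :
    AnalyticAt ℂ (fiber p z) 0 := by
  induction p using OnePoint.rec with
  | infty => exact AnalyticAt.neg (AnalyticAt.inv (by fun_prop) (by simp))
  | coe a =>
    have h1 : z - a ≠ 0 := sub_ne_zero.2 fun e => h (by rw [e])
    exact AnalyticAt.inv (by fun_prop) (by simpa using h1)

theorem HasJet.tendsto_pow_mul {m : ℕ} {f : ℂ → ℂ} {j : Jet} (h : HasJet m f j) :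
    Tendsto (fun s => s ^ m * f s) (𝓝[≠] 0) (𝓝 j.c0) :=
  let ⟨g, hg, e⟩ := h
  HasJet.tendsto_zero ⟨g, hg, by simpa using e⟩

namespace Uniformizer

variable {x y : RatFunc ℂ} {p : OnePoint ℂ} (U : Uniformizer x y p)

/-- The Bergman kernel between `z` and the point with coordinate `s`. -/
def bergman (z s : ℂ) : ℂ := fiber p z (U.τ s) * deriv U.τ s

/-- The Bergman kernel between `z` and `p`. -/
def xi (z : ℂ) : ℂ := deriv U.τ 0 * poleForm p 1 z

theorem bergman_zero (z : ℂ) : U.bergman z 0 = U.xi z := by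
  rw [bergman, U.τ_zero, fiber_zero, xi, mul_comm]

theorem analyticAt_bergman {z : ℂ} (h : (z : OnePoint ℂ) ≠ p) : AnalyticAt ℂ (U.bergman z) 0 :=
  (AnalyticAt.fun_comp (by rw [U.τ_zero]; exact analyticAt_fiber h) U.analyticAt_τ).mul
    U.analyticAt_τ.deriv

theorem bergman_φ (z : ℂ) :
    ∀ᶠ s in 𝓝[≠] (0 : ℂ), ((z - U.φ s) ^ 2)⁻¹ * deriv U.φ s = U.bergman z s := by
  filter_upwards [U.eventually_deriv_φ, U.tendsto_τ.eventually eventually_ne_zero_nhdsNE] with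
    s h1 h2
  rw [h1, bergman, ← fiber_eq p z h2, φ]
  ring

theorem xi_φ : ∀ᶠ s in 𝓝[≠] (0 : ℂ), U.xi (U.φ s) * deriv U.φ s = bergmanOrigin U.τ s := by
  filter_upwards [U.eventually_deriv_φ, U.tendsto_τ.eventually eventually_ne_zero_nhdsNE] with
    s h1 h2
  have h3 := poleForm_chart p le_rfl h2
  rw [h1, bergmanOrigin, xi, φ, ← mul_inv, ← sq]
  linear_combination deriv U.τ 0 * deriv U.τ s * h3

theorem analyticAt_xi {z : ℂ} (h : (z : OnePoint ℂ) ≠ p) : AnalyticAt ℂ U.xi z :=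
  analyticAt_const.mul (analyticAt_poleForm h 1)

theorem regForm_xi {q : OnePoint ℂ} (h : q ≠ p) : RegForm q U.xi :=
  (Reg.const_mul (regForm_poleForm h le_rfl) (deriv U.τ 0)).congr
    (Eventually.of_forall fun t => by simp only [xi]; ring)

theorem isLocalData_zero_three {z₁ z₂ : ℂ} (h₁ : (z₁ : OnePoint ℂ) ≠ p)
    (h₂ : (z₂ : OnePoint ℂ) ≠ p) : IsLocalData U
      (fun q => ((z₁ - q) ^ 2)⁻¹ * ((z₂ - galoisInvolution x p q) ^ 2)⁻¹ +
        ((z₂ - q) ^ 2)⁻¹ * ((z₁ - galoisInvolution x p q) ^ 2)⁻¹)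
      (fun s => U.bergman z₁ s * U.bergman z₂ (-s) + U.bergman z₂ s * U.bergman z₁ (-s)) where
  even := Eventually.of_forall fun s => by rw [neg_neg]; ring
  jet := by
    have h1 := U.analyticAt_bergman h₁
    have h2 := U.analyticAt_bergman h₂
    obtain ⟨j, hj⟩ := HasJet.exists_of_reg ((h1.reg.mul h2.reg.comp_neg).add
      (h2.reg.mul h1.reg.comp_neg))
    exact ⟨_, hj.shift.shift.shift.shift⟩
  eq := by
    filter_upwards [U.galoisInvolution_φ, U.bergman_φ z₁, U.bergman_φ z₂,
      eventually_nhdsNE_neg (U.bergman_φ z₁), eventually_nhdsNE_neg (U.bergman_φ z₂)] with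
      s h1 h2 h3 h4 h5
    rw [h1, ← h2, ← h3, ← h4, ← h5]
    ring

theorem bergmanAntidiag_neg (τ : ℂ → ℂ) (s : ℂ) :
    bergmanAntidiag τ (-s) = bergmanAntidiag τ s := by
  have : τ (-s) - τ s = -(τ s - τ (-s)) := by ring
  rw [bergmanAntidiag, bergmanAntidiag, neg_neg, this, inv_neg]
  ring

theorem isLocalData_one_one : IsLocalData U
    (fun q => ((q - galoisInvolution x p q) ^ 2)⁻¹) (bergmanAntidiag U.τ) where
  even := Eventually.of_forall fun s => bergmanAntidiag_neg _ s
  jet := by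
    obtain ⟨k0, k1, k2, k3, k11, k12, h, -⟩ :=
      exists_bergman_jets U.analyticAt_τ U.τ_zero U.deriv_τ
    exact ⟨_, h.shift.shift⟩
  eq := by
    filter_upwards [U.galoisInvolution_φ, U.bergman_eq] with s h1 h2
    rw [h1, ← h2]
    ring

/-- The pole is at most double and has no residue, so one coefficient determines the principal part.
It is found by comparing the limits of the squared parameter times the form in the coordinates t and
s. -/
theorem hasJet_toChart_zero_three {z₁ z₂ : ℂ} (h₁ : (z₁ : OnePoint ℂ) ≠ p)
    (h₂ : (z₂ : OnePoint ℂ) ≠ p) : HasJet 6 (U.toChart (localForm U.Y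
      fun s => U.bergman z₁ s * U.bergman z₂ (-s) + U.bergman z₂ s * U.bergman z₁ (-s)))
      ⟨0, 0, 0, 0, -(deriv U.Y 0)⁻¹ / 2 * U.xi z₁ * U.xi z₂ * deriv U.τ 0, 0⟩ := by
  set Q := fun s => U.bergman z₁ s * U.bergman z₂ (-s) + U.bergman z₂ s * U.bergman z₁ (-s)
  have a1 := U.analyticAt_bergman h₁
  have a2 := U.analyticAt_bergman h₂
  obtain ⟨n2, n3, n4, n5, n6, j1, -⟩ := exists_jets_of_deriv_ne_zero U.analyticAt_Y U.deriv_Y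
  obtain ⟨⟨b0, b1, b2, b3, b4, b5⟩, k1, e1, -⟩ := HasJet.exists_of_analyticAt a1
  obtain ⟨⟨d0, d1, d2, d3, d4, d5⟩, k2, e2, -⟩ := HasJet.exists_of_analyticAt a2
  have jQ := (k1.mul (k2.reflect (by decide))).add (k2.mul (k1.reflect (by decide)))
  have jG : HasJet 2 (localForm U.Y Q) _ := ((jQ.smul (-1)).mul
    (hasJet_inv_two_mul.mul (hasJet_inv_odd U.deriv_Y j1))).congr
    (Eventually.of_forall fun s => by simp [localForm, Q])
  obtain ⟨k, hk⟩ := U.exists_hasJet_toChart jG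
  have h5 := U.jet_c5_eq_zero (U.isLocalData_zero_three h₁ h₂) hk.shift.shift.shift.shift
  have h4 : k.c0 = -(deriv U.Y 0)⁻¹ / 2 * U.xi z₁ * U.xi z₂ * deriv U.τ 0 := by
    have l1 : Tendsto (fun s => U.τ s ^ 2 * U.toChart (localForm U.Y Q) (U.τ s)) (𝓝[≠] 0)
      (𝓝 k.c0) := hk.tendsto_pow_mul.comp U.tendsto_τ
    have l2 : Tendsto (fun s => dslope U.τ 0 s ^ 2) (𝓝[≠] 0) (𝓝 (deriv U.τ 0 ^ 2)) := by
      have := (analyticAt_dslope U.analyticAt_τ).continuousAt.tendsto.mono_left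
        (nhdsWithin_le_nhds (s := {(0 : ℂ)}ᶜ))
      rw [dslope_same] at this
      exact this.pow 2
    have l3 : Tendsto (deriv U.τ) (𝓝[≠] 0) (𝓝 (deriv U.τ 0)) :=
      U.analyticAt_τ.deriv.continuousAt.tendsto.mono_left nhdsWithin_le_nhds
    have l5 := jG.tendsto_pow_mul
    have l6 := (l1.mul l3).congr' (f₂ := fun s => dslope U.τ 0 s ^ 2 *
        (s ^ 2 * localForm U.Y Q s)) (by
      filter_upwards [U.toChart_τ (localForm U.Y Q)] with s r2
      have r3 := eq_add_mul_dslope U.τ s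
      rw [U.τ_zero, zero_add] at r3
      rw [← r2]
      nth_rewrite 1 [r3]
      ring)
    have l7 := tendsto_nhds_unique l6 (l2.mul l5)
    simp only [Jet.eval, Jet.mul, Jet.add, Jet.smul, Jet.reflect] at l7
    rw [← U.bergman_zero, ← U.bergman_zero, ← e1, ← e2]
    have hτ := U.deriv_τ
    have l8 := mul_right_cancel₀ hτ (l7.trans (b := _) (c := (deriv U.τ 0 *
      (-(deriv U.Y 0)⁻¹ / 2 * b0 * d0)) * deriv U.τ 0) (by ring))
    rw [l8]; ring
  refine hk.shift.shift.shift.shift.of_jet_eq ?_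
  ext
  · rfl
  · rfl
  · rfl
  · rfl
  · exact h4
  · exact h5

end Uniformizer

/-- A choice of uniformizers at the ramification points. -/
def IsRegularAtRamification.uniformizer {x y : RatFunc ℂ} (h : IsRegularAtRamification x y)
    (p : ramificationPoints x) : Uniformizer x y p := Classical.choice (exists_uniformizer h p.2)

theorem IsRegularAtRamification.finite {x y : RatFunc ℂ} (h : IsRegularAtRamification x y) :
    (ramificationPoints x).Finite := finite_ramificationPoints (h.ordDiffAt_ne_top _)

section Correlators

variable {x y : RatFunc ℂ} (h : IsRegularAtRamification x y)
-- Each ramification point contributes a double pole whose coefficient factorises. Unlike the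
-- recursion, this exhibits the dependence on all three arguments, which is needed when two of them
-- coincide or are exchanged by the involution.
theorem omega_zero_three_eq [Fintype (ramificationPoints x)] {z₁ z₂ z : ℂ}
    (h₁ : (z₁ : OnePoint ℂ) ∉ ramificationPoints x)
    (h₂ : (z₂ : OnePoint ℂ) ∉ ramificationPoints x)
    (hz : (z : OnePoint ℂ) ∉ ramificationPoints x) :
    omega x y 0 3 ![z₁, z₂, z] = ∑ p : ramificationPoints x,
      -(deriv (h.uniformizer p).Y 0)⁻¹ / 2 * (h.uniformizer p).xi z₁ * (h.uniformizer p).xi z₂ *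
        (h.uniformizer p).xi z := by
  have n1 : ∀ p : ramificationPoints x, (z₁ : OnePoint ℂ) ≠ p := fun p e => h₁ (e ▸ p.2)
  have n2 : ∀ p : ramificationPoints x, (z₂ : OnePoint ℂ) ≠ p := fun p e => h₂ (e ▸ p.2)
  rw [omega_zero_three, recursionSum_eq h.uniformizer
    (fun p => (h.uniformizer p).isLocalData_zero_three (n1 p) (n2 p))
    (fun p => (h.uniformizer p).hasJet_toChart_zero_three (n1 p) (n2 p)) hz]
  refine Finset.sum_congr rfl fun p _ => ?_
  simp only [principal, Uniformizer.xi]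
  ring

end Correlators

/-! ### Derivatives of the Bergman kernel in the fixed variable -/

/-- `F v z` is, for `v` near `w`, a polar part in `z` at `v` with coefficients analytic in `v`. -/
def IsPolar (w : ℂ) (F : ℂ → ℂ → ℂ) : Prop :=
  ∃ (N : ℕ) (C : ℕ → ℂ → ℂ), (∀ k, AnalyticAt ℂ (C k) w) ∧
    ∀ᶠ v in 𝓝 w, ∀ z ≠ v, F v z = ∑ k ∈ Finset.range N, C k v * ((v - z) ^ (k + 2))⁻¹

namespace IsPolar

variable {w : ℂ} {F G : ℂ → ℂ → ℂ}

theorem bergman (w : ℂ) : IsPolar w fun v z => ((v - z) ^ 2)⁻¹ :=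
  ⟨1, fun _ _ => 1, fun _ => analyticAt_const, Eventually.of_forall fun v z _ => by simp⟩

theorem mul_left (hF : IsPolar w F) {f : ℂ → ℂ} (hf : AnalyticAt ℂ f w) :
    IsPolar w fun v z => f v * F v z := by
  obtain ⟨N, C, hC, e⟩ := hF
  refine ⟨N, fun k v => f v * C k v, fun k => hf.mul (hC k), e.mono fun v hv z hz => ?_⟩
  dsimp only
  rw [hv z hz, Finset.mul_sum]
  exact Finset.sum_congr rfl fun k _ => by ring

theorem add (hF : IsPolar w F) (hG : IsPolar w G) : IsPolar w fun v z => F v z + G v z := by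
  obtain ⟨N, C, hC, e⟩ := hF
  obtain ⟨M, D, hD, e'⟩ := hG
  refine ⟨max N M, fun k v => (if k < N then 1 else 0) * C k v + (if k < M then 1 else 0) * D k v,
    fun k => (analyticAt_const.mul (hC k)).add (analyticAt_const.mul (hD k)), ?_⟩
  filter_upwards [e, e'] with v h1 h2 z hz
  have key : ∀ (L : ℕ) (E : ℕ → ℂ → ℂ), L ≤ max N M →
      ∑ k ∈ Finset.range L, E k v * ((v - z) ^ (k + 2))⁻¹ =
      ∑ k ∈ Finset.range (max N M), (if k < L then 1 else 0) * E k v * ((v - z) ^ (k + 2))⁻¹ := by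
    intro L E hL
    rw [← Finset.sum_subset (Finset.range_mono hL)]
    · exact Finset.sum_congr rfl fun k hk => by rw [if_pos (Finset.mem_range.1 hk), one_mul]
    · intro k _ hk
      rw [if_neg (fun h => hk (Finset.mem_range.2 h)), zero_mul, zero_mul]
  rw [h1 z hz, h2 z hz, key N C (le_max_left _ _), key M D (le_max_right _ _),
    ← Finset.sum_add_distrib]
  exact Finset.sum_congr rfl fun k _ => by ring

/-- Differentiation in `v` only raises exponents, so they stay at least two. Such forms in z have no
residue at v and are regular at infinity. -/
theorem deriv (hF : IsPolar w F) : IsPolar w fun v z => deriv (fun v => F v z) v := by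
  obtain ⟨N, C, hC, e⟩ := hF
  have h0 : IsPolar w fun v z => ∑ k ∈ Finset.range N,
      (_root_.deriv (C k) v * ((v - z) ^ (k + 2))⁻¹ +
        (-(k + 2) * C k v) * ((v - z) ^ (k + 3))⁻¹) := by
    clear e
    induction N with
    | zero => exact ⟨0, C, hC, Eventually.of_forall fun v z _ => by simp⟩
    | succ N ih =>
      have h1 : ∀ (j : ℕ) (D : ℂ → ℂ), AnalyticAt ℂ D w →
          IsPolar w fun v z => D v * ((v - z) ^ (j + 2))⁻¹ := fun j D hD =>
        ⟨j + 1, fun k v => (if k = j then 1 else 0) * D v, fun k => analyticAt_const.mul hD,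
          Eventually.of_forall fun v z _ => by
            rw [Finset.sum_eq_single j (by intro k _ hk; simp [hk]) (by simp)]; simp⟩
      simp only [Finset.sum_range_succ]
      exact ih.add ((h1 N _ (hC N).deriv).add (h1 (N + 1) _ (analyticAt_const.mul (hC N))))
  obtain ⟨M, D, hD, e'⟩ := h0
  refine ⟨M, D, hD, ?_⟩
  have hC' : ∀ᶠ v in 𝓝 w, ∀ k ∈ Finset.range N, AnalyticAt ℂ (C k) v :=
    (Finset.range N).eventually_all.2 fun k _ => (hC k).eventually_analyticAt
  filter_upwards [e.eventually_nhds, e', hC'] with v h1 h2 h3 z hz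
  rw [← h2 z hz]
  have h4 : (fun v => F v z) =ᶠ[𝓝 v]
      fun v => ∑ k ∈ Finset.range N, C k v * ((v - z) ^ (k + 2))⁻¹ := by
    filter_upwards [h1, isOpen_ne.mem_nhds hz.symm] with u h5 h6
    exact h5 z (Ne.symm h6)
  rw [h4.deriv_eq]
  refine HasDerivAt.deriv (HasDerivAt.fun_sum fun k hk => ?_)
  have h7 : v - z ≠ 0 := sub_ne_zero.2 hz.symm
  refine ((h3 k hk).differentiableAt.hasDerivAt.fun_mul
    ((((hasDerivAt_id' v).sub_const z).fun_pow (k + 2)).fun_inv (pow_ne_zero _ h7))).congr_deriv ?_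
  push_cast
  field_simp
  ring

theorem congr (hF : IsPolar w F) (h : ∀ v z, G v z = F v z) : IsPolar w G := by
  have : G = F := funext fun v => funext fun z => h v z
  rwa [this]

theorem linearPart {a b : ℂ → ℂ} (ha : AnalyticAt ℂ a w) (hb : AnalyticAt ℂ b w) (hb0 : b w ≠ 0) :
    IsPolar w fun v z => linearPart a b 0 (fun v => ((v - z) ^ 2)⁻¹) v := by
  have h0 := bergman w
  have hd : AnalyticAt ℂ (diagTerm a 0) w := by
    have := ha.deriv
    have := ha.deriv.deriv
    unfold diagTerm
    simp only [Pi.zero_apply]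
    fun_prop
  have h1 := ((h0.mul_left (hd.mul hb)).deriv.mul_left hb).mul_left
    (analyticAt_const (v := (1 / 2 : ℂ)))
  have h2 := ((((((h0.deriv.add (h0.mul_left (hb.deriv.mul (hb.inv hb0)))).mul_left
    (ha.mul ha)).deriv).mul_left hb).deriv).mul_left hb).mul_left
    (analyticAt_const (v := (1 / 24 : ℂ)))
  exact (h1.add h2).congr fun v z => rfl

theorem eq_poleForm (w z : ℂ) (k : ℕ) :
    ((w - z) ^ (k + 2))⁻¹ = (-1) ^ k * poleForm w (k + 1) z := by
  simp only [poleForm, OnePoint.elim_some]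
  have : w - z = -1 * (z - w) := by ring
  rw [this, mul_pow, mul_inv, pow_add (-1 : ℂ) k 2, ← inv_pow, ]
  norm_num
  rw [← inv_pow]
  norm_num

theorem exists_eq (hF : IsPolar w F) : ∃ (N : ℕ) (c : ℕ → ℂ),
    ∀ z ≠ w, F w z = ∑ k ∈ Finset.range N, c k * poleForm w (k + 1) z := by
  obtain ⟨N, C, hC, e⟩ := hF
  refine ⟨N, fun k => C k w * (-1) ^ k, fun z hz => ?_⟩
  rw [e.self_of_nhds z hz]
  exact Finset.sum_congr rfl fun k _ => by rw [eq_poleForm]; ring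

theorem regForm (hF : IsPolar w F) {q : OnePoint ℂ} (hq : q ≠ w) : RegForm q (F w) := by
  obtain ⟨N, c, e⟩ := hF.exists_eq
  refine (regForm_sum (Finset.range N) (f := fun k z => c k * poleForm w (k + 1) z)
    fun k _ => ?_).congr ?_
  · exact (Reg.const_mul (regForm_poleForm hq (Nat.le_add_left 1 k)) (c k)).congr
      (Eventually.of_forall fun t => by simp only [mul_assoc])
  · filter_upwards [eventually_chart_notMem q (Set.finite_singleton w)] with t ht
    exact e _ ht

theorem analyticAt (hF : IsPolar w F) {z : ℂ} (hz : z ≠ w) : AnalyticAt ℂ (F w) z := by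
  obtain ⟨N, c, e⟩ := hF.exists_eq
  have h1 : AnalyticAt ℂ (fun z => ∑ k ∈ Finset.range N, c k * poleForm w (k + 1) z) z :=
    Finset.analyticAt_fun_sum _ fun k _ => analyticAt_const.mul
      (analyticAt_poleForm (fun h => hz (OnePoint.coe_injective h)) _)
  refine h1.congr ?_
  filter_upwards [isOpen_ne.mem_nhds hz] with u hu
  exact (e u hu).symm

end IsPolar

/-! ### Coordinates adapted to rational functions -/

/-- `φ` is a coordinate near a point of the sphere, so that it avoids finite sets. -/
structure IsFrame (φ : ℂ → ℂ) : Prop where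
  coord : IsCoord φ
  avoid : ∀ T : Set ℂ, T.Finite → ∀ᶠ s in 𝓝[≠] (0 : ℂ), φ s ∉ T

theorem isFrame_chart (p : OnePoint ℂ) : IsFrame (chart p) :=
  ⟨isCoord_chart p, fun _ hT => eventually_chart_notMem p hT⟩

theorem Uniformizer.isFrame {x y : RatFunc ℂ} {p : OnePoint ℂ} (U : Uniformizer x y p) :
    IsFrame U.φ :=
  ⟨U.isCoord, fun T hT => U.eventually_φ (P := fun z => z ∉ T) (eventually_chart_notMem p hT)⟩

/-- The vector field `1 / df`. -/
def vec (f : RatFunc ℂ) (z : ℂ) : ℂ := (deriv (ev f) z)⁻¹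

/-- The vector field `1 / df` in the coordinate `φ`. -/
def localVec (f : RatFunc ℂ) (φ : ℂ → ℂ) (s : ℂ) : ℂ := (deriv (fun s => ev f (φ s)) s)⁻¹

theorem analyticAt_vec {f : RatFunc ℂ} {z : ℂ} (h : z ∉ badSet f) : AnalyticAt ℂ (vec f) z := by
  simp only [badSet, Set.mem_ofPred_eq, not_or] at h
  exact (analyticAt_ev h.1).deriv.inv h.2

theorem vec_ne_zero {f : RatFunc ℂ} {z : ℂ} (h : z ∉ badSet f) : vec f z ≠ 0 := by
  simp only [badSet, Set.mem_ofPred_eq, not_or] at h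
  exact inv_ne_zero h.2

namespace IsFrame

variable {φ : ℂ → ℂ} {f : RatFunc ℂ}

theorem analyticAlong_vec (hφ : IsFrame φ) (hf : (badSet f).Finite) : AnalyticAlong φ (vec f) :=
  (hφ.avoid _ hf).mono fun _ h => analyticAt_vec h

theorem vec_ne_zero (hφ : IsFrame φ) (hf : (badSet f).Finite) :
    ∀ᶠ s in 𝓝[≠] (0 : ℂ), vec f (φ s) ≠ 0 := (hφ.avoid _ hf).mono fun _ h => XYSwap.vec_ne_zero h

theorem vec_comp (hφ : IsFrame φ) (hf : (badSet f).Finite) :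
    (fun s => vec f (φ s) * (deriv φ s)⁻¹) =ᶠ[𝓝[≠] 0] localVec f φ := by
  filter_upwards [hφ.avoid _ hf, hφ.coord] with s h1 h2
  simp only [badSet, Set.mem_ofPred_eq, not_or] at h1
  rw [localVec, (hasDerivAt_comp_of_analyticAt (analyticAt_ev h1.1) h2.1).deriv, mul_inv, vec]

theorem deriv_eq (hφ : IsFrame φ) {g G : ℂ → ℂ} (hg : AnalyticAlong φ g)
    (h : (fun s => g (φ s)) =ᶠ[𝓝[≠] 0] G) :
    (fun s => deriv g (φ s) * deriv φ s) =ᶠ[𝓝[≠] 0] deriv G := by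
  filter_upwards [hg.deriv_comp hφ.coord, deriv_eventuallyEq h] with s h1 h2
  rw [← h1, h2]

end IsFrame

namespace AnalyticAlong

variable {φ : ℂ → ℂ}

theorem genusOnePotential {a b : ℂ → ℂ} (ha : AnalyticAlong φ a) (hb : AnalyticAlong φ b)
    (ha0 : ∀ᶠ s in 𝓝[≠] (0 : ℂ), a (φ s) ≠ 0) (hb0 : ∀ᶠ s in 𝓝[≠] (0 : ℂ), b (φ s) ≠ 0) :
    AnalyticAlong φ (genusOnePotential a b 0) := by
  filter_upwards [ha, hb, ha0, hb0] with s h1 h2 h3 h4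
  have := h1.deriv
  have := h1.deriv.deriv
  have := h2.deriv
  have := h2.deriv.deriv
  have := h1.fun_inv h3
  have := h2.fun_inv h4
  unfold XYSwap.genusOnePotential
  simp only [Pi.zero_apply]
  fun_prop

end AnalyticAlong

theorem schwarzian_chart (p : OnePoint ℂ) : schwarzian (chart p) =ᶠ[𝓝[≠] 0] 0 := by
  induction p using OnePoint.rec with
  | coe a =>
    have h1 : deriv (chart (a : OnePoint ℂ)) = fun _ => 1 := funext fun t => deriv_chart_coe a t
    refine Eventually.of_forall fun s => ?_
    simp [schwarzian, h1]
  | infty =>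
    have h1 : deriv (chart OnePoint.infty) = fun t => -(t ^ 2)⁻¹ := funext deriv_chart_infty
    have h2 : deriv (deriv (chart OnePoint.infty)) =ᶠ[𝓝[≠] 0] fun t => 2 * (t ^ 3)⁻¹ := by
      filter_upwards [eventually_ne_zero_nhdsNE] with t ht
      rw [h1, (((hasDerivAt_id' t).fun_pow 2).fun_inv (pow_ne_zero 2 ht)).fun_neg.deriv]
      push_cast
      field_simp
    filter_upwards [schwarzian_eventuallyEq (isCoord_chart OnePoint.infty), h2,
      deriv_eventuallyEq h2, eventually_ne_zero_nhdsNE] with t e1 e2 e3 ht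
    rw [e1, e3, e2, h1, ((((hasDerivAt_id' t).fun_pow 3).fun_inv (pow_ne_zero 3 ht)).const_mul
      2).deriv]
    simp only [Pi.zero_apply]
    push_cast
    field_simp
    ring

theorem IsSpectralCurve.symm {x y : RatFunc ℂ} (h : IsSpectralCurve x y) : IsSpectralCurve y x :=
  ⟨h.right, h.left⟩

theorem IsRegularAtRamification.finite_badSet {x y : RatFunc ℂ}
    (h : IsRegularAtRamification x y) : (badSet x).Finite :=
  XYSwap.finite_badSet (h.ordDiffAt_ne_top _)

theorem reg_localVec {f : RatFunc ℂ} {q : OnePoint ℂ} (hq : q ∉ ramificationPoints f) :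
    Reg (localVec f (chart q)) ∧ (∀ᶠ s in 𝓝[≠] (0 : ℂ), localVec f (chart q) s ≠ 0) ∧
      Reg fun s => deriv (localVec f (chart q)) s *
        (deriv (localVec f (chart q)) s * (localVec f (chart q) s)⁻¹) :=
  reg_inv_deriv_of_notMem (meromorphicAt_ev_chart f q) hq

theorem schwarzian_reg (q : OnePoint ℂ) : Reg (schwarzian (chart q)) :=
  (Reg.const 0).congr (schwarzian_chart q)

namespace Uniformizer

variable {x y : RatFunc ℂ} {p : OnePoint ℂ} (U : Uniformizer x y p)

theorem localVec_left : localVec x U.φ =ᶠ[𝓝[≠] 0] fun s => (2 * s)⁻¹ := by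
  have h2 : (fun s => ev x (U.φ s)) =ᶠ[𝓝[≠] 0] fun s => U.c + s ^ 2 := U.x_eq
  filter_upwards [deriv_eventuallyEq h2] with s h
  rw [localVec, h]
  simp

theorem localVec_right : localVec y U.φ =ᶠ[𝓝[≠] 0] fun s => (deriv U.Y s)⁻¹ := by
  have h2 : (fun s => ev y (U.φ s)) =ᶠ[𝓝[≠] 0] U.Y := U.y_eq
  filter_upwards [deriv_eventuallyEq h2] with s h
  rw [localVec, h]

end Uniformizer

/-! ### The genus-one one-point functions -/

theorem genusOnePotential_comm (a b S : ℂ → ℂ) :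
    genusOnePotential a b S = genusOnePotential b a S := by
  funext s
  simp only [genusOnePotential]
  ring

section OneSided

variable {x y : RatFunc ℂ} (h : IsRegularAtRamification x y)
include h

theorem analyticAt_omega_one_one {z : ℂ} (hz : (z : OnePoint ℂ) ∉ ramificationPoints x) :
    AnalyticAt ℂ (fun z => omega x y 1 1 ![z]) z := by
  rw [funext (omega_one_one x y)]
  exact analyticAt_recursionSum h.uniformizer h.finite
    (fun p => (h.uniformizer p).isLocalData_one_one) hz

theorem regForm_omega_one_one {q : OnePoint ℂ} (hq : q ∉ ramificationPoints x) :
    RegForm q fun z => omega x y 1 1 ![z] := by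
  rw [funext (omega_one_one x y)]
  exact regForm_recursionSum h.uniformizer h.finite
    (fun p => (h.uniformizer p).isLocalData_one_one) hq

theorem reg_omega_one_one (p : ramificationPoints x) :
    Reg fun s => omega x y 1 1 ![(h.uniformizer p).φ s] * deriv (h.uniformizer p).φ s +
      bergmanAntidiag (h.uniformizer p).τ s *
        ((2 * s)⁻¹ * ((h.uniformizer p).Y s - (h.uniformizer p).Y (-s))⁻¹) := by
  have := reg_recursionSum_sub h.uniformizer
    (F := fun p q => ((q - galoisInvolution x p q) ^ 2)⁻¹)
    (Q := fun p => bergmanAntidiag (h.uniformizer p).τ) h.finite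
    (fun p => (h.uniformizer p).isLocalData_one_one) p
  refine this.congr (Eventually.of_forall fun s => ?_)
  simp only [omega_one_one, localForm]
  ring

theorem reg_omega_one_one_sub_left (hy : (badSet y).Finite) (p : ramificationPoints x) :
    Reg fun s => (omega x y 1 1 ![(h.uniformizer p).φ s] -
      deriv (genusOnePotential (vec x) (vec y) 0) ((h.uniformizer p).φ s)) *
        deriv (h.uniformizer p).φ s := by
  set U := h.uniformizer p
  have hφ := U.isFrame
  have ax := hφ.analyticAlong_vec h.finite_badSet
  have ay := hφ.analyticAlong_vec hy
  have nx := hφ.vec_ne_zero h.finite_badSet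
  have ny := hφ.vec_ne_zero hy
  have e1 : (fun s => genusOnePotential (vec x) (vec y) 0 (U.φ s)) =ᶠ[𝓝[≠] 0]
      genusOnePotential (fun s => (2 * s)⁻¹) (fun s => (deriv U.Y s)⁻¹) (schwarzian U.τ) := by
    filter_upwards [genusOnePotential_comp hφ.coord ax ay nx ny, U.schwarzian_eq,
      genusOnePotential_congr (S := schwarzian U.φ)
      ((hφ.vec_comp h.finite_badSet).trans U.localVec_left)
      ((hφ.vec_comp hy).trans U.localVec_right)] with s h1 h2 h3
    rw [h1, h3, genusOnePotential, genusOnePotential, h2]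
  refine ((reg_omega_one_one h p).sub (reg_genusOne_at_ramification U.analyticAt_Y U.deriv_Y
    U.analyticAt_τ U.τ_zero U.deriv_τ)).congr ?_
  filter_upwards [hφ.deriv_eq (ax.genusOnePotential ay nx ny) e1] with s h1
  rw [← h1]
  ring

end OneSided

theorem regForm_deriv_genusOnePotential {x y : RatFunc ℂ} (hx : (badSet x).Finite)
    (hy : (badSet y).Finite) {q : OnePoint ℂ} (hqx : q ∉ ramificationPoints x)
    (hqy : q ∉ ramificationPoints y) :
    RegForm q (deriv (genusOnePotential (vec x) (vec y) 0)) := by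
  have hφ := isFrame_chart q
  have ax := hφ.analyticAlong_vec hx
  have ay := hφ.analyticAlong_vec hy
  have nx := hφ.vec_ne_zero hx
  have ny := hφ.vec_ne_zero hy
  obtain ⟨rx, -, rx'⟩ := reg_localVec hqx
  obtain ⟨ry, -, ry'⟩ := reg_localVec hqy
  have h1 := reg_genusOnePotential rx ry (schwarzian_reg q) rx' ry'
  have h2 : (fun s => genusOnePotential (vec x) (vec y) 0 (chart q s)) =ᶠ[𝓝[≠] 0]
      genusOnePotential (localVec x (chart q)) (localVec y (chart q)) (schwarzian (chart q)) :=
    EventuallyEq.trans (genusOnePotential_comp hφ.coord ax ay nx ny)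
      (genusOnePotential_congr (hφ.vec_comp hx) (hφ.vec_comp hy))
  exact h1.deriv.congr (hφ.deriv_eq (ax.genusOnePotential ay nx ny) h2)

theorem analyticAt_genusOnePotential {x y : RatFunc ℂ} {z : ℂ} (hx : z ∉ badSet x)
    (hy : z ∉ badSet y) : AnalyticAt ℂ (genusOnePotential (vec x) (vec y) 0) z := by
  have h1 := analyticAt_vec hx
  have h2 := analyticAt_vec hy
  have := h1.deriv
  have := h1.deriv.deriv
  have := h2.deriv
  have := h2.deriv.deriv
  have := h1.fun_inv (vec_ne_zero hx)
  have := h2.fun_inv (vec_ne_zero hy)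
  unfold genusOnePotential
  simp only [Pi.zero_apply]
  fun_prop

/-- The principal parts agree at the zeros of dx by `reg_genusOne_at_ramification`. The potential is
symmetric in its two vector fields, which gives the zeros of dy; elsewhere both sides are regular.
-/
theorem IsSpectralCurve.omega_one_one_add_swap {x y : RatFunc ℂ} (h : IsSpectralCurve x y) {z : ℂ}
    (hx : z ∉ badSet x) (hy : z ∉ badSet y) :
    omega x y 1 1 ![z] + omega y x 1 1 ![z] =
      deriv (genusOnePotential (vec x) (vec y) 0) z := by
  have key : ∀ {x y : RatFunc ℂ}, IsSpectralCurve x y → ∀ p ∈ ramificationPoints x,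
      RegForm p fun z => omega x y 1 1 ![z] + omega y x 1 1 ![z] -
        deriv (genusOnePotential (vec x) (vec y) 0) z := by
    intro x y h p hp
    have h1 := (h.left.uniformizer ⟨p, hp⟩).regForm (f := fun z => omega x y 1 1 ![z] -
        deriv (genusOnePotential (vec x) (vec y) 0) z) (reg_omega_one_one_sub_left h.left h.right.finite_badSet ⟨p, hp⟩)
    have h2 := regForm_omega_one_one h.right (h.left.disjoint p hp)
    exact (Reg.add h1 h2).congr (Eventually.of_forall fun s => by ring)
  have hreg : ∀ p, RegForm p fun z => omega x y 1 1 ![z] + omega y x 1 1 ![z] -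
      deriv (genusOnePotential (vec x) (vec y) 0) z := by
    intro p
    by_cases hpx : p ∈ ramificationPoints x
    · exact key h p hpx
    by_cases hpy : p ∈ ramificationPoints y
    · refine (key h.symm p hpy).congr (Eventually.of_forall fun s => ?_)
      rw [genusOnePotential_comm, add_comm]
    · have h1 := regForm_omega_one_one h.left hpx
      have h2 := regForm_omega_one_one h.right hpy
      have h3 := regForm_deriv_genusOnePotential h.left.finite_badSet h.right.finite_badSet hpx hpy
      exact (Reg.sub (Reg.add h1 h2) h3).congr (Eventually.of_forall fun s => by ring)
  have hc := ((analyticAt_omega_one_one h.left (notMem_ramificationPoints hx)).add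
    (analyticAt_omega_one_one h.right (notMem_ramificationPoints hy))).sub
    (analyticAt_genusOnePotential hx hy).deriv
  exact sub_eq_zero.1 (eq_zero_of_regForm hreg hc.continuousAt)

/-! ### The genus-zero three-point functions -/

theorem analyticAlong_bergman {φ : ℂ → ℂ} (hφ : IsFrame φ) (w : ℂ) :
    AnalyticAlong φ fun z => ((w - z) ^ 2)⁻¹ := by
  filter_upwards [hφ.avoid _ (Set.finite_singleton w)] with s hs
  have : w - φ s ≠ 0 := sub_ne_zero.2 fun h => hs h.symm
  exact AnalyticAt.inv (by fun_prop) (pow_ne_zero 2 this)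

theorem analyticAlong_three {x y : RatFunc ℂ} {φ : ℂ → ℂ} (hφ : IsFrame φ)
    (hx : (badSet x).Finite) (hy : (badSet y).Finite) (w : ℂ) :
    AnalyticAlong φ fun z => (((w - z) ^ 2)⁻¹ * ((w - z) ^ 2)⁻¹) * (vec x z * vec y z) :=
  ((analyticAlong_bergman hφ w).mul (analyticAlong_bergman hφ w)).mul
    ((hφ.analyticAlong_vec hx).mul (hφ.analyticAlong_vec hy))

theorem isPolar_three {x y : RatFunc ℂ} {w : ℂ} (hx : w ∉ badSet x) (hy : w ∉ badSet y) :
    IsPolar w fun v z => deriv (fun v => deriv (fun v => deriv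
      (fun v => vec x v * vec y v * ((v - z) ^ 2)⁻¹) v) v) v :=
  ((IsPolar.bergman w).mul_left ((analyticAt_vec hx).mul (analyticAt_vec hy))).deriv.deriv.deriv

section OneSided

variable {x y : RatFunc ℂ} (h : IsRegularAtRamification x y)
include h

theorem analyticAt_omega_zero_three {z₁ z₂ z : ℂ}
    (h₁ : (z₁ : OnePoint ℂ) ∉ ramificationPoints x)
    (h₂ : (z₂ : OnePoint ℂ) ∉ ramificationPoints x)
    (hz : (z : OnePoint ℂ) ∉ ramificationPoints x) :
    AnalyticAt ℂ (fun z => omega x y 0 3 ![z₁, z₂, z]) z := by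
  rw [funext (omega_zero_three x y z₁ z₂)]
  exact analyticAt_recursionSum h.uniformizer h.finite (fun p =>
    (h.uniformizer p).isLocalData_zero_three (fun e => h₁ (e ▸ p.2)) (fun e => h₂ (e ▸ p.2))) hz

theorem regForm_omega_zero_three {z₁ z₂ : ℂ} {q : OnePoint ℂ}
    (h₁ : (z₁ : OnePoint ℂ) ∉ ramificationPoints x)
    (h₂ : (z₂ : OnePoint ℂ) ∉ ramificationPoints x) (hq : q ∉ ramificationPoints x) :
    RegForm q fun z => omega x y 0 3 ![z₁, z₂, z] := by
  rw [funext (omega_zero_three x y z₁ z₂)]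
  exact regForm_recursionSum h.uniformizer h.finite (fun p =>
    (h.uniformizer p).isLocalData_zero_three (fun e => h₁ (e ▸ p.2)) (fun e => h₂ (e ▸ p.2))) hq

theorem reg_omega_zero_three_sub_left (hy : (badSet y).Finite) {w : ℂ}
    (hw : (w : OnePoint ℂ) ∉ ramificationPoints x) (p : ramificationPoints x) :
    Reg fun s => (omega x y 0 3 ![w, w, (h.uniformizer p).φ s] -
      deriv (fun z => (((w - z) ^ 2)⁻¹ * ((w - z) ^ 2)⁻¹) * (vec x z * vec y z))
        ((h.uniformizer p).φ s)) * deriv (h.uniformizer p).φ s := by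
  have hne : ∀ p : ramificationPoints x, (w : OnePoint ℂ) ≠ p := fun p e => hw (e ▸ p.2)
  have h0 := reg_recursionSum_sub h.uniformizer
    (F := fun p q => ((w - q) ^ 2)⁻¹ * ((w - galoisInvolution x p q) ^ 2)⁻¹ +
      ((w - q) ^ 2)⁻¹ * ((w - galoisInvolution x p q) ^ 2)⁻¹)
    (Q := fun p s => (h.uniformizer p).bergman w s * (h.uniformizer p).bergman w (-s) +
      (h.uniformizer p).bergman w s * (h.uniformizer p).bergman w (-s)) h.finite
    (fun p => (h.uniformizer p).isLocalData_zero_three (hne p) (hne p)) p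
  set U := h.uniformizer p
  have hφ := U.isFrame
  have hβ := U.analyticAt_bergman (hne p)
  have e1 : (fun s => (((w - U.φ s) ^ 2)⁻¹ * ((w - U.φ s) ^ 2)⁻¹) *
      (vec x (U.φ s) * vec y (U.φ s))) =ᶠ[𝓝[≠] 0]
      fun s => U.bergman w s * U.bergman w s * ((2 * s)⁻¹ * (deriv U.Y s)⁻¹) := by
    filter_upwards [(hφ.vec_comp h.finite_badSet).trans U.localVec_left,
      (hφ.vec_comp hy).trans U.localVec_right, U.bergman_φ w, hφ.coord] with s h1 h2 h3 h4
    rw [← h1, ← h2, ← h3]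
    have := h4.2
    field_simp
  refine (h0.sub (reg_symmetric_add_deriv U.analyticAt_Y U.deriv_Y hβ hβ)).congr ?_
  filter_upwards [hφ.deriv_eq (analyticAlong_three hφ h.finite_badSet hy w) e1] with s h1
  rw [sub_mul, h1, omega_zero_three]
  simp only [localForm]
  ring

end OneSided

theorem regForm_deriv_three {x y : RatFunc ℂ} (hx : (badSet x).Finite)
    (hy : (badSet y).Finite) {w : ℂ} {q : OnePoint ℂ} (hqx : q ∉ ramificationPoints x)
    (hqy : q ∉ ramificationPoints y) (hq : q ≠ w) :
    RegForm q (deriv fun z => (((w - z) ^ 2)⁻¹ * ((w - z) ^ 2)⁻¹) * (vec x z * vec y z)) := by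
  have hφ := isFrame_chart q
  obtain ⟨rx, -, -⟩ := reg_localVec hqx
  obtain ⟨ry, -, -⟩ := reg_localVec hqy
  have hβ : Reg (fiber q w) := (analyticAt_fiber (Ne.symm hq)).reg
  have h2 : (fun s => (((w - chart q s) ^ 2)⁻¹ * ((w - chart q s) ^ 2)⁻¹) *
      (vec x (chart q s) * vec y (chart q s))) =ᶠ[𝓝[≠] 0]
      fun s => fiber q w s * fiber q w s * (localVec x (chart q) s * localVec y (chart q) s) := by
    filter_upwards [hφ.vec_comp hx, hφ.vec_comp hy, eventually_ne_zero_nhdsNE, hφ.coord] with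
      s h1 h2 h3 h4
    rw [← h1, ← h2, ← fiber_eq q w h3]
    have := h4.2
    field_simp
  exact ((hβ.mul hβ).mul (rx.mul ry)).deriv.congr (hφ.deriv_eq (analyticAlong_three hφ hx hy w) h2)

/-- The z-derivative of β²ab has the poles of the left side at all ramification points, and an extra
pole at z = w. The third derivative in the first argument has its only pole at w and cancels the
extra one (`reg_threePoint_at_diagonal`). -/
theorem IsSpectralCurve.omega_zero_three_add_swap {x y : RatFunc ℂ} (h : IsSpectralCurve x y)
    {w z : ℂ} (hwx : w ∉ badSet x) (hwy : w ∉ badSet y) (hx : z ∉ badSet x) (hy : z ∉ badSet y)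
    (hzw : z ≠ w) :
    omega x y 0 3 ![w, w, z] + omega y x 0 3 ![w, w, z] =
      deriv (fun z => (((w - z) ^ 2)⁻¹ * ((w - z) ^ 2)⁻¹) * (vec x z * vec y z)) z +
      1 / 6 * deriv (fun v => deriv (fun v => deriv
        (fun v => vec x v * vec y v * ((v - z) ^ 2)⁻¹) v) v) w := by
  have key : ∀ {x y : RatFunc ℂ}, IsSpectralCurve x y → w ∉ badSet x → w ∉ badSet y →
      ∀ p ∈ ramificationPoints x,
      RegForm p fun z => omega x y 0 3 ![w, w, z] + omega y x 0 3 ![w, w, z] -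
        (deriv (fun z => (((w - z) ^ 2)⁻¹ * ((w - z) ^ 2)⁻¹) * (vec x z * vec y z)) z +
        1 / 6 * deriv (fun v => deriv (fun v => deriv
          (fun v => vec x v * vec y v * ((v - z) ^ 2)⁻¹) v) v) w) := by
    intro x y h hwx hwy p hp
    have h1 := (h.left.uniformizer ⟨p, hp⟩).regForm (f := fun z => omega x y 0 3 ![w, w, z] -
      deriv (fun z => (((w - z) ^ 2)⁻¹ * ((w - z) ^ 2)⁻¹) * (vec x z * vec y z)) z)
      (reg_omega_zero_three_sub_left h.left h.right.finite_badSet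
        (notMem_ramificationPoints hwx) ⟨p, hp⟩)
    have h2 := regForm_omega_zero_three h.right (notMem_ramificationPoints hwy)
      (notMem_ramificationPoints hwy) (h.left.disjoint p hp)
    have h3 := (isPolar_three hwx hwy).regForm (q := p)
      (fun e => notMem_ramificationPoints hwx (e ▸ hp))
    exact (Reg.sub (Reg.add h1 h2) (Reg.const_mul h3 (1 / 6))).congr
      (Eventually.of_forall fun s => by ring)
  have hreg : ∀ p, RegForm p fun z => omega x y 0 3 ![w, w, z] + omega y x 0 3 ![w, w, z] -
        (deriv (fun z => (((w - z) ^ 2)⁻¹ * ((w - z) ^ 2)⁻¹) * (vec x z * vec y z)) z +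
        1 / 6 * deriv (fun v => deriv (fun v => deriv
          (fun v => vec x v * vec y v * ((v - z) ^ 2)⁻¹) v) v) w) := by
    intro p
    by_cases hpx : p ∈ ramificationPoints x
    · exact key h hwx hwy p hpx
    by_cases hpy : p ∈ ramificationPoints y
    · refine (key h.symm hwy hwx p hpy).congr (Eventually.of_forall fun s => ?_)
      simp only [add_comm (omega y x 0 3 _), mul_comm (vec y _)]
    have h1 := regForm_omega_zero_three h.left (notMem_ramificationPoints hwx)
      (notMem_ramificationPoints hwx) hpx
    have h2 := regForm_omega_zero_three h.right (notMem_ramificationPoints hwy)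
      (notMem_ramificationPoints hwy) hpy
    by_cases hpw : p = w
    · subst hpw
      have hf : AnalyticAt ℂ (fun δ => vec x (w + δ) * vec y (w + δ)) 0 :=
        AnalyticAt.fun_comp (g := fun z => vec x z * vec y z) (f := fun δ => w + δ)
          (by simpa using (analyticAt_vec hwx).fun_mul (analyticAt_vec hwy)) (by fun_prop)
      refine (Reg.sub (Reg.add h1 h2) (reg_threePoint_at_diagonal hf)).congr
        (Eventually.of_forall fun t => ?_)
      have e1 : deriv (fun z => (((w - z) ^ 2)⁻¹ * ((w - z) ^ 2)⁻¹) * (vec x z * vec y z))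
          (w + t) = deriv (fun t => vec x (w + t) * vec y (w + t) * (t ^ 4)⁻¹) t := by
        rw [← deriv_comp_const_add]
        congr 1
        funext t
        rw [show w - (w + t) = -t by ring, mul_comm, ← mul_inv]
        congr 2
        ring
      have e2 : deriv (fun v => deriv (fun v => deriv
          (fun v => vec x v * vec y v * ((v - (w + t)) ^ 2)⁻¹) v) v) w =
          deriv (deriv (deriv fun δ => vec x (w + δ) * vec y (w + δ) * ((t - δ) ^ 2)⁻¹)) 0 := by
        set g := fun v => vec x v * vec y v * ((v - (w + t)) ^ 2)⁻¹
        have e3 : (fun δ => vec x (w + δ) * vec y (w + δ) * ((t - δ) ^ 2)⁻¹) = fun δ =>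
            g (w + δ) := by
          funext δ
          simp only [g]
          congr 2
          ring
        have e4 : ∀ g : ℂ → ℂ, deriv (fun δ => g (w + δ)) = fun δ => deriv g (w + δ) :=
          fun g => funext fun δ => deriv_comp_const_add ..
        rw [e3, e4 g, e4 (deriv g), e4 (deriv (deriv g))]
        dsimp only
        rw [add_zero]
      dsimp only
      rw [deriv_chart_coe, chart_coe]
      simp only [mul_one]
      rw [e1, e2]
    · have h3 := (isPolar_three hwx hwy).regForm hpw
      have h4 := regForm_deriv_three h.left.finite_badSet h.right.finite_badSet hpx hpy hpw
      exact (Reg.sub (Reg.add h1 h2) (Reg.add h4 (Reg.const_mul h3 (1 / 6)))).congr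
        (Eventually.of_forall fun s => by ring)
  have hc := ((analyticAt_omega_zero_three h.left (notMem_ramificationPoints hwx)
    (notMem_ramificationPoints hwx) (notMem_ramificationPoints hx)).add
    (analyticAt_omega_zero_three h.right (notMem_ramificationPoints hwy)
    (notMem_ramificationPoints hwy) (notMem_ramificationPoints hy)))
  have hB : AnalyticAt ℂ (fun z => ((w - z) ^ 2)⁻¹) z :=
    AnalyticAt.inv (by fun_prop) (pow_ne_zero 2 (sub_ne_zero.2 hzw.symm))
  have hc' := hc.sub (((hB.mul hB).mul ((analyticAt_vec hx).mul (analyticAt_vec hy))).deriv.add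
    (analyticAt_const (v := (1 / 6 : ℂ)).mul ((isPolar_three hwx hwy).analyticAt hzw)))
  exact sub_eq_zero.1 (eq_zero_of_regForm hreg hc'.continuousAt)

/-! ### Local expressions of the genus-one two-point function -/

theorem deriv_add_eventuallyEq {f g : ℂ → ℂ} (hf : MeromorphicAt f 0) (hg : MeromorphicAt g 0) :
    deriv (fun s => f s + g s) =ᶠ[𝓝[≠] 0] fun s => deriv f s + deriv g s := by
  filter_upwards [hf.eventually_analyticAt, hg.eventually_analyticAt] with s h1 h2
  exact deriv_fun_add h1.differentiableAt h2.differentiableAt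

theorem reg_symmetric_add_deriv_of_reg {Y f g : ℂ → ℂ} (hY : AnalyticAt ℂ Y 0)
    (h : deriv Y 0 ≠ 0) (hf : Reg f) (hg : Reg g) :
    Reg fun s => (f s * g (-s) + g s * f (-s)) * ((2 * s)⁻¹ * (Y s - Y (-s))⁻¹) +
      deriv (fun s => f s * g s * ((2 * s)⁻¹ * (deriv Y s)⁻¹)) s := by
  obtain ⟨F, hF, e⟩ := hf
  obtain ⟨G, hG, e'⟩ := hg
  have h1 : (fun s => f s * g s * ((2 * s)⁻¹ * (deriv Y s)⁻¹)) =ᶠ[𝓝[≠] 0]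
      fun s => F s * G s * ((2 * s)⁻¹ * (deriv Y s)⁻¹) := (e.mul e').mul .rfl
  refine (reg_symmetric_add_deriv hY h hF hG).congr ?_
  filter_upwards [e, e', eventually_nhdsNE_neg e, eventually_nhdsNE_neg e',
    deriv_eventuallyEq h1] with s e1 e2 e3 e4 e5
  rw [e1, e2, e3, e4, e5]

theorem meromorphicAt_ramified {Y : ℂ → ℂ} (hY : AnalyticAt ℂ Y 0) :
    MeromorphicAt (fun s => (2 * s)⁻¹ * (deriv Y s)⁻¹) 0 :=
  (AnalyticAt.meromorphicAt (f := fun s : ℂ => 2 * s) (by fun_prop)).inv.mul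
    hY.deriv.meromorphicAt.inv

theorem reg_symmetric_sum {ι : Type*} (T : Finset ι) {Y : ℂ → ℂ} (hY : AnalyticAt ℂ Y 0)
    (h : deriv Y 0 ≠ 0) (k : ι → ℂ) {q : ι → ℂ → ℂ} (hq : ∀ i ∈ T, Reg (q i)) :
    Reg fun s => 2 * (∑ i ∈ T, k i * (q i s * q i (-s))) * ((2 * s)⁻¹ * (Y s - Y (-s))⁻¹) +
      deriv (fun s => (∑ i ∈ T, k i * (q i s * q i s)) * ((2 * s)⁻¹ * (deriv Y s)⁻¹)) s := by
  classical
  induction T using Finset.induction_on with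
  | empty => simpa using Reg.const 0
  | insert i T hi ih =>
    have hT := fun j hj => hq j (Finset.mem_insert_of_mem hj)
    have hi' := hq i (Finset.mem_insert_self i T)
    have hm := meromorphicAt_ramified hY
    have m1 : MeromorphicAt (fun s => k i * (q i s * q i s * ((2 * s)⁻¹ * (deriv Y s)⁻¹))) 0 :=
      (MeromorphicAt.const (k i) 0).fun_mul ((hi'.mul hi').meromorphicAt.fun_mul hm)
    have m2 : MeromorphicAt (fun s => (∑ i ∈ T, k i * (q i s * q i s)) *
        ((2 * s)⁻¹ * (deriv Y s)⁻¹)) 0 :=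
      (Reg.sum T fun j hj => ((hT j hj).mul (hT j hj)).const_mul (k j)).meromorphicAt.fun_mul hm
    refine (((reg_symmetric_add_deriv_of_reg hY h hi' hi').const_mul (k i)).add (ih hT)).congr ?_
    filter_upwards [deriv_add_eventuallyEq m1 m2, (hi'.mul hi').meromorphicAt.fun_mul hm
      |>.eventually_analyticAt] with s h1 h2
    have h3 : (fun s => (∑ j ∈ insert i T, k j * (q j s * q j s)) * ((2 * s)⁻¹ * (deriv Y s)⁻¹)) =
        fun s => k i * (q i s * q i s * ((2 * s)⁻¹ * (deriv Y s)⁻¹)) +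
          (∑ i ∈ T, k i * (q i s * q i s)) * ((2 * s)⁻¹ * (deriv Y s)⁻¹) := by
      funext s
      rw [Finset.sum_insert hi]
      ring
    rw [h3, h1, deriv_const_mul _ h2.differentiableAt, Finset.sum_insert hi]
    ring

theorem linearPart_congr_connection {a b S S' β : ℂ → ℂ} (hS : S =ᶠ[𝓝[≠] 0] S') :
    linearPart a b S β =ᶠ[𝓝[≠] 0] linearPart a b S' β := by
  have h1 : (fun s => diagTerm a S s * b s * β s) =ᶠ[𝓝[≠] 0]
      fun s => diagTerm a S' s * b s * β s := by
    filter_upwards [hS] with s h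
    simp only [diagTerm, h]
  filter_upwards [deriv_eventuallyEq h1] with s h2
  rw [linearPart, linearPart, h2]

/-- The coefficient of the three-point function. -/
def Uniformizer.coef {x y : RatFunc ℂ} {p : OnePoint ℂ} (U : Uniformizer x y p) : ℂ :=
  -(deriv U.Y 0)⁻¹ / 2

section OneSided

variable {x y : RatFunc ℂ} (h : IsRegularAtRamification x y)

/-- The pullback of the form `ξ` of the ramification point `r` by `φ`. -/
def IsRegularAtRamification.form (r : ramificationPoints x) (φ : ℂ → ℂ) (s : ℂ) : ℂ :=
  (h.uniformizer r).xi (φ s) * deriv φ s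

/-- The pullback of the genus-one one-point function by `φ`. -/
def onePoint (x y : RatFunc ℂ) (φ : ℂ → ℂ) (s : ℂ) : ℂ := omega x y 1 1 ![φ s] * deriv φ s

theorem reg_form_of_ne {p r : ramificationPoints x} (hr : r ≠ p) :
    Reg (h.form r (h.uniformizer p).φ) :=
  (h.uniformizer p).reg_comp ((h.uniformizer r).regForm_xi fun e => hr (Subtype.ext e.symm))

theorem form_self (p : ramificationPoints x) :
    h.form p (h.uniformizer p).φ =ᶠ[𝓝[≠] 0] bergmanOrigin (h.uniformizer p).τ :=
  (h.uniformizer p).xi_φ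

theorem reg_sq_mul_form (r p : ramificationPoints x) :
    Reg fun s => s ^ 2 * h.form r (h.uniformizer p).φ s := by
  by_cases hr : r = p
  · subst hr
    set U := h.uniformizer r
    obtain ⟨k0, k1, k2, k3, k11, k12, -, j, -⟩ :=
      exists_bergman_jets U.analyticAt_τ U.τ_zero U.deriv_τ
    refine j.reg_pow_mul.congr ?_
    filter_upwards [form_self h r] with s hs
    rw [hs]
  · exact (Reg.id.pow 2).mul (reg_form_of_ne h hr)

/-- Order four: two from the Bergman kernel between s and -s, two from the recursion kernel. -/
theorem reg_pow_mul_onePoint (p : ramificationPoints x) :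
    Reg fun s => s ^ 4 * onePoint x y (h.uniformizer p).φ s := by
  have h1 := reg_omega_one_one h p
  set U := h.uniformizer p
  obtain ⟨k0, k1, k2, k3, k11, k12, j, -⟩ :=
    exists_bergman_jets U.analyticAt_τ U.τ_zero U.deriv_τ
  obtain ⟨n2, n3, n4, n5, n6, j1, j2⟩ := exists_jets_of_deriv_ne_zero U.analyticAt_Y U.deriv_Y
  have h2 := (j.mul (hasJet_inv_two_mul.mul (hasJet_inv_odd U.deriv_Y j1))).reg_pow_mul
  refine (((Reg.id.pow 4).mul h1).sub h2).congr (Eventually.of_forall fun s => ?_)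
  simp only [onePoint]
  ring

/-- By `omega_zero_three_eq` the three-point term is a sum of products f_r(s) f_r(-s) over the
ramification points r, in which only f_p is singular at `p`. Like the terms with the one-point
function, it has a pole of order at most four. -/
theorem isLocalData_one_two [Fintype (ramificationPoints x)] {w : ℂ}
    (hw : (w : OnePoint ℂ) ∉ ramificationPoints x) (p : ramificationPoints x) :
    IsLocalData (h.uniformizer p)
      (fun q => omega x y 0 3 ![w, q, galoisInvolution x p q] +
        (omega x y 1 1 ![q] * ((w - galoisInvolution x p q) ^ 2)⁻¹ +
        ((w - q) ^ 2)⁻¹ * omega x y 1 1 ![galoisInvolution x p q]))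
      (fun s => ∑ r : ramificationPoints x, (h.uniformizer r).coef * (h.uniformizer r).xi w *
          (h.form r (h.uniformizer p).φ s * h.form r (h.uniformizer p).φ (-s)) +
        (onePoint x y (h.uniformizer p).φ s * (h.uniformizer p).bergman w (-s) +
          (h.uniformizer p).bergman w s * onePoint x y (h.uniformizer p).φ (-s))) where
  even := Eventually.of_forall fun s => by
    simp only [neg_neg]
    rw [add_comm (onePoint _ _ _ (-s) * _)]
    congr 1
    · exact Finset.sum_congr rfl fun r _ => by ring
    · ring
  jet := by
    have hβ := ((h.uniformizer p).analyticAt_bergman (z := w) fun e => hw (e ▸ p.2)).reg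
    refine HasJet.exists_of_reg_pow_mul ?_
    have h1 := Reg.sum Finset.univ fun (r : ramificationPoints x) _ =>
      (((reg_sq_mul_form h r p).mul (reg_sq_mul_form h r p).comp_neg).const_mul
        ((h.uniformizer r).coef * (h.uniformizer r).xi w))
    have h2 := ((reg_pow_mul_onePoint h p).mul hβ.comp_neg).add
      (hβ.mul (reg_pow_mul_onePoint h p).comp_neg)
    refine (h1.add h2).congr (Eventually.of_forall fun s => ?_)
    dsimp only
    rw [mul_add, Finset.mul_sum]
    congr 1
    · exact Finset.sum_congr rfl fun r _ => by ring
    · ring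
  eq := by
    filter_upwards [(h.uniformizer p).galoisInvolution_φ, (h.uniformizer p).bergman_φ w,
      eventually_nhdsNE_neg ((h.uniformizer p).bergman_φ w),
      (h.uniformizer p).eventually_φ_notMem h.finite,
      eventually_nhdsNE_neg ((h.uniformizer p).eventually_φ_notMem h.finite)] with s h1 h2 h3 h4 h5
    rw [h1, omega_zero_three_eq h hw h4 h5, add_mul, Finset.sum_mul, ← h2, ← h3]
    congr 1
    · refine Finset.sum_congr rfl fun r _ => ?_
      simp only [IsRegularAtRamification.form, Uniformizer.coef]
      ring
    · simp only [onePoint]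
      ring

theorem analyticAt_omega_one_two {w z : ℂ} (hw : (w : OnePoint ℂ) ∉ ramificationPoints x)
    (hz : (z : OnePoint ℂ) ∉ ramificationPoints x) (h : IsRegularAtRamification x y) :
    AnalyticAt ℂ (fun z => omega x y 1 2 ![w, z]) z := by
  have := h.finite.fintype
  rw [funext (omega_one_two x y w)]
  exact analyticAt_recursionSum h.uniformizer h.finite (isLocalData_one_two h hw) hz

theorem regForm_omega_one_two {w : ℂ} {q : OnePoint ℂ}
    (hw : (w : OnePoint ℂ) ∉ ramificationPoints x) (hq : q ∉ ramificationPoints x)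
    (h : IsRegularAtRamification x y) : RegForm q fun z => omega x y 1 2 ![w, z] := by
  have := h.finite.fintype
  rw [funext (omega_one_two x y w)]
  exact regForm_recursionSum h.uniformizer h.finite (isLocalData_one_two h hw) hq

theorem reg_omega_one_two_add [Fintype (ramificationPoints x)] {w : ℂ}
    (hw : (w : OnePoint ℂ) ∉ ramificationPoints x) (p : ramificationPoints x) :
    Reg fun s => omega x y 1 2 ![w, (h.uniformizer p).φ s] * deriv (h.uniformizer p).φ s +
      (∑ r : ramificationPoints x, (h.uniformizer r).coef * (h.uniformizer r).xi w *
          (h.form r (h.uniformizer p).φ s * h.form r (h.uniformizer p).φ (-s)) +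
        (onePoint x y (h.uniformizer p).φ s * (h.uniformizer p).bergman w (-s) +
          (h.uniformizer p).bergman w s * onePoint x y (h.uniformizer p).φ (-s))) *
      ((2 * s)⁻¹ * ((h.uniformizer p).Y s - (h.uniformizer p).Y (-s))⁻¹) := by
  refine (reg_recursionSum_sub h.uniformizer (F := fun p q =>
    omega x y 0 3 ![w, q, galoisInvolution x p q] +
        (omega x y 1 1 ![q] * ((w - galoisInvolution x p q) ^ 2)⁻¹ +
        ((w - q) ^ 2)⁻¹ * omega x y 1 1 ![galoisInvolution x p q])) h.finite
    (isLocalData_one_two h hw) p).congr (Eventually.of_forall fun s => ?_)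
  simp only [omega_one_two, localForm]
  ring

end OneSided

/-! ### The swap term -/

/-- The derivative in the fixed variable that comes from the square of the Bergman kernel. -/
def crossTerm (x y : RatFunc ℂ) (w z : ℂ) : ℂ :=
  deriv (fun v => (((v - z) ^ 2)⁻¹ * ((v - z) ^ 2)⁻¹) * (vec x v * vec y v)) w

/-- The function of the moving point whose derivative enters the swap relation. -/
def movingPotential (x y : RatFunc ℂ) (w z : ℂ) : ℂ :=
  -(omega x y 1 1 ![z] * (vec x z * vec y z) * ((w - z) ^ 2)⁻¹) -
    1 / 2 * (omega x y 0 3 ![z, z, w] * (vec x z * vec y z)) +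
    linearPart (vec x) (vec y) 0 (fun z => ((w - z) ^ 2)⁻¹) z +
    1 / 2 * (vec x z * vec y z * crossTerm x y w z)

/-- The function of the fixed point whose derivative enters the swap relation. -/
def fixedPotential (x y : RatFunc ℂ) (z v : ℂ) : ℂ :=
  -(omega x y 1 1 ![v] * (vec x v * vec y v) * ((v - z) ^ 2)⁻¹) -
    1 / 2 * (omega x y 0 3 ![v, v, z] * (vec x v * vec y v)) +
    linearPart (vec x) (vec y) 0 (fun v => ((v - z) ^ 2)⁻¹) v

/-- The difference of the genus-one two-point functions of the two spectral curves. -/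
def swapTerm (x y : RatFunc ℂ) (w z : ℂ) : ℂ :=
  deriv (movingPotential x y w) z + deriv (fixedPotential x y z) w

section

variable {x y : RatFunc ℂ} {w z : ℂ}

theorem analyticAt_mul_vec (hx : z ∉ badSet x) (hy : z ∉ badSet y) :
    AnalyticAt ℂ (fun z => vec x z * vec y z) z :=
  (analyticAt_vec hx).mul (analyticAt_vec hy)

theorem crossTerm_eq (hwx : w ∉ badSet x) (hwy : w ∉ badSet y) (hz : z ≠ w) :
    crossTerm x y w z = ((w - z) ^ 2)⁻¹ *
      (deriv (fun v => vec x v * vec y v) w * ((w - z) ^ 2)⁻¹ -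
        4 * (vec x w * vec y w) * ((w - z) ^ 3)⁻¹) := by
  have h1 : w - z ≠ 0 := sub_ne_zero.2 hz.symm
  have h2 := (((hasDerivAt_id' w).sub_const z).fun_pow 2).fun_inv (pow_ne_zero 2 h1)
  have h3 := (analyticAt_mul_vec hwx hwy).differentiableAt.hasDerivAt
  rw [crossTerm, ((h2.fun_mul h2).fun_mul h3).deriv]
  push_cast
  field_simp
  ring

theorem analyticAt_bergmanKernel (hz : z ≠ w) : AnalyticAt ℂ (fun z => ((w - z) ^ 2)⁻¹) z :=
  AnalyticAt.inv (by fun_prop) (pow_ne_zero 2 (sub_ne_zero.2 hz.symm))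

theorem analyticAt_crossTerm (hwx : w ∉ badSet x) (hwy : w ∉ badSet y) (hz : z ≠ w) :
    AnalyticAt ℂ (crossTerm x y w) z := by
  have h1 := analyticAt_bergmanKernel hz
  have h2 : AnalyticAt ℂ (fun z => ((w - z) ^ 3)⁻¹) z :=
    AnalyticAt.inv (by fun_prop) (pow_ne_zero 3 (sub_ne_zero.2 hz.symm))
  refine (h1.fun_mul ((analyticAt_const (v := deriv (fun v => vec x v * vec y v) w)).fun_mul h1
    |>.fun_sub ((analyticAt_const (v := 4 * (vec x w * vec y w))).fun_mul h2))).congr ?_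
  filter_upwards [isOpen_ne.mem_nhds hz] with u hu
  exact (crossTerm_eq hwx hwy hu).symm

theorem eventually_notMem_ramificationPoints (h : IsRegularAtRamification x y)
    (hz : (z : OnePoint ℂ) ∉ ramificationPoints x) :
    ∀ᶠ u : ℂ in 𝓝 z, (u : OnePoint ℂ) ∉ ramificationPoints x :=
  (finite_coe_preimage_ramificationPoints h.finite).isClosed.isOpen_compl.mem_nhds hz

theorem analyticAt_xi_uniformizer (h : IsRegularAtRamification x y)
    (hz : (z : OnePoint ℂ) ∉ ramificationPoints x) (p : ramificationPoints x) :
    AnalyticAt ℂ (h.uniformizer p).xi z :=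
  (h.uniformizer p).analyticAt_xi fun e => hz (e ▸ p.2)

theorem analyticAt_omega_zero_three_diag (h : IsRegularAtRamification x y)
    (hw : (w : OnePoint ℂ) ∉ ramificationPoints x)
    (hz : (z : OnePoint ℂ) ∉ ramificationPoints x) :
    AnalyticAt ℂ (fun z => omega x y 0 3 ![z, z, w]) z := by
  have := h.finite.fintype
  have h1 : AnalyticAt ℂ (fun z => ∑ p : ramificationPoints x,
      -(deriv (h.uniformizer p).Y 0)⁻¹ / 2 * (h.uniformizer p).xi z * (h.uniformizer p).xi z *
        (h.uniformizer p).xi w) z :=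
    Finset.analyticAt_fun_sum _ fun p _ => (((analyticAt_const.mul
      (analyticAt_xi_uniformizer h hz p)).mul (analyticAt_xi_uniformizer h hz p)).mul
      analyticAt_const)
  refine h1.congr ?_
  filter_upwards [eventually_notMem_ramificationPoints h hz] with u hu
  exact (omega_zero_three_eq h hu hu hw).symm

theorem analyticAt_linearPart {a b β : ℂ → ℂ} (ha : AnalyticAt ℂ a z) (hb : AnalyticAt ℂ b z)
    (hβ : AnalyticAt ℂ β z) (hb0 : b z ≠ 0) : AnalyticAt ℂ (linearPart a b 0 β) z := by
  have := ha.deriv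
  have := ha.deriv.deriv
  have := hb.deriv
  have hbi := hb.inv hb0
  have hd : AnalyticAt ℂ (diagTerm a 0) z := by
    unfold diagTerm
    simp only [Pi.zero_apply]
    fun_prop
  have h5 := ((hd.mul hb).mul hβ).deriv
  have h8 := (hb.mul ((ha.mul ha).mul (hβ.deriv.add ((hb.deriv.mul hbi).mul hβ))).deriv).deriv
  exact (analyticAt_const.mul (hb.mul h5)).add (analyticAt_const.mul (hb.mul h8))

theorem analyticAt_movingPotential (h : IsRegularAtRamification x y) (hwx : w ∉ badSet x)
    (hwy : w ∉ badSet y) (hx : z ∉ badSet x) (hy : z ∉ badSet y) (hz : z ≠ w) :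
    AnalyticAt ℂ (movingPotential x y w) z := by
  have h1 := analyticAt_mul_vec hx hy
  have h2 := analyticAt_bergmanKernel hz
  have h3 := analyticAt_omega_one_one h (notMem_ramificationPoints hx)
  have h4 := analyticAt_omega_zero_three_diag h (notMem_ramificationPoints hwx)
    (notMem_ramificationPoints hx)
  have h5 := analyticAt_linearPart (analyticAt_vec hx) (analyticAt_vec hy) h2 (vec_ne_zero hy)
  have h6 := analyticAt_crossTerm hwx hwy hz
  unfold movingPotential
  fun_prop

/-- The part of the potential that is polar on the diagonal. -/
def polarPotential (x y : RatFunc ℂ) (v z : ℂ) : ℂ :=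
  -(omega x y 1 1 ![v] * (vec x v * vec y v)) * ((v - z) ^ 2)⁻¹ +
    linearPart (vec x) (vec y) 0 (fun v => ((v - z) ^ 2)⁻¹) v

theorem isPolar_polarPotential (h : IsRegularAtRamification x y) (hwx : w ∉ badSet x)
    (hwy : w ∉ badSet y) : IsPolar w (polarPotential x y) :=
  ((IsPolar.bergman w).mul_left ((analyticAt_omega_one_one h (notMem_ramificationPoints hwx)).mul
    (analyticAt_mul_vec hwx hwy)).neg).add
    (IsPolar.linearPart (analyticAt_vec hwx) (analyticAt_vec hwy) (vec_ne_zero hwy))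

theorem analyticAt_polarPotential (h : IsRegularAtRamification x y) (hwx : w ∉ badSet x)
    (hwy : w ∉ badSet y) (hz : z ≠ w) : AnalyticAt ℂ (fun v => polarPotential x y v z) w := by
  have h1 := analyticAt_mul_vec hwx hwy
  have h2 : AnalyticAt ℂ (fun v => ((v - z) ^ 2)⁻¹) w :=
    AnalyticAt.inv (by fun_prop) (pow_ne_zero 2 (sub_ne_zero.2 hz.symm))
  have h3 := analyticAt_omega_one_one h (notMem_ramificationPoints hwx)
  have h5 := analyticAt_linearPart (analyticAt_vec hwx) (analyticAt_vec hwy) h2 (vec_ne_zero hwy)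
  unfold polarPotential
  fun_prop

theorem analyticAt_fixedPotential (h : IsRegularAtRamification x y) (hwx : w ∉ badSet x)
    (hwy : w ∉ badSet y) (hz : z ≠ w) (hzR : (z : OnePoint ℂ) ∉ ramificationPoints x) :
    AnalyticAt ℂ (fixedPotential x y z) w := by
  have h1 := analyticAt_mul_vec hwx hwy
  have h4 := analyticAt_omega_zero_three_diag h hzR (notMem_ramificationPoints hwx)
  refine ((analyticAt_polarPotential h hwx hwy hz).fun_sub
    ((analyticAt_const (v := (1 / 2 : ℂ))).fun_mul (h4.fun_mul h1))).congr
    (Eventually.of_forall fun v => ?_)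
  simp only [polarPotential, fixedPotential]
  ring

/-- Separates a part that is polar on the diagonal from a finite combination of the forms ξ_p(z).
The behaviour in z of a derivative taken in w is then visible. -/
theorem deriv_fixedPotential [Fintype (ramificationPoints x)] (h : IsRegularAtRamification x y)
    (hwx : w ∉ badSet x) (hwy : w ∉ badSet y) (hz : z ≠ w)
    (hzR : (z : OnePoint ℂ) ∉ ramificationPoints x) :
    deriv (fixedPotential x y z) w = deriv (fun v => polarPotential x y v z) w -
      ∑ p : ramificationPoints x, 1 / 2 * (h.uniformizer p).coef *
        deriv (fun v => (h.uniformizer p).xi v * (h.uniformizer p).xi v * (vec x v * vec y v)) w *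
        (h.uniformizer p).xi z := by
  have hc := analyticAt_mul_vec hwx hwy
  have e : fixedPotential x y z =ᶠ[𝓝 w] fun v => polarPotential x y v z -
      ∑ p : ramificationPoints x, (1 / 2 * (h.uniformizer p).coef * (h.uniformizer p).xi z) *
        ((h.uniformizer p).xi v * (h.uniformizer p).xi v * (vec x v * vec y v)) := by
    filter_upwards [eventually_notMem_ramificationPoints h (notMem_ramificationPoints hwx)]
      with v hv
    have e1 : ∑ p : ramificationPoints x, (1 / 2 * (h.uniformizer p).coef *
        (h.uniformizer p).xi z) *
        ((h.uniformizer p).xi v * (h.uniformizer p).xi v * (vec x v * vec y v)) =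
        1 / 2 * (omega x y 0 3 ![v, v, z] * (vec x v * vec y v)) := by
      rw [omega_zero_three_eq h hv hv hzR, Finset.sum_mul, Finset.mul_sum]
      exact Finset.sum_congr rfl fun p _ => by simp only [Uniformizer.coef]; ring
    rw [e1, fixedPotential, polarPotential]
    ring
  rw [e.deriv_eq]
  have hd : ∀ p : ramificationPoints x, HasDerivAt
      (fun v => (h.uniformizer p).xi v * (h.uniformizer p).xi v * (vec x v * vec y v))
      (deriv (fun v => (h.uniformizer p).xi v * (h.uniformizer p).xi v * (vec x v * vec y v)) w)
      w := fun p =>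
    have hξ := analyticAt_xi_uniformizer h (notMem_ramificationPoints hwx) p
    ((hξ.mul hξ).mul hc).differentiableAt.hasDerivAt
  rw [((analyticAt_polarPotential h hwx hwy hz).differentiableAt.hasDerivAt.fun_sub
    (HasDerivAt.fun_sum fun p _ => (hd p).const_mul _)).deriv]
  congr 1
  exact Finset.sum_congr rfl fun p _ => by ring

theorem movingPotential_comp [Fintype (ramificationPoints x)] (h : IsRegularAtRamification x y)
    (hy : (badSet y).Finite) (hw : (w : OnePoint ℂ) ∉ ramificationPoints x) {φ : ℂ → ℂ}
    (hφ : IsFrame φ) : (fun s => movingPotential x y w (φ s)) =ᶠ[𝓝[≠] 0] fun s =>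
      -(onePoint x y φ s * (((w - φ s) ^ 2)⁻¹ * deriv φ s) * (localVec x φ s * localVec y φ s)) -
      1 / 2 * (∑ r : ramificationPoints x, (h.uniformizer r).coef * (h.uniformizer r).xi w *
        (h.form r φ s * h.form r φ s)) * (localVec x φ s * localVec y φ s) +
      linearPart (localVec x φ) (localVec y φ) (schwarzian φ)
        (fun s => ((w - φ s) ^ 2)⁻¹ * deriv φ s) s +
      1 / 2 * (localVec x φ s * localVec y φ s *
        (crossTerm x y w (φ s) * (deriv φ s * deriv φ s))) := by
  have ax := hφ.analyticAlong_vec h.finite_badSet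
  have ay := hφ.analyticAlong_vec hy
  filter_upwards [hφ.vec_comp h.finite_badSet, hφ.vec_comp hy, hφ.coord,
    hφ.avoid _ (finite_coe_preimage_ramificationPoints h.finite),
    linearPart_comp hφ.coord ax ay (analyticAlong_bergman hφ w) (hφ.vec_ne_zero hy),
    linearPart_congr (S := schwarzian φ) (hφ.vec_comp h.finite_badSet) (hφ.vec_comp hy)
      (EventuallyEq.refl _ fun s => ((w - φ s) ^ 2)⁻¹ * deriv φ s)] with s h1 h2 h3 h4 h5 h6
  have hd := h3.2
  have e1 : vec x (φ s) * vec y (φ s) = localVec x φ s * localVec y φ s *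
      (deriv φ s * deriv φ s) := by
    rw [← h1, ← h2]
    field_simp
  rw [movingPotential, h5, h6, e1, omega_zero_three_eq h h4 h4 hw]
  have e2 : (∑ p : ramificationPoints x, -(deriv (h.uniformizer p).Y 0)⁻¹ / 2 *
      (h.uniformizer p).xi (φ s) * (h.uniformizer p).xi (φ s) * (h.uniformizer p).xi w) *
      (deriv φ s * deriv φ s) = ∑ r : ramificationPoints x, (h.uniformizer r).coef *
        (h.uniformizer r).xi w * (h.form r φ s * h.form r φ s) := by
    rw [Finset.sum_mul]
    refine Finset.sum_congr rfl fun r _ => ?_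
    simp only [IsRegularAtRamification.form, Uniformizer.coef]
    ring
  rw [← e2, onePoint]
  ring

end

/-! ### Regularity at the ramification points -/

/-- The form `dt` times `1 / (z - chart p t)³`. -/
def cubicFiber (p : OnePoint ℂ) (z t : ℂ) : ℂ :=
  p.elim (-(t * ((z * t - 1) ^ 3)⁻¹)) fun a => ((z - a - t) ^ 3)⁻¹

theorem cubicFiber_eq (p : OnePoint ℂ) (z : ℂ) {t : ℂ} (ht : t ≠ 0) :
    ((z - chart p t) ^ 3)⁻¹ * deriv (chart p) t = cubicFiber p z t := by
  induction p using OnePoint.rec with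
  | infty =>
    rw [deriv_chart_infty, chart_infty]
    simp only [cubicFiber, OnePoint.elim_infty]
    have h : z * t - 1 = (z - t⁻¹) * t := by field_simp
    rw [h, mul_pow, mul_inv]
    field_simp
  | coe a =>
    rw [deriv_chart_coe, chart_coe]
    simp only [cubicFiber, OnePoint.elim_some, sub_sub, mul_one]

theorem analyticAt_cubicFiber {p : OnePoint ℂ} {z : ℂ} (h : (z : OnePoint ℂ) ≠ p) :
    AnalyticAt ℂ (cubicFiber p z) 0 := by
  induction p using OnePoint.rec with
  | infty => exact (AnalyticAt.mul (by fun_prop) (AnalyticAt.inv (by fun_prop) (by simp))).neg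
  | coe a =>
    have h1 : z - a ≠ 0 := sub_ne_zero.2 fun e => h (by rw [e])
    exact AnalyticAt.inv (by fun_prop) (by simpa using h1)

theorem cubicFiber_zero {p : OnePoint ℂ} {z : ℂ} (h : (z : OnePoint ℂ) ≠ p) :
    deriv (poleForm p 1) z = -2 * cubicFiber p z 0 := by
  induction p using OnePoint.rec with
  | infty =>
    have : poleForm OnePoint.infty 1 = fun _ => -1 := by funext z; simp [poleForm]
    simp [this, cubicFiber]
  | coe a =>
    have h1 : z - a ≠ 0 := sub_ne_zero.2 fun e => h (by rw [e])
    have e : poleForm a 1 = fun z => ((z - a) ^ 2)⁻¹ := rfl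
    rw [e, ((((hasDerivAt_id' z).sub_const a).fun_pow 2).fun_inv (pow_ne_zero 2 h1)).deriv]
    simp only [cubicFiber, OnePoint.elim_some]
    push_cast
    field_simp
    ring

/-- At s = 0 the Bergman kernel becomes ξ_p(w), so the cross term takes the value ∂(ξ_p² ab) at w.
This is the coefficient with which ξ_p(z) enters `deriv_fixedPotential`. -/
theorem Uniformizer.exists_crossTerm {x y : RatFunc ℂ} {p : OnePoint ℂ} (U : Uniformizer x y p)
    {w : ℂ} (hwx : w ∉ badSet x) (hwy : w ∉ badSet y) (hw : (w : OnePoint ℂ) ≠ p) :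
    ∃ Γ, AnalyticAt ℂ Γ 0 ∧
      Γ 0 = deriv (fun v => U.xi v * U.xi v * (vec x v * vec y v)) w ∧
      (fun s => crossTerm x y w (U.φ s) * (deriv U.φ s * deriv U.φ s)) =ᶠ[𝓝[≠] 0] Γ := by
  have hγ : AnalyticAt ℂ (fun s => cubicFiber p w (U.τ s) * deriv U.τ s) 0 :=
    (AnalyticAt.fun_comp (by rw [U.τ_zero]; exact analyticAt_cubicFiber hw) U.analyticAt_τ).mul
      U.analyticAt_τ.deriv
  have hβ := U.analyticAt_bergman hw
  refine ⟨fun s => U.bergman w s * (deriv (fun v => vec x v * vec y v) w * U.bergman w s -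
    4 * (vec x w * vec y w) * (cubicFiber p w (U.τ s) * deriv U.τ s)), by fun_prop, ?_, ?_⟩
  · have hξ := (U.analyticAt_xi hw).differentiableAt.hasDerivAt
    have hc := (analyticAt_mul_vec hwx hwy).differentiableAt.hasDerivAt
    have hd : deriv U.xi w = deriv U.τ 0 * (-2 * cubicFiber p w 0) := by
      rw [← cubicFiber_zero hw]
      exact deriv_const_mul _ (analyticAt_poleForm hw 1).differentiableAt
    rw [((hξ.fun_mul hξ).fun_mul hc).deriv, hd]
    dsimp only
    rw [U.bergman_zero, U.τ_zero]
    ring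
  · filter_upwards [U.eventually_deriv_φ, U.tendsto_τ.eventually eventually_ne_zero_nhdsNE,
      U.bergman_φ w, U.isFrame.avoid _ (Set.finite_singleton w)] with s h1 h2 h3 h4
    rw [crossTerm_eq hwx hwy h4, ← h3, ← cubicFiber_eq p w h2, h1]
    simp only [φ]
    ring

/-- The term under the derivative has the simple pole Γ(0)/(4Y'(0)s); the resulting double pole is
cancelled by the multiple of ξ_p from the fixed potential. -/
theorem reg_cross_at_ramification {Y τ Γ : ℂ → ℂ} (hY : AnalyticAt ℂ Y 0) (hY1 : deriv Y 0 ≠ 0)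
    (hτ : AnalyticAt ℂ τ 0) (h0 : τ 0 = 0) (h1 : deriv τ 0 ≠ 0) (hΓ : AnalyticAt ℂ Γ 0) :
    Reg fun s => deriv (fun s => 1 / 2 * ((2 * s)⁻¹ * (deriv Y s)⁻¹ * Γ s)) s +
      (deriv Y 0)⁻¹ / 4 * Γ 0 * bergmanOrigin τ s := by
  obtain ⟨n2, n3, n4, n5, n6, i1, i2⟩ := exists_jets_of_deriv_ne_zero hY hY1
  obtain ⟨k0, k1, k2, k3, k11, k12, jB, jO, jS⟩ := exists_bergman_jets hτ h0 h1
  obtain ⟨⟨g0, g1, g2, g3, g4, g5⟩, jg, e, -⟩ := HasJet.exists_of_analyticAt hΓ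
  have j := (((hasJet_inv_two_mul.mul (i2.inv_smul hY1)).mul jg).smul (1 / 2)).deriv.add
    (jO.smul ((deriv Y 0)⁻¹ / 4 * Γ 0))
  refine j.reg_two ?_ ?_ <;> simp only [Jet.add, Jet.smul, Jet.mul, Jet.deriv, ← e] <;>
    push_cast <;> ring

theorem AnalyticAlong.eventually_analyticAt_comp {φ f : ℂ → ℂ} (hf : AnalyticAlong φ f)
    (hφ : IsCoord φ) : ∀ᶠ s in 𝓝[≠] (0 : ℂ), AnalyticAt ℂ (fun s => f (φ s)) s := by
  filter_upwards [hf, hφ] with s h1 h2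
  exact AnalyticAt.fun_comp h1 h2.1

/-- The one-point form is a regular germ minus its known principal part, and among the forms f_i
only f_p is singular. Purely singular terms cancel by `reg_swap_at_ramification`, those with the
regular germ or with f_i, i ≠ p, by `reg_symmetric_add_deriv_of_reg` and `reg_symmetric_sum`, and
the cross term by `reg_cross_at_ramification`. The rest of the fixed potential is regular at `p`. -/
theorem reg_omega_one_two_add_swapTerm {x y : RatFunc ℂ} (h : IsRegularAtRamification x y)
    (hy : (badSet y).Finite) {w : ℂ} (hwx : w ∉ badSet x) (hwy : w ∉ badSet y)
    (p : ramificationPoints x) :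
    Reg fun s => (omega x y 1 2 ![w, (h.uniformizer p).φ s] +
      swapTerm x y w ((h.uniformizer p).φ s)) * deriv (h.uniformizer p).φ s := by
  classical
  have := h.finite.fintype
  have hw := notMem_ramificationPoints hwx
  have hne : (w : OnePoint ℂ) ≠ p := fun e => hw (e ▸ p.2)
  set U := h.uniformizer p with hU
  have hφ := U.isFrame
  have hβ := U.analyticAt_bergman hne
  obtain ⟨Γ, hΓ, hΓ0, eΓ⟩ := U.exists_crossTerm hwx hwy hne
  set u := onePoint x y U.φ
  set k : ramificationPoints x → ℂ := fun r => (h.uniformizer r).coef * (h.uniformizer r).xi w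
  set f : ramificationPoints x → ℂ → ℂ := fun r => h.form r U.φ
  set D : ramificationPoints x → ℂ := fun r => deriv (fun v => (h.uniformizer r).xi v *
    (h.uniformizer r).xi v * (vec x v * vec y v)) w
  set r : ℂ → ℂ := fun s => u s + bergmanAntidiag U.τ s * ((2 * s)⁻¹ * (U.Y s - U.Y (-s))⁻¹)
  have hr : Reg r := reg_omega_one_one h p
  have hf : ∀ i ∈ Finset.univ.erase p, Reg (f i) := fun i hi =>
    reg_form_of_ne h (Finset.ne_of_mem_erase hi)
  have hR1 := reg_omega_one_two_add h hw p
  have hmain := reg_swap_at_ramification U.analyticAt_Y U.deriv_Y U.analyticAt_τ U.τ_zero U.deriv_τ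
    hβ
  have hS1 := reg_symmetric_add_deriv_of_reg U.analyticAt_Y U.deriv_Y hr hβ.reg
  have hS2 := reg_symmetric_sum (Finset.univ.erase p) U.analyticAt_Y U.deriv_Y k hf
  have htail := reg_cross_at_ramification U.analyticAt_Y U.deriv_Y U.analyticAt_τ U.τ_zero
    U.deriv_τ hΓ
  have hpol := U.reg_comp ((isPolar_polarPotential h hwx hwy).deriv.regForm (q := p) hne.symm)
  have hrest := Reg.sum (Finset.univ.erase p) fun i hi =>
    (hf i hi).const_mul (1 / 2 * (h.uniformizer i).coef * D i)
  have hmov : AnalyticAlong U.φ (movingPotential x y w) := by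
    filter_upwards [hφ.avoid _ h.finite_badSet, hφ.avoid _ hy,
      hφ.avoid _ (Set.finite_singleton w)] with s h1 h2 h3
    exact analyticAt_movingPotential h hwx hwy h1 h2 h3
  have hfp : f p =ᶠ[𝓝[≠] 0] bergmanOrigin U.τ := form_self h p
  have hm := meromorphicAt_ramified U.analyticAt_Y
  have m1 : MeromorphicAt (fun s => r s * U.bergman w s * ((2 * s)⁻¹ * (deriv U.Y s)⁻¹)) 0 :=
    (hr.mul hβ.reg).meromorphicAt.fun_mul hm
  have m2 : MeromorphicAt (fun s => (∑ i ∈ Finset.univ.erase p, k i * (f i s * f i s)) *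
      ((2 * s)⁻¹ * (deriv U.Y s)⁻¹)) 0 :=
    (Reg.sum _ fun i hi => ((hf i hi).mul (hf i hi)).const_mul (k i)).meromorphicAt.fun_mul hm
  have m3 : MeromorphicAt (fun s => 1 / 2 * ((2 * s)⁻¹ * (deriv U.Y s)⁻¹ * Γ s)) 0 :=
    (MeromorphicAt.const _ 0).fun_mul (hm.fun_mul hΓ.meromorphicAt)
  -- The singular germ of `reg_swap_at_ramification` is the moving potential with the regular
  -- one-point part, the forms f_i for i ≠ p and the cross term removed.
  have eM : (fun s => bergmanAntidiag U.τ s * ((2 * s)⁻¹ * (U.Y s - U.Y (-s))⁻¹) *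
        ((2 * s)⁻¹ * (deriv U.Y s)⁻¹) * U.bergman w s +
      (deriv U.Y 0)⁻¹ / 4 * U.bergman w 0 * (bergmanOrigin U.τ s * bergmanOrigin U.τ s) *
        ((2 * s)⁻¹ * (deriv U.Y s)⁻¹) +
      linearPart (fun s => (2 * s)⁻¹) (fun s => (deriv U.Y s)⁻¹) (schwarzian U.τ)
        (U.bergman w) s) =ᶠ[𝓝[≠] 0] fun s => movingPotential x y w (U.φ s) +
      r s * U.bergman w s * ((2 * s)⁻¹ * (deriv U.Y s)⁻¹) +
      1 / 2 * ((∑ i ∈ Finset.univ.erase p, k i * (f i s * f i s)) *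
        ((2 * s)⁻¹ * (deriv U.Y s)⁻¹)) -
      1 / 2 * ((2 * s)⁻¹ * (deriv U.Y s)⁻¹ * Γ s) := by
    filter_upwards [movingPotential_comp h hy hw hφ, U.localVec_left, U.localVec_right,
      U.bergman_φ w, hfp, eΓ,
      (linearPart_congr U.localVec_left U.localVec_right (U.bergman_φ w)).trans
        (linearPart_congr_connection U.schwarzian_eq)] with s h1 h2 h3 h4 h5 h6 h7
    rw [h1, h7, h2, h3, h4, h6, ← Finset.add_sum_erase _ _ (Finset.mem_univ p)]
    change _ = -(u s * _ * _) - 1 / 2 * (k p * (f p s * f p s) +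
      ∑ i ∈ Finset.univ.erase p, k i * (f i s * f i s)) * _ + _ + _ + _ + _ - _
    rw [h5]
    simp only [r, k, ← hU, U.bergman_zero, Uniformizer.coef]
    ring
  refine (((((hR1.add hmain).sub hS1).sub (hS2.const_mul (1 / 2))).add htail).add
    (hpol.sub hrest)).congr ?_
  filter_upwards [hφ.deriv_eq hmov .rfl, deriv_eventuallyEq eM,
    hmov.eventually_analyticAt_comp hφ.coord, m1.eventually_analyticAt, m2.eventually_analyticAt,
    m3.eventually_analyticAt, hfp, eventually_nhdsNE_neg hfp,
    U.eventually_φ_notMem h.finite, hφ.avoid _ (Set.finite_singleton w)] with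
    s d1 d2 a0 a1 a2 a3 e1 e2 n1 n2
  rw [(((a0.differentiableAt.hasDerivAt.fun_add a1.differentiableAt.hasDerivAt).fun_add
    (a2.differentiableAt.hasDerivAt.const_mul (1 / 2))).fun_sub
    a3.differentiableAt.hasDerivAt).deriv] at d2
  rw [d2, ← d1, swapTerm, deriv_fixedPotential h hwx hwy n2 n1,
    ← Finset.add_sum_erase _ _ (Finset.mem_univ p), ← Finset.add_sum_erase _ _ (Finset.mem_univ p)]
  have s1 : (∑ i ∈ Finset.univ.erase p, 1 / 2 * (h.uniformizer i).coef * D i *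
      (h.uniformizer i).xi (U.φ s)) * deriv U.φ s =
      ∑ i ∈ Finset.univ.erase p, 1 / 2 * (h.uniformizer i).coef * D i * f i s := by
    rw [Finset.sum_mul]
    exact Finset.sum_congr rfl fun i _ => by
      simp only [f, IsRegularAtRamification.form]; ring
  have s2 : U.xi (U.φ s) * deriv U.φ s = bergmanOrigin U.τ s := e1
  have hK : (2 * -s)⁻¹ * (U.Y (-s) - U.Y (- -s))⁻¹ = (2 * s)⁻¹ * (U.Y s - U.Y (-s))⁻¹ := by
    have e3 : U.Y (-s) - U.Y s = -(U.Y s - U.Y (-s)) := by ring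
    rw [neg_neg, e3, mul_neg, inv_neg, inv_neg, neg_mul_neg]
  have hr1 : r s = u s + bergmanAntidiag U.τ s * ((2 * s)⁻¹ * (U.Y s - U.Y (-s))⁻¹) := rfl
  have hr2 : r (-s) = u (-s) + bergmanAntidiag U.τ s * ((2 * s)⁻¹ * (U.Y s - U.Y (-s))⁻¹) := by
    simp only [r]
    rw [hK, Uniformizer.bergmanAntidiag_neg]
  have hk : (h.uniformizer p).coef * (h.uniformizer p).xi w =
      -(deriv U.Y 0)⁻¹ / 2 * U.xi w := rfl
  have hc : (h.uniformizer p).coef = -(deriv U.Y 0)⁻¹ / 2 := rfl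
  have e1' : h.form p (h.uniformizer p).φ s = bergmanOrigin U.τ s := e1
  have e2' : h.form p (h.uniformizer p).φ (-s) = bergmanOrigin U.τ (-s) := e2
  rw [← s1, hk, e1', e2', hr1, hr2, U.bergman_zero, hΓ0, hc]
  have e5 : (∑ i ∈ Finset.univ.erase p, (h.uniformizer i).coef * (h.uniformizer i).xi w *
      (h.form i (h.uniformizer p).φ s * h.form i (h.uniformizer p).φ (-s))) =
      ∑ i ∈ Finset.univ.erase p, k i * (f i s * f i (-s)) := rfl
  rw [e5]
  simp only [← hU]
  simp only [u, D]
  linear_combination (deriv U.Y 0)⁻¹ / 4 *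
    deriv (fun v => U.xi v * U.xi v * (vec x v * vec y v)) w * s2

/-! ### Regularity at the other points -/

section

variable {x y : RatFunc ℂ} {w z : ℂ}

theorem regForm_deriv_fixedPotential (h : IsRegularAtRamification x y) (hwx : w ∉ badSet x)
    (hwy : w ∉ badSet y) {q : OnePoint ℂ} (hq : q ∉ ramificationPoints x) (hqw : q ≠ w) :
    RegForm q fun z => deriv (fixedPotential x y z) w := by
  have := h.finite.fintype
  have h1 := (isPolar_polarPotential h hwx hwy).deriv.regForm hqw
  have h2 := regForm_sum (Finset.univ : Finset (ramificationPoints x)) (q := q)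
    (f := fun p z => 1 / 2 * (h.uniformizer p).coef *
        deriv (fun v => (h.uniformizer p).xi v * (h.uniformizer p).xi v * (vec x v * vec y v)) w *
        (h.uniformizer p).xi z) fun p _ =>
    (Reg.const_mul ((h.uniformizer p).regForm_xi (q := q) fun e => hq (by rw [e]; exact p.2))
      (1 / 2 * (h.uniformizer p).coef * deriv (fun v => (h.uniformizer p).xi v *
        (h.uniformizer p).xi v * (vec x v * vec y v)) w)).congr
      (Eventually.of_forall fun s => by ring)
  refine (Reg.sub h1 h2).congr ?_
  filter_upwards [eventually_chart_notMem q (finite_coe_preimage_ramificationPoints h.finite),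
    eventually_chart_notMem q (Set.finite_singleton w)] with t e1 e2
  rw [deriv_fixedPotential h hwx hwy e2 e1]
  ring

theorem reg_crossTerm (hwx : w ∉ badSet x) (hwy : w ∉ badSet y) {q : OnePoint ℂ} (hq : q ≠ w) :
    Reg fun s => crossTerm x y w (chart q s) * (deriv (chart q) s * deriv (chart q) s) := by
  have h1 := (analyticAt_fiber hq.symm).reg
  have h2 := (analyticAt_cubicFiber hq.symm).reg
  refine (h1.mul ((h1.const_mul (deriv (fun v => vec x v * vec y v) w)).sub
    (h2.const_mul (4 * (vec x w * vec y w))))).congr ?_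
  filter_upwards [eventually_ne_zero_nhdsNE, eventually_chart_notMem q (Set.finite_singleton w)]
    with s e1 e2
  rw [crossTerm_eq hwx hwy e2, ← fiber_eq q w e1, ← cubicFiber_eq q w e1]
  ring

/-- Both vector fields 1/dx and 1/dy are regular at such a point, even at a pole of x or y; the
quotient b'/b is taken care of in `reg_linearPart`. -/
theorem regForm_swapTerm (h : IsRegularAtRamification x y) (hwx : w ∉ badSet x)
    (hwy : w ∉ badSet y) (hy : (badSet y).Finite) {q : OnePoint ℂ}
    (hqx : q ∉ ramificationPoints x) (hqy : q ∉ ramificationPoints y) (hqw : q ≠ w) :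
    RegForm q (swapTerm x y w) := by
  have := h.finite.fintype
  have hφ := isFrame_chart q
  have hw := notMem_ramificationPoints hwx
  obtain ⟨rx, -, -⟩ := reg_localVec hqx
  obtain ⟨ry, ny, ry'⟩ := reg_localVec hqy
  have hβ : Reg fun s => ((w - chart q s) ^ 2)⁻¹ * deriv (chart q) s := by
    refine (analyticAt_fiber hqw.symm).reg.congr ?_
    filter_upwards [eventually_ne_zero_nhdsNE] with s hs using fiber_eq q w hs
  have hu : Reg (onePoint x y (chart q)) := regForm_omega_one_one h hqx
  have hf : ∀ r : ramificationPoints x, Reg (h.form r (chart q)) := fun r =>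
    (h.uniformizer r).regForm_xi fun e => hqx (by rw [e]; exact r.2)
  have hs := Reg.sum Finset.univ fun (r : ramificationPoints x) _ =>
    ((hf r).mul (hf r)).const_mul ((h.uniformizer r).coef * (h.uniformizer r).xi w)
  have hM := (((((hu.mul hβ).mul (rx.mul ry)).neg).sub ((hs.const_mul (1 / 2)).mul
    (rx.mul ry))).add (reg_linearPart rx ry (schwarzian_reg q) hβ ry' ny)).add
    (((rx.mul ry).mul (reg_crossTerm hwx hwy hqw)).const_mul (1 / 2))
  have hmov : AnalyticAlong (chart q) (movingPotential x y w) := by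
    filter_upwards [hφ.avoid _ h.finite_badSet, hφ.avoid _ hy,
      hφ.avoid _ (Set.finite_singleton w)] with s h1 h2 h3
    exact analyticAt_movingPotential h hwx hwy h1 h2 h3
  refine (Reg.add (hM.congr (movingPotential_comp h hy hw hφ)).deriv
    (regForm_deriv_fixedPotential h hwx hwy hqx hqw)).congr ?_
  filter_upwards [hφ.deriv_eq hmov .rfl] with s e1
  rw [← e1, swapTerm]
  ring

theorem deriv_const_add (g : ℂ → ℂ) (c : ℂ) :
    deriv (fun δ => g (c + δ)) = fun δ => deriv g (c + δ) :=
  funext fun _ => deriv_comp_const_add ..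

theorem linearPart_const_add (a b β : ℂ → ℂ) (c t : ℂ) :
    linearPart a b 0 β (c + t) =
      linearPart (fun δ => a (c + δ)) (fun δ => b (c + δ)) 0 (fun δ => β (c + δ)) t := by
  have e1 : ∀ δ, diagTerm (fun δ => a (c + δ)) 0 δ = diagTerm a 0 (c + δ) := fun δ => by
    simp only [diagTerm, deriv_const_add a, deriv_const_add (deriv a), Pi.zero_apply]
  simp only [linearPart, e1, deriv_const_add β, deriv_const_add b]
  rw [deriv_const_add (fun s => diagTerm a 0 s * b s * β s),
    deriv_const_add (fun s => a s * a s * (deriv β s + deriv b s * (b s)⁻¹ * β s)),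
    deriv_const_add (fun s => b s * deriv (fun s => a s * a s *
      (deriv β s + deriv b s * (b s)⁻¹ * β s)) s)]

theorem genusOnePotential_const_add (a b : ℂ → ℂ) (c t : ℂ) :
    genusOnePotential a b 0 (c + t) =
      genusOnePotential (fun δ => a (c + δ)) (fun δ => b (c + δ)) 0 t := by
  simp only [genusOnePotential, deriv_const_add a, deriv_const_add b, deriv_const_add (deriv a),
    deriv_const_add (deriv b), Pi.zero_apply]

theorem AnalyticAt.comp_const_add {f : ℂ → ℂ} {c : ℂ} (hf : AnalyticAt ℂ f c) :
    AnalyticAt ℂ (fun δ => f (c + δ)) 0 :=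
  AnalyticAt.fun_comp (g := f) (f := fun δ => c + δ) (by simpa using hf) (by fun_prop)

/-- The linear parts and the cross term cancel by `reg_swap_at_diagonal`, the one-point terms by
`reg_trapezoid`; the three-point terms are regular on the diagonal by themselves. -/
theorem regForm_swapTerm_diagonal (h : IsRegularAtRamification x y) (hwx : w ∉ badSet x)
    (hwy : w ∉ badSet y) (hy : (badSet y).Finite) : RegForm w (swapTerm x y w) := by
  have := h.finite.fintype
  have hφ := isFrame_chart w
  have hw := notMem_ramificationPoints hwx
  have ha := AnalyticAt.comp_const_add (analyticAt_vec hwx)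
  have hb := AnalyticAt.comp_const_add (analyticAt_vec hwy)
  have hc := analyticAt_mul_vec hwx hwy
  have hu := analyticAt_omega_one_one h hw
  set a := fun δ => vec x (w + δ)
  set b := fun δ => vec y (w + δ)
  set f := fun δ => omega x y 1 1 ![w + δ] * (a δ * b δ)
  set g := fun δ => omega x y 0 3 ![w + δ, w + δ, w] * (a δ * b δ)
  have hf : AnalyticAt ℂ f 0 := AnalyticAt.comp_const_add (hu.fun_mul hc)
  have hg : AnalyticAt ℂ g 0 :=
    AnalyticAt.comp_const_add ((analyticAt_omega_zero_three_diag h hw hw).fun_mul hc)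
  have hb0 : b 0 ≠ 0 := by simpa [b] using vec_ne_zero hwy
  have h2 := regForm_sum (Finset.univ : Finset (ramificationPoints x)) (q := w)
    (f := fun p z => 1 / 2 * (h.uniformizer p).coef *
        deriv (fun v => (h.uniformizer p).xi v * (h.uniformizer p).xi v * (vec x v * vec y v)) w *
        (h.uniformizer p).xi z) fun p _ =>
    regForm_of_analyticAt (analyticAt_const.mul (analyticAt_xi_uniformizer h hw p))
  have hmov : AnalyticAlong (chart w) (movingPotential x y w) := by
    filter_upwards [hφ.avoid _ h.finite_badSet, hφ.avoid _ hy,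
      hφ.avoid _ (Set.finite_singleton w)] with s h1 h2 h3
    exact analyticAt_movingPotential h hwx hwy h1 h2 h3
  have mB : MeromorphicAt (fun t : ℂ => (t ^ 2)⁻¹) 0 := ((MeromorphicAt.id 0).pow 2).inv
  have m1 : MeromorphicAt (fun t => f t * (t ^ 2)⁻¹) 0 := hf.meromorphicAt.fun_mul mB
  have m2 : MeromorphicAt (fun t => 1 / 2 * g t) 0 :=
    (MeromorphicAt.const _ 0).fun_mul hg.meromorphicAt
  have eM : (fun t => linearPart a b 0 (fun t => (t ^ 2)⁻¹) t +
        1 / 2 * (a t * b t * (deriv (fun δ => a δ * b δ) 0 * (t ^ 4)⁻¹ +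
          4 * (a 0 * b 0) * (t ^ 5)⁻¹))) =ᶠ[𝓝[≠] 0]
      fun t => movingPotential x y w (chart w t) + f t * (t ^ 2)⁻¹ + 1 / 2 * g t := by
    filter_upwards [eventually_ne_zero_nhdsNE] with t ht
    have e1 : ∀ t : ℂ, w - (w + t) = -t := fun t => by ring
    have e2 : (fun δ : ℂ => ((w - (w + δ)) ^ 2)⁻¹) = fun t => (t ^ 2)⁻¹ := by
      funext δ; rw [e1, neg_sq]
    have e3 : deriv (fun δ => a δ * b δ) 0 = deriv (fun v => vec x v * vec y v) w := by
      simp only [a, b]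
      rw [deriv_const_add (fun v => vec x v * vec y v)]
      simp only [add_zero]
    rw [chart_coe, movingPotential, linearPart_const_add, e2,
      crossTerm_eq hwx hwy (by simpa using ht), e3]
    simp only [e1, f, g, a, b, add_zero]
    rw [neg_sq, Odd.neg_pow (by decide)]
    field_simp
    ring
  refine (Reg.sub (((reg_swap_at_diagonal ha hb hb0).sub (reg_trapezoid hf)).sub
    (hg.reg.const_mul (1 / 2)).deriv) h2).congr ?_
  filter_upwards [hφ.deriv_eq hmov .rfl, deriv_eventuallyEq eM,
    hmov.eventually_analyticAt_comp hφ.coord, m1.eventually_analyticAt, m2.eventually_analyticAt,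
    eventually_chart_notMem w (finite_coe_preimage_ramificationPoints h.finite),
    eventually_chart_notMem w (Set.finite_singleton w), eventually_ne_zero_nhdsNE] with
    t d1 d2 a0 a1 a2 n1 n2 ht
  rw [((a0.differentiableAt.hasDerivAt.fun_add a1.differentiableAt.hasDerivAt).fun_add
    a2.differentiableAt.hasDerivAt).deriv] at d2
  have hβ := analyticAt_bergman ht
  have hp : deriv (fun v => polarPotential x y v (chart w t)) w =
      -deriv (fun δ => f δ * ((t - δ) ^ 2)⁻¹) 0 +
        deriv (linearPart a b 0 fun δ => ((t - δ) ^ 2)⁻¹) 0 := by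
    have e1 : deriv (fun v => polarPotential x y v (chart w t)) w =
        deriv (fun δ => polarPotential x y (w + δ) (chart w t)) 0 := by
      rw [deriv_const_add (fun v => polarPotential x y v (chart w t))]
      simp only [add_zero]
    have e2 : (fun δ => polarPotential x y (w + δ) (chart w t)) = fun δ =>
        -(f δ * ((t - δ) ^ 2)⁻¹) + linearPart a b 0 (fun δ => ((t - δ) ^ 2)⁻¹) δ := by
      have e3 : ∀ δ : ℂ, (w + δ - (w + t)) ^ 2 = (t - δ) ^ 2 := fun δ => by ring
      funext δ
      rw [polarPotential, chart_coe, linearPart_const_add]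
      simp only [e3, f, a, b]
      ring
    rw [e1, e2]
    exact ((hf.fun_mul hβ).differentiableAt.hasDerivAt.fun_neg.fun_add
      (analyticAt_linearPart ha hb hβ hb0).differentiableAt.hasDerivAt).deriv
  have hs : (∑ p : ramificationPoints x, 1 / 2 * (h.uniformizer p).coef *
        deriv (fun v => (h.uniformizer p).xi v * (h.uniformizer p).xi v * (vec x v * vec y v)) w *
        (h.uniformizer p).xi (chart w t)) * deriv (chart (w : OnePoint ℂ)) t =
      ∑ p : ramificationPoints x, 1 / 2 * (h.uniformizer p).coef *
        deriv (fun v => (h.uniformizer p).xi v * (h.uniformizer p).xi v * (vec x v * vec y v)) w *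
        (h.uniformizer p).xi (chart w t) := by rw [deriv_chart_coe, mul_one]
  rw [d2, ← d1, swapTerm, deriv_fixedPotential h hwx hwy n2 n1, hp, hs, deriv_chart_coe]
  ring

/-! ### The swap relation -/

theorem linearPart_add_swap {a b β : ℂ → ℂ} (ha : AnalyticAt ℂ a z) (hb : AnalyticAt ℂ b z)
    (hβ : AnalyticAt ℂ β z) (ha0 : a z ≠ 0) (hb0 : b z ≠ 0) :
    linearPart a b 0 β z + linearPart b a 0 β z =
      1 / 12 * (a z * b z * deriv (deriv (deriv fun s => a s * b s * β s)) z) +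
      deriv (genusOnePotential a b 0) z * (a z * b z * β z) := by
  have h1 := linearPart_add_swap_zero (AnalyticAt.comp_const_add ha) (AnalyticAt.comp_const_add hb)
    (AnalyticAt.comp_const_add hβ) (by simpa using ha0) (by simpa using hb0)
  have e := linearPart_const_add a b β z 0
  have e' := linearPart_const_add b a β z 0
  rw [add_zero] at e e'
  rw [e, e', h1]
  have e2 : genusOnePotential (fun δ => a (z + δ)) (fun δ => b (z + δ)) 0 =
      fun t => genusOnePotential a b 0 (z + t) :=
    funext fun t => (genusOnePotential_const_add a b z t).symm
  rw [e2, deriv_const_add (genusOnePotential a b 0), deriv_const_add (fun s => a s * b s * β s),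
    deriv_const_add (deriv fun s => a s * b s * β s),
    deriv_const_add (deriv (deriv fun s => a s * b s * β s))]
  simp only [add_zero]

end

section

variable {x y : RatFunc ℂ} {w z : ℂ}

theorem crossTerm_comm (x y : RatFunc ℂ) (w z : ℂ) : crossTerm x y w z = crossTerm y x w z := by
  simp only [crossTerm, mul_comm (vec x _)]

/-- The exchange relations remove the third derivative and the genus-one potential from
`linearPart_add_swap`. Of the cross term, two halves come from the two potentials and one half is
subtracted by the three-point relation. -/
theorem movingPotential_add_swap (h : IsSpectralCurve x y) (hwx : w ∉ badSet x)
    (hwy : w ∉ badSet y) (hx : z ∉ badSet x) (hy : z ∉ badSet y) (hz : z ≠ w) :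
    movingPotential x y w z + movingPotential y x w z =
      1 / 2 * (vec x z * vec y z * crossTerm x y w z) := by
  have h1 := linearPart_add_swap (analyticAt_vec hx) (analyticAt_vec hy)
    (analyticAt_bergmanKernel hz) (vec_ne_zero hx) (vec_ne_zero hy)
  have h2 := h.omega_one_one_add_swap hx hy
  have h3 := h.omega_zero_three_add_swap hx hy hwx hwy hz.symm
  have e1 : deriv (fun v => (((z - v) ^ 2)⁻¹ * ((z - v) ^ 2)⁻¹) * (vec x v * vec y v)) w =
      crossTerm x y w z := by
    rw [crossTerm]
    congr 1
    funext v
    rw [show (z - v) ^ 2 = (v - z) ^ 2 by ring]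
  have e2 : deriv (fun v => deriv (fun v => deriv
      (fun v => vec x v * vec y v * ((v - w) ^ 2)⁻¹) v) v) z =
      deriv (deriv (deriv fun s => vec x s * vec y s * ((w - s) ^ 2)⁻¹)) z := by
    have : (fun v => vec x v * vec y v * ((v - w) ^ 2)⁻¹) =
        fun s => vec x s * vec y s * ((w - s) ^ 2)⁻¹ := by
      funext v
      rw [show (v - w) ^ 2 = (w - v) ^ 2 by ring]
    rw [this]
  rw [e1, e2] at h3
  rw [movingPotential, movingPotential, ← crossTerm_comm x y]
  linear_combination h1 - vec x z * vec y z * ((w - z) ^ 2)⁻¹ * h2 -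
    1 / 2 * vec x z * vec y z * h3

/-- As for the moving potential, but no cross term is built in, so only the negative half remains.
-/
theorem fixedPotential_add_swap (h : IsSpectralCurve x y) (hwx : w ∉ badSet x)
    (hwy : w ∉ badSet y) (hx : z ∉ badSet x) (hy : z ∉ badSet y) (hz : z ≠ w) :
    fixedPotential x y z w + fixedPotential y x z w =
      -(1 / 2) * (vec x w * vec y w * crossTerm x y z w) := by
  have hB : AnalyticAt ℂ (fun v => ((v - z) ^ 2)⁻¹) w :=
    AnalyticAt.inv (by fun_prop) (pow_ne_zero 2 (sub_ne_zero.2 hz.symm))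
  have h1 := linearPart_add_swap (analyticAt_vec hwx) (analyticAt_vec hwy) hB
    (vec_ne_zero hwx) (vec_ne_zero hwy)
  have h2 := h.omega_one_one_add_swap hwx hwy
  have h3 := h.omega_zero_three_add_swap hwx hwy hx hy hz
  have e1 : deriv (fun v => (((w - v) ^ 2)⁻¹ * ((w - v) ^ 2)⁻¹) * (vec x v * vec y v)) z =
      crossTerm x y z w := by
    rw [crossTerm]
    congr 1
    funext v
    rw [show (w - v) ^ 2 = (v - w) ^ 2 by ring]
  have e2 : deriv (fun v => deriv (fun v => deriv
      (fun v => vec x v * vec y v * ((v - z) ^ 2)⁻¹) v) v) w =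
      deriv (deriv (deriv fun s => vec x s * vec y s * ((s - z) ^ 2)⁻¹)) w := rfl
  rw [e1, e2] at h3
  rw [fixedPotential, fixedPotential]
  linear_combination h1 - vec x w * vec y w * ((w - z) ^ 2)⁻¹ * h2 -
    1 / 2 * vec x w * vec y w * h3

theorem eventually_notMem_badSet {f : RatFunc ℂ} (hf : (badSet f).Finite) (hz : z ∉ badSet f) :
    ∀ᶠ u in 𝓝 z, u ∉ badSet f := hf.isClosed.isOpen_compl.mem_nhds hz

/-- The mixed partial derivative of (ab)(z) (ab)(w) (w - z)⁻⁴, written out so that its symmetry in z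
and w can be read off. -/
theorem deriv_mul_crossTerm (hwx : w ∉ badSet x) (hwy : w ∉ badSet y) (hx : z ∉ badSet x)
    (hy : z ∉ badSet y) (hz : z ≠ w) :
    deriv (fun z => vec x z * vec y z * crossTerm x y w z) z =
      deriv (fun v => vec x v * vec y v) z * deriv (fun v => vec x v * vec y v) w *
        ((w - z) ^ 4)⁻¹ +
      4 * (vec x z * vec y z * deriv (fun v => vec x v * vec y v) w -
        deriv (fun v => vec x v * vec y v) z * (vec x w * vec y w)) * ((w - z) ^ 5)⁻¹ -
      20 * (vec x z * vec y z) * (vec x w * vec y w) * ((w - z) ^ 6)⁻¹ := by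
  set c' := deriv (fun v => vec x v * vec y v) w
  have e : (fun z => vec x z * vec y z * crossTerm x y w z) =ᶠ[𝓝 z] fun z =>
      vec x z * vec y z * (((w - z) ^ 2)⁻¹ *
      (c' * ((w - z) ^ 2)⁻¹ - 4 * (vec x w * vec y w) * ((w - z) ^ 3)⁻¹)) := by
    filter_upwards [isOpen_ne.mem_nhds hz] with u hu
    rw [crossTerm_eq hwx hwy hu]
  have h1 : w - z ≠ 0 := sub_ne_zero.2 hz.symm
  have h2 := ((hasDerivAt_id' z).const_sub w).fun_pow 2 |>.fun_inv (pow_ne_zero 2 h1)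
  have h3 := ((hasDerivAt_id' z).const_sub w).fun_pow 3 |>.fun_inv (pow_ne_zero 3 h1)
  have h4 := (analyticAt_mul_vec hx hy).differentiableAt.hasDerivAt
  rw [e.deriv_eq, (h4.fun_mul (h2.fun_mul ((h2.const_mul c').fun_sub
    (h3.const_mul (4 * (vec x w * vec y w)))))).deriv]
  push_cast
  field_simp
  ring

/-- The two surviving cross terms are the same mixed derivative, taken in the two orders and with
opposite signs. -/
theorem swapTerm_add_swap (h : IsSpectralCurve x y) (hwx : w ∉ badSet x)
    (hwy : w ∉ badSet y) (hx : z ∉ badSet x) (hy : z ∉ badSet y) (hz : z ≠ w) :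
    swapTerm x y w z + swapTerm y x w z = 0 := by
  have fx := h.left.finite_badSet
  have fy := h.right.finite_badSet
  have hzx := notMem_ramificationPoints hx
  have hzy := notMem_ramificationPoints hy
  have e1 : (fun u => movingPotential x y w u + movingPotential y x w u) =ᶠ[𝓝 z]
      fun u => 1 / 2 * (vec x u * vec y u * crossTerm x y w u) := by
    filter_upwards [eventually_notMem_badSet fx hx, eventually_notMem_badSet fy hy,
      isOpen_ne.mem_nhds hz] with u h1 h2 h3
    exact movingPotential_add_swap h hwx hwy h1 h2 h3
  have e2 : (fun v => fixedPotential x y z v + fixedPotential y x z v) =ᶠ[𝓝 w]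
      fun v => -(1 / 2) * (vec x v * vec y v * crossTerm x y z v) := by
    filter_upwards [eventually_notMem_badSet fx hwx, eventually_notMem_badSet fy hwy,
      isOpen_ne.mem_nhds hz.symm] with u h1 h2 h3
    exact fixedPotential_add_swap h h1 h2 hx hy h3.symm
  have d1 := ((analyticAt_movingPotential h.left hwx hwy hx hy hz).differentiableAt.hasDerivAt.fun_add
    (analyticAt_movingPotential h.right hwy hwx hy hx hz).differentiableAt.hasDerivAt).deriv
  have d2 := ((analyticAt_fixedPotential h.left hwx hwy hz hzx).differentiableAt.hasDerivAt.fun_add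
    (analyticAt_fixedPotential h.right hwy hwx hz hzy).differentiableAt.hasDerivAt).deriv
  have c1 := (analyticAt_mul_vec hx hy).fun_mul (analyticAt_crossTerm hwx hwy hz)
  have c2 := (analyticAt_mul_vec hwx hwy).fun_mul (analyticAt_crossTerm hx hy hz.symm)
  rw [e1.deriv_eq, deriv_const_mul _ c1.differentiableAt,
    deriv_mul_crossTerm hwx hwy hx hy hz] at d1
  rw [e2.deriv_eq, deriv_const_mul _ c2.differentiableAt,
    deriv_mul_crossTerm hx hy hwx hwy hz.symm] at d2
  have p4 : (z - w) ^ 4 = (w - z) ^ 4 := by ring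
  have p5 : (z - w) ^ 5 = -(w - z) ^ 5 := by ring
  have p6 : (z - w) ^ 6 = (w - z) ^ 6 := by ring
  rw [p4, p5, p6, inv_neg] at d2
  rw [swapTerm, swapTerm]
  linear_combination -d1 - d2

/-- The swap relation for the genus-one two-point functions, in terms of the global coordinate. -/
theorem IsSpectralCurve.omega_one_two_swap (h : IsSpectralCurve x y) (hwx : w ∉ badSet x)
    (hwy : w ∉ badSet y) (hx : z ∉ badSet x) (hy : z ∉ badSet y) (hz : z ≠ w) :
    omega y x 1 2 ![w, z] = omega x y 1 2 ![w, z] + swapTerm x y w z := by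
  have fx := h.left.finite_badSet
  have fy := h.right.finite_badSet
  have rx := notMem_ramificationPoints hwx
  have ry := notMem_ramificationPoints hwy
  have left : ∀ {x y : RatFunc ℂ}, IsSpectralCurve x y → w ∉ badSet x → w ∉ badSet y →
      ∀ p ∈ ramificationPoints x,
      RegForm p fun z => omega x y 1 2 ![w, z] + swapTerm x y w z := fun h hwx hwy p hp =>
    (h.left.uniformizer ⟨p, hp⟩).regForm (f := fun z => omega _ _ 1 2 ![w, z] + swapTerm _ _ w z)
      (reg_omega_one_two_add_swapTerm h.left h.right.finite_badSet hwx hwy ⟨p, hp⟩)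
  have hreg : ∀ p, RegForm p fun z =>
      omega y x 1 2 ![w, z] - (omega x y 1 2 ![w, z] + swapTerm x y w z) := by
    intro p
    by_cases hpx : p ∈ ramificationPoints x
    · have h1 := left h hwx hwy p hpx
      have h2 := regForm_omega_one_two ry (h.left.disjoint p hpx) h.right
      exact (Reg.sub h2 h1).congr (Eventually.of_forall fun s => by ring)
    by_cases hpy : p ∈ ramificationPoints y
    -- At a zero of dy the curve with x and y exchanged is used; the antisymmetry of the correction
    -- brings the result back.
    · have h1 := left h.symm hwy hwx p hpy
      have h2 := regForm_omega_one_two rx hpx h.left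
      refine (Reg.sub h1 h2).congr ?_
      filter_upwards [eventually_chart_notMem p fx, eventually_chart_notMem p fy,
        eventually_chart_notMem p (Set.finite_singleton w)] with s n1 n2 n3
      have h3 := swapTerm_add_swap h hwx hwy n1 n2 n3
      linear_combination -deriv (chart p) s * h3
    · have h1 := regForm_omega_one_two rx hpx h.left
      have h2 := regForm_omega_one_two ry hpy h.right
      have h3 : RegForm p (swapTerm x y w) := by
        by_cases hpw : p = w
        · rw [hpw]
          exact regForm_swapTerm_diagonal h.left hwx hwy fy
        · exact regForm_swapTerm h.left hwx hwy fy hpx hpy hpw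
      exact (Reg.sub h2 (Reg.add h1 h3)).congr (Eventually.of_forall fun s => by ring)
  -- Continuity in z of the derivative in w is read off from `deriv_fixedPotential`.
  have hs : ContinuousAt (swapTerm x y w) z := by
    have := h.left.finite.fintype
    have h1 := (analyticAt_movingPotential h.left hwx hwy hx hy hz).deriv
    have h2 := (isPolar_polarPotential h.left hwx hwy).deriv.analyticAt hz
    have h3 : AnalyticAt ℂ (fun z => ∑ p : ramificationPoints x,
        1 / 2 * (h.left.uniformizer p).coef * deriv (fun v => (h.left.uniformizer p).xi v *
          (h.left.uniformizer p).xi v * (vec x v * vec y v)) w * (h.left.uniformizer p).xi z) z :=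
      Finset.analyticAt_fun_sum _ fun p _ => analyticAt_const.mul
        (analyticAt_xi_uniformizer h.left (notMem_ramificationPoints hx) p)
    refine ((h1.fun_add (h2.fun_sub h3)).continuousAt).congr ?_
    filter_upwards [isOpen_ne.mem_nhds hz,
      eventually_notMem_ramificationPoints h.left (notMem_ramificationPoints hx)] with u h4 h5
    rw [swapTerm, deriv_fixedPotential h.left hwx hwy h4 h5]
  have hc := (analyticAt_omega_one_two ry (notMem_ramificationPoints hy) h.right).continuousAt.sub
    ((analyticAt_omega_one_two rx (notMem_ramificationPoints hx) h.left).continuousAt.add hs)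
  exact sub_eq_zero.1 (eq_zero_of_regForm hreg hc)

end

/-! ### Passing to the coordinate `y` -/

section

variable {x y : RatFunc ℂ}

/-- The double and simple poles of the two kernels cancel; the constant term is -{F, t}/(6F'²) at 0,
which is `diagTerm` for 1/F'. -/
theorem tendsto_regularized_kernel {F : ℂ → ℂ} (hF : AnalyticAt ℂ F 0) (h : deriv F 0 ≠ 0) :
    Tendsto (fun t => (t ^ 2)⁻¹ * ((deriv F 0)⁻¹ * (deriv F t)⁻¹) - ((F 0 - F t) ^ 2)⁻¹) (𝓝[≠] 0)
      (𝓝 (diagTerm (fun t => (deriv F t)⁻¹) 0 0)) := by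
  obtain ⟨n2, n3, n4, n5, n6, j1, j2⟩ := exists_jets_of_deriv_ne_zero hF h
  have k1 := j1.inv_smul h
  have k2 := j2.inv_smul h
  have ha : AnalyticAt ℂ (fun t => (deriv F t)⁻¹) 0 := hF.deriv.inv h
  have d1 := tendsto_nhds_unique (k2.deriv.unshift (by simp [Jet.deriv])).choose_spec.tendsto_zero
    (ha.deriv.continuousAt.tendsto.mono_left nhdsWithin_le_nhds)
  have d2 := tendsto_nhds_unique ((k2.deriv.unshift (by simp [Jet.deriv])).choose_spec.deriv.unshift
    (by simp [Jet.deriv])).choose_spec.tendsto_zero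
    (ha.deriv.deriv.continuousAt.tendsto.mono_left nhdsWithin_le_nhds)
  have k3 := ((HasJet.inv_pow 2).mul (k2.smul (deriv F 0)⁻¹)).sub ((HasJet.inv_pow 2).mul (k1.mul k1))
  obtain ⟨_, k4⟩ := k3.unshift (by simp [Jet.add, Jet.smul, Jet.mul])
  obtain ⟨_, k5⟩ := k4.unshift (by simp [Jet.add, Jet.smul, Jet.mul]; ring)
  refine (k5.tendsto_zero.congr fun t => ?_).trans_eq ?_
  · have e : F 0 - F t = -(t * dslope F 0 t) := by rw [eq_add_mul_dslope F t]; ring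
    rw [e, neg_sq, mul_pow, mul_inv, sq (dslope F 0 t), mul_inv]
  · congr 1
    rw [diagTerm, ← d1, ← d2]
    simp only [Jet.add, Jet.smul, Jet.mul, Jet.deriv, Pi.zero_apply]
    push_cast
    ring

theorem whatDiag_eq {z : ℂ} (hz : z ∉ badSet x) : WhatDiag x y z = diagTerm (vec x) 0 z := by
  have hx : AnalyticAt ℂ (ev x) z := analyticAt_ev fun h => hz (.inl h)
  have h1 := tendsto_regularized_kernel (AnalyticAt.comp_const_add hx)
    (by rw [deriv_const_add (ev x)]; simpa using fun h => hz (.inr h))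
  have e : diagTerm (fun t => (deriv (fun t => ev x (z + t)) t)⁻¹) 0 0 = diagTerm (vec x) 0 z := by
    have e1 : (fun t => (deriv (fun t => ev x (z + t)) t)⁻¹) = fun t => vec x (z + t) := by
      rw [deriv_const_add (ev x)]; rfl
    rw [e1]
    simp only [diagTerm, deriv_const_add (vec x), deriv_const_add (deriv (vec x)), Pi.zero_apply,
      add_zero]
  rw [e] at h1
  have h2 : Tendsto (fun u => u - z) (𝓝[≠] z) (𝓝[≠] 0) := by
    refine tendsto_nhdsWithin_iff.2 ⟨?_, ?_⟩
    · have : Tendsto (fun u : ℂ => u - z) (𝓝 z) (𝓝 (z - z)) := (continuous_sub_right z).tendsto z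
      rw [sub_self] at this
      exact this.mono_left nhdsWithin_le_nhds
    · filter_upwards [self_mem_nhdsWithin] with u hu
      exact sub_ne_zero.2 hu
  refine ((h1.comp h2).congr fun u => ?_).limUnder_eq
  simp only [Function.comp, deriv_const_add (ev x), add_zero, add_sub_cancel, W, omega_zero_two,
    Fin.prod_univ_two, Matrix.cons_val_zero, Matrix.cons_val_one, div_eq_mul_inv, mul_inv,
    one_mul]
  rw [← neg_sub z u, neg_sq]

namespace IsInverseBranch

variable {U : Set ℂ} {ζ : ℂ → ℂ} {u : ℂ}

theorem notMem_badSet_left (h : IsInverseBranch x y U ζ) (hu : u ∈ U) : ζ u ∉ badSet x :=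
  fun h' => h'.elim (h.finite_x u hu) (h.unramified u hu)

theorem analyticAt (h : IsInverseBranch x y U ζ) (hu : u ∈ U) : AnalyticAt ℂ ζ u :=
  h.holomorphic.analyticAt (h.isOpen.mem_nhds hu)

theorem deriv_mul_deriv (h : IsInverseBranch x y U ζ) (hu : u ∈ U) :
    deriv (ev y) (ζ u) * deriv ζ u = 1 := by
  rw [← (hasDerivAt_comp_of_analyticAt (analyticAt_ev (h.finite_y u hu)) (h.analyticAt hu)).deriv]
  have e : (fun u => ev y (ζ u)) =ᶠ[𝓝 u] fun u => u := by
    filter_upwards [h.isOpen.mem_nhds hu] with v hv using h.right_inv v hv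
  rw [e.deriv_eq, deriv_id'']

theorem notMem_badSet_right (h : IsInverseBranch x y U ζ) (hu : u ∈ U) : ζ u ∉ badSet y :=
  fun h' => h'.elim (h.finite_y u hu) fun h0 => by
    simpa [h0] using h.deriv_mul_deriv hu

theorem deriv_eq (h : IsInverseBranch x y U ζ) (hu : u ∈ U) : deriv ζ u = vec y (ζ u) :=
  eq_inv_of_mul_eq_one_right (h.deriv_mul_deriv hu)

/-- Along the branch d/dy is the vector field 1/dy. The equality holds on a neighbourhood so that it
can be iterated for higher derivatives. -/
theorem deriv_comp (h : IsInverseBranch x y U ζ) (hu : u ∈ U) {F g : ℂ → ℂ}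
    (hg : AnalyticAt ℂ g (ζ u)) (e : F =ᶠ[𝓝 u] fun u => g (ζ u)) :
    deriv F =ᶠ[𝓝 u] fun u => vec y (ζ u) * deriv g (ζ u) := by
  filter_upwards [e.deriv, h.isOpen.mem_nhds hu,
    (h.analyticAt hu).continuousAt.eventually hg.eventually_analyticAt] with v h1 h2 h3
  rw [h1, (hasDerivAt_comp_of_analyticAt h3 (h.analyticAt h2)).deriv, h.deriv_eq h2, mul_comm]

theorem deriv_X (h : IsInverseBranch x y U ζ) (hu : u ∈ U) :
    deriv (fun u => ev x (ζ u)) u = deriv (ev x) (ζ u) * vec y (ζ u) := by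
  rw [(hasDerivAt_comp_of_analyticAt (analyticAt_ev (h.finite_x u hu)) (h.analyticAt hu)).deriv,
    h.deriv_eq hu]

/-- The terms of the swap formula with derivatives in one variable only. -/
theorem sum_terms (h : IsInverseBranch x y U ζ) (hx : IsRegularAtRamification x y)
    (hu : u ∈ U) {z : ℂ} (hz : z ≠ ζ u) (hzx : z ∉ badSet x) (D : ℂ) :
    -deriv (fun u => deriv (fun u => ev x (ζ u)) u * D * W x y 1 1 ![ζ u] * W x y 0 2 ![ζ u, z]) u -
      1 / 2 * deriv (fun u => deriv (fun u => ev x (ζ u)) u * D * W x y 0 3 ![ζ u, ζ u, z]) u +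
      1 / 2 * iteratedDeriv 2 (fun u => deriv (fun u => ev x (ζ u)) u * D *
        WhatDiag x y (ζ u) * W x y 0 2 ![ζ u, z]) u +
      1 / 24 * iteratedDeriv 3 (fun u => (1 / deriv (fun u => ev x (ζ u)) u) ^ 2 *
        deriv (fun u' => deriv (fun u => ev x (ζ u)) u' * D * W x y 0 2 ![ζ u', z]) u) u =
      D * vec x z * (vec y (ζ u) * deriv (fixedPotential x y z) (ζ u)) := by
  have ha := analyticAt_vec (h.notMem_badSet_left hu)
  have hb := analyticAt_vec (h.notMem_badSet_right hu)
  have hb0 := vec_ne_zero (h.notMem_badSet_right hu)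
  have hβ : AnalyticAt ℂ (fun v => ((v - z) ^ 2)⁻¹) (ζ u) :=
    AnalyticAt.inv (by fun_prop) (pow_ne_zero 2 (sub_ne_zero.2 hz.symm))
  have hω1 := analyticAt_omega_one_one hx (notMem_ramificationPoints (h.notMem_badSet_left hu))
  have hω3 := analyticAt_omega_zero_three_diag hx (notMem_ramificationPoints hzx)
    (notMem_ramificationPoints (h.notMem_badSet_left hu))
  have hd : AnalyticAt ℂ (diagTerm (vec x) 0) (ζ u) := by
    have := ha.deriv
    have := ha.deriv.deriv
    unfold diagTerm
    simp only [Pi.zero_apply]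
    fun_prop
  have hbi := hb.inv hb0
  set c := D * vec x z with hc
  have g1 : AnalyticAt ℂ (fun v => omega x y 1 1 ![v] * (vec x v * vec y v) * ((v - z) ^ 2)⁻¹)
    (ζ u) := by fun_prop
  have g2 : AnalyticAt ℂ (fun v => omega x y 0 3 ![v, v, z] * (vec x v * vec y v)) (ζ u) := by
    fun_prop
  have g3 : AnalyticAt ℂ (fun v => diagTerm (vec x) 0 v * vec y v * ((v - z) ^ 2)⁻¹) (ζ u) := by
    fun_prop
  have g3' := hb.fun_mul g3.deriv
  have g4 : AnalyticAt ℂ (fun v => vec y v * ((v - z) ^ 2)⁻¹) (ζ u) := by fun_prop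
  have g5 : AnalyticAt ℂ (fun v => vec x v * vec x v * (deriv (fun v => ((v - z) ^ 2)⁻¹) v +
      deriv (vec y) v * (vec y v)⁻¹ * ((v - z) ^ 2)⁻¹)) (ζ u) :=
    (ha.mul ha).mul (hβ.deriv.add ((hb.deriv.mul hbi).mul hβ))
  have g5' := hb.fun_mul g5.deriv
  have g5'' := hb.fun_mul g5'.deriv
  have hmem := h.isOpen.mem_nhds hu
  have hne : ∀ᶠ v in 𝓝 u, ζ v ≠ z := (h.analyticAt hu).continuousAt.eventually_ne hz.symm
  have e1 : (fun u => deriv (fun u => ev x (ζ u)) u * D * W x y 1 1 ![ζ u] *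
      W x y 0 2 ![ζ u, z]) =ᶠ[𝓝 u] fun u => c * (omega x y 1 1 ![ζ u] *
        (vec x (ζ u) * vec y (ζ u)) * ((ζ u - z) ^ 2)⁻¹) := by
    filter_upwards [hmem] with v hv
    have n := h.unramified v hv
    rw [h.deriv_X hv]
    simp [W, omega_zero_two, vec, hc]
    field_simp
  have e2 : (fun u => deriv (fun u => ev x (ζ u)) u * D * W x y 0 3 ![ζ u, ζ u, z]) =ᶠ[𝓝 u]
      fun u => c * (omega x y 0 3 ![ζ u, ζ u, z] * (vec x (ζ u) * vec y (ζ u))) := by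
    filter_upwards [hmem] with v hv
    have n := h.unramified v hv
    rw [h.deriv_X hv]
    simp [W, vec, hc, Fin.prod_univ_three]
    field_simp
  have e3 : (fun u => deriv (fun u => ev x (ζ u)) u * D * WhatDiag x y (ζ u) *
      W x y 0 2 ![ζ u, z]) =ᶠ[𝓝 u] fun u => c * (diagTerm (vec x) 0 (ζ u) * vec y (ζ u) *
        ((ζ u - z) ^ 2)⁻¹) := by
    filter_upwards [hmem] with v hv
    have n := h.unramified v hv
    rw [h.deriv_X hv, whatDiag_eq (h.notMem_badSet_left hv)]
    simp [W, omega_zero_two, vec, hc]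
    field_simp
  have e4 : (fun u => deriv (fun u => ev x (ζ u)) u * D * W x y 0 2 ![ζ u, z]) =ᶠ[𝓝 u]
      fun u => c * (vec y (ζ u) * ((ζ u - z) ^ 2)⁻¹) := by
    filter_upwards [hmem] with v hv
    have n := h.unramified v hv
    rw [h.deriv_X hv]
    simp [W, omega_zero_two, vec, hc]
    field_simp
  -- Here (dy/dX)² = (a/b)² and the inner derivative is b (bβ)', which gives the expression a²(β' +
  -- b'β/b) of `linearPart`.
  have e5 : (fun u => (1 / deriv (fun u => ev x (ζ u)) u) ^ 2 *
        deriv (fun u' => deriv (fun u => ev x (ζ u)) u' * D * W x y 0 2 ![ζ u', z]) u) =ᶠ[𝓝 u]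
      fun u => c * (vec x (ζ u) * vec x (ζ u) * (deriv (fun v => ((v - z) ^ 2)⁻¹) (ζ u) +
        deriv (vec y) (ζ u) * (vec y (ζ u))⁻¹ * ((ζ u - z) ^ 2)⁻¹)) := by
    filter_upwards [hmem, hne, h.deriv_comp hu ((analyticAt_const (v := c)).fun_mul g4) e4]
      with v hv hv' h4
    have n := h.unramified v hv
    have nb := vec_ne_zero (h.notMem_badSet_right hv)
    have hb' := (analyticAt_vec (h.notMem_badSet_right hv)).differentiableAt.hasDerivAt
    have hβ' : AnalyticAt ℂ (fun v => ((v - z) ^ 2)⁻¹) (ζ v) :=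
      AnalyticAt.inv (by fun_prop) (pow_ne_zero 2 (sub_ne_zero.2 hv'))
    rw [h4, h.deriv_X hv,
      ((hb'.fun_mul hβ'.differentiableAt.hasDerivAt).const_mul c).deriv]
    have ny : deriv (ev y) (ζ v) ≠ 0 := fun h0 => nb (by rw [vec, h0, inv_zero])
    generalize deriv (fun v => ((v - z) ^ 2)⁻¹) (ζ v) = β'
    simp only [vec]
    field_simp
    ring
  -- Each use replaces one d/dy by b d/dz and carries the constant factor of the other point along.
  have hm : ∀ {F g : ℂ → ℂ}, AnalyticAt ℂ g (ζ u) → F =ᶠ[𝓝 u] (fun u => c * g (ζ u)) →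
      deriv F =ᶠ[𝓝 u] fun u => c * (vec y (ζ u) * deriv g (ζ u)) := fun {F g} hg e => by
    refine (h.deriv_comp hu ((analyticAt_const (v := c)).fun_mul hg) e).trans ?_
    filter_upwards with v
    rw [deriv_const_mul_field]
    ring
  have t1 := (hm g1 e1).self_of_nhds
  have t2 := (hm g2 e2).self_of_nhds
  have t3 := (hm g3' (hm g3 e3)).self_of_nhds
  have t5 := (hm g5'' (hm g5' (hm g5 e5))).self_of_nhds
  have hp : deriv (fixedPotential x y z) (ζ u) = _ :=
    (((g1.differentiableAt.hasDerivAt.fun_neg).fun_sub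
      (g2.differentiableAt.hasDerivAt.const_mul (1 / 2))).fun_add
      (((g3'.differentiableAt.hasDerivAt.const_mul (1 / 2))).fun_add
        (g5''.differentiableAt.hasDerivAt.const_mul (1 / 24)))).deriv
  rw [iteratedDeriv_succ, iteratedDeriv_one, iteratedDeriv_succ, iteratedDeriv_succ,
    iteratedDeriv_one, t1, t2, t3, t5, hp]
  ring

/-- The term of the swap formula with a mixed derivative. -/
theorem mixed_term {U₂ : Set ℂ} {ζ₂ : ℂ → ℂ} {v : ℂ} (h : IsInverseBranch x y U ζ)
    (h₂ : IsInverseBranch x y U₂ ζ₂) (hu : u ∈ U) (hv : v ∈ U₂) (hne : ∀ u ∈ U, ζ u ≠ ζ₂ v) :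
    deriv (fun u => deriv (fun v => deriv (fun u => ev x (ζ u)) u * deriv (fun v => ev x (ζ₂ v)) v *
      W x y 0 2 ![ζ u, ζ₂ v] * W x y 0 2 ![ζ u, ζ₂ v]) v) u =
      vec y (ζ u) * vec y (ζ₂ v) *
        deriv (fun w => vec x w * vec y w * crossTerm x y (ζ₂ v) w) (ζ u) := by
  have hc := analyticAt_mul_vec (h₂.notMem_badSet_left hv) (h₂.notMem_badSet_right hv)
  have e : (fun u => deriv (fun v => deriv (fun u => ev x (ζ u)) u * deriv (fun v => ev x (ζ₂ v)) v *
      W x y 0 2 ![ζ u, ζ₂ v] * W x y 0 2 ![ζ u, ζ₂ v]) v) =ᶠ[𝓝 u] fun u =>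
      vec y (ζ₂ v) * (vec x (ζ u) * vec y (ζ u) * crossTerm x y (ζ₂ v) (ζ u)) := by
    filter_upwards [h.isOpen.mem_nhds hu] with s hs
    have n := h.unramified s hs
    have e1 : (fun v => deriv (fun u => ev x (ζ u)) s * deriv (fun v => ev x (ζ₂ v)) v *
        W x y 0 2 ![ζ s, ζ₂ v] * W x y 0 2 ![ζ s, ζ₂ v]) =ᶠ[𝓝 v] fun v =>
        vec x (ζ s) * vec y (ζ s) * ((((ζ₂ v - ζ s) ^ 2)⁻¹ * ((ζ₂ v - ζ s) ^ 2)⁻¹) *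
          (vec x (ζ₂ v) * vec y (ζ₂ v))) := by
      filter_upwards [h₂.isOpen.mem_nhds hv] with t ht
      have n' := h₂.unramified t ht
      rw [h.deriv_X hs, h₂.deriv_X ht, ← neg_sub (ζ s) (ζ₂ t), neg_sq]
      simp [W, omega_zero_two, vec]
      field_simp
    have hβ : AnalyticAt ℂ (fun v => ((v - ζ s) ^ 2)⁻¹) (ζ₂ v) :=
      AnalyticAt.inv (by fun_prop) (pow_ne_zero 2 (sub_ne_zero.2 (hne s hs).symm))
    refine (h₂.deriv_comp hv (analyticAt_const.fun_mul ((hβ.fun_mul hβ).fun_mul hc))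
      e1).self_of_nhds.trans ?_
    dsimp only
    rw [deriv_const_mul_field, crossTerm]
  have ha := (analyticAt_mul_vec (h.notMem_badSet_left hu) (h.notMem_badSet_right hu)).fun_mul
    (analyticAt_crossTerm (h₂.notMem_badSet_left hv) (h₂.notMem_badSet_right hv) (hne u hu))
  refine (h.deriv_comp hu (analyticAt_const.fun_mul ha) e).self_of_nhds.trans ?_
  dsimp only
  rw [deriv_const_mul_field]
  ring

end IsInverseBranch

theorem movingPotential_eq (x y : RatFunc ℂ) (w z : ℂ) :
    movingPotential x y w z =
      fixedPotential x y w z + 1 / 2 * (vec x z * vec y z * crossTerm x y w z) := by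
  have e : ∀ v, (w - v) ^ 2 = (v - w) ^ 2 := fun v => by ring
  simp only [movingPotential, fixedPotential, e]

/-- The cross term was attached to the moving point only; symmetry of the mixed derivative puts the
correction into the form of the proposition. -/
theorem swapTerm_eq {w z : ℂ} (h : IsRegularAtRamification x y) (hwx : w ∉ badSet x)
    (hwy : w ∉ badSet y) (hx : z ∉ badSet x) (hy : z ∉ badSet y) (hz : z ≠ w) :
    swapTerm x y w z = deriv (fixedPotential x y z) w + deriv (fixedPotential x y w) z +
      1 / 2 * deriv (fun v => vec x v * vec y v * crossTerm x y z v) w := by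
  have h1 := analyticAt_fixedPotential h hx hy hz.symm (notMem_ramificationPoints hwx)
  have h2 := (analyticAt_mul_vec hx hy).fun_mul (analyticAt_crossTerm hwx hwy hz)
  rw [swapTerm, funext (movingPotential_eq x y w),
    (h1.differentiableAt.hasDerivAt.fun_add
      (h2.differentiableAt.hasDerivAt.const_mul (1 / 2))).deriv,
    deriv_mul_crossTerm hwx hwy hx hy hz, deriv_mul_crossTerm hx hy hwx hwy hz.symm]
  have p4 : (z - w) ^ 4 = (w - z) ^ 4 := by ring
  have p5 : (z - w) ^ 5 = -(w - z) ^ 5 := by ring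
  have p6 : (z - w) ^ 6 = (w - z) ^ 6 := by ring
  rw [p4, p5, p6, inv_neg]
  ring

end

end

end XYSwap

/-! ### The formula for the correlators `W` -/

theorem mainTheorem6 (x y : RatFunc ℂ) (hxy : XYSwap.IsSpectralCurve x y)
    (U₁ U₂ : Set ℂ) (ζ₁ ζ₂ : ℂ → ℂ)
    (hζ₁ : XYSwap.IsInverseBranch x y U₁ ζ₁) (hζ₂ : XYSwap.IsInverseBranch x y U₂ ζ₂)
    (hne : ∀ u ∈ U₁, ∀ v ∈ U₂, ζ₁ u ≠ ζ₂ v)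
    (X₁ X₂ : ℂ → ℂ) (hX₁ : X₁ = fun u => XYSwap.ev x (ζ₁ u))
    (hX₂ : X₂ = fun v => XYSwap.ev x (ζ₂ v))
    (y₁ : ℂ) (hy₁ : y₁ ∈ U₁) (y₂ : ℂ) (hy₂ : y₂ ∈ U₂) :
    XYSwap.W y x 1 2 ![ζ₁ y₁, ζ₂ y₂] =
      deriv X₁ y₁ * deriv X₂ y₂ * XYSwap.W x y 1 2 ![ζ₁ y₁, ζ₂ y₂]
      - deriv (fun u => deriv X₁ u * deriv X₂ y₂ *
          XYSwap.W x y 1 1 ![ζ₁ u] * XYSwap.W x y 0 2 ![ζ₁ u, ζ₂ y₂]) y₁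
      - deriv (fun v => deriv X₁ y₁ * deriv X₂ v *
          XYSwap.W x y 1 1 ![ζ₂ v] * XYSwap.W x y 0 2 ![ζ₁ y₁, ζ₂ v]) y₂
      - 1 / 2 * deriv (fun u => deriv X₁ u * deriv X₂ y₂ *
          XYSwap.W x y 0 3 ![ζ₁ u, ζ₁ u, ζ₂ y₂]) y₁
      - 1 / 2 * deriv (fun v => deriv X₁ y₁ * deriv X₂ v *
          XYSwap.W x y 0 3 ![ζ₂ v, ζ₂ v, ζ₁ y₁]) y₂
      + 1 / 2 * iteratedDeriv 2 (fun u => deriv X₁ u * deriv X₂ y₂ *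
          XYSwap.WhatDiag x y (ζ₁ u) * XYSwap.W x y 0 2 ![ζ₁ u, ζ₂ y₂]) y₁
      + 1 / 2 * iteratedDeriv 2 (fun v => deriv X₁ y₁ * deriv X₂ v *
          XYSwap.WhatDiag x y (ζ₂ v) * XYSwap.W x y 0 2 ![ζ₁ y₁, ζ₂ v]) y₂
      + 1 / 2 * deriv (fun u => deriv (fun v => deriv X₁ u * deriv X₂ v *
          XYSwap.W x y 0 2 ![ζ₁ u, ζ₂ v] * XYSwap.W x y 0 2 ![ζ₁ u, ζ₂ v]) y₂) y₁
      + 1 / 24 * iteratedDeriv 3 (fun u => (1 / deriv X₁ u) ^ 2 *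
          deriv (fun u' => deriv X₁ u' * deriv X₂ y₂ *
            XYSwap.W x y 0 2 ![ζ₁ u', ζ₂ y₂]) u) y₁
      + 1 / 24 * iteratedDeriv 3 (fun v => (1 / deriv X₂ v) ^ 2 *
          deriv (fun v' => deriv X₁ y₁ * deriv X₂ v' *
            XYSwap.W x y 0 2 ![ζ₁ y₁, ζ₂ v']) v) y₂ := by
  have n1x := hζ₁.notMem_badSet_left hy₁
  have n1y := hζ₁.notMem_badSet_right hy₁
  have n2x := hζ₂.notMem_badSet_left hy₂
  have n2y := hζ₂.notMem_badSet_right hy₂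
  have hz := (hne y₁ hy₁ y₂ hy₂).symm
  have t1 := hζ₁.sum_terms hxy.left hy₁ hz n2x (deriv X₂ y₂)
  have t2 := hζ₂.sum_terms hxy.left hy₂ hz.symm n1x (deriv X₁ y₁)
  have t3 := hζ₁.mixed_term hζ₂ hy₁ hy₂ fun u hu => hne u hu y₂ hy₂
  -- `IsInverseBranch.sum_terms` places the moving point first, so for the second variable the
  -- arguments of the symmetric kernel are exchanged.
  have c1 : ∀ v, XYSwap.W x y 0 2 ![ζ₂ v, ζ₁ y₁] = XYSwap.W x y 0 2 ![ζ₁ y₁, ζ₂ v] := fun v => by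
    rw [XYSwap.W, XYSwap.W, XYSwap.omega_zero_two, XYSwap.omega_zero_two, Fin.prod_univ_two,
      Fin.prod_univ_two]
    simp only [Matrix.cons_val_zero, Matrix.cons_val_one]
    rw [← neg_sub (ζ₁ y₁), neg_sq, mul_comm (deriv (XYSwap.ev x) (ζ₂ v))]
  have c2 : ∀ v, deriv X₂ v * deriv X₁ y₁ = deriv X₁ y₁ * deriv X₂ v := fun v => mul_comm _ _
  have s1 : XYSwap.W y x 1 2 ![ζ₁ y₁, ζ₂ y₂] = XYSwap.vec y (ζ₁ y₁) * XYSwap.vec y (ζ₂ y₂) *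
      (XYSwap.omega x y 1 2 ![ζ₁ y₁, ζ₂ y₂] + XYSwap.swapTerm x y (ζ₁ y₁) (ζ₂ y₂)) := by
    rw [XYSwap.W, hxy.omega_one_two_swap n1x n1y n2x n2y hz, Fin.prod_univ_two, div_eq_mul_inv,
      mul_inv, mul_comm]
    rfl
  have d1 : deriv X₁ y₁ = _ := hX₁ ▸ hζ₁.deriv_X hy₁
  have d2 : deriv X₂ y₂ = _ := hX₂ ▸ hζ₂.deriv_X hy₂
  have n1 := hζ₁.unramified y₁ hy₁
  have n2 := hζ₂.unramified y₂ hy₂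
  -- The Jacobian dX/dy turns division by dx into division by dy.
  have v1 : deriv X₁ y₁ * XYSwap.vec x (ζ₁ y₁) = XYSwap.vec y (ζ₁ y₁) := by
    rw [d1, mul_right_comm, XYSwap.vec.eq_def x, mul_inv_cancel₀ n1, one_mul]
  have v2 : deriv X₂ y₂ * XYSwap.vec x (ζ₂ y₂) = XYSwap.vec y (ζ₂ y₂) := by
    rw [d2, mul_right_comm, XYSwap.vec.eq_def x, mul_inv_cancel₀ n2, one_mul]
  have s2 : deriv X₁ y₁ * deriv X₂ y₂ * XYSwap.W x y 1 2 ![ζ₁ y₁, ζ₂ y₂] =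
      XYSwap.vec y (ζ₁ y₁) * XYSwap.vec y (ζ₂ y₂) * XYSwap.omega x y 1 2 ![ζ₁ y₁, ζ₂ y₂] := by
    rw [← v1, ← v2, XYSwap.W, Fin.prod_univ_two, div_eq_mul_inv, mul_inv]
    simp only [XYSwap.vec, Matrix.cons_val_zero, Matrix.cons_val_one]
    ring
  rw [v2, ← hX₁] at t1
  rw [v1, ← hX₂] at t2
  simp only [c1, c2] at t2
  rw [← hX₁, ← hX₂] at t3
  rw [s1, s2, XYSwap.swapTerm_eq hxy.left n1x n1y n2x n2y hz]
  linear_combination -t1 - t2 - 1 / 2 * t3
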